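/- Consider the real planar system \[ \dot x=-y,\qquad \dot y=a_{11}xy+a_{02}y^2+a_{30}x^3+a_{21}x^2y+a_{12}xy^2+a_{03}y^3,\qquad a_{ij}\in\mathbb R . \] The origin is a nilpotent center of this system if and only if it is a monodromy singular point and the four conditions \[ a_{21}-a_{02}a_{11}=0,\qquad a_{03}=0,\qquad a_{02}a_{11}a_{30}=0,\qquad a_{02}a_{11}(3a_{02}^2+2a_{12})=0 \] hold. Here a singular point $p$ is a center if it has a neighborhood $U$ such that all orbits in $U\setminus\{p\}$ are (nonconstant) periodic orbits. A center is nilpotent if, after an affine change of variables sending it to the origin and a rescaling of the time, the system takes the form $\dot x=y+F_1(x,y)$, $\dot y=F_2(x,y)$ with $F_1,F_2$ real analytic near the origin without constant and linear terms. A singular point $p$ is a monodromy singular point if it is isolated and there is no orbit other than $p$ itself that tends to $p$, in forward or backward time, with a definite tangent at $p$. -/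

import Mathlib

open Filter Topology

/-! Planar autonomous differential systems `q' = X q`, given by a vector field
`X : ℝ × ℝ → ℝ × ℝ`. -/

/-- The singular point `p` of `X` is a center: it has a neighborhood `U` such that every orbit
of `U \ {p}` is periodic (and is not a single singular point). -/
def IsCenter (X : ℝ × ℝ → ℝ × ℝ) (p : ℝ × ℝ) : Prop :=
  X p = 0 ∧ ∃ U ∈ 𝓝 p, ∀ q ∈ U, q ≠ p →
    X q ≠ 0 ∧ ∃ γ : ℝ → ℝ × ℝ, γ 0 = q ∧ (∀ t, HasDerivAt γ (X (γ t)) t) ∧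
      (∀ t, γ t ∈ U ∧ γ t ≠ p) ∧ ∃ T > 0, Function.Periodic γ T

/-- After an affine change of variables `q ↦ L (q - p)` and a rescaling of the time by `c`, the
system takes, near the origin, the form `x' = y + F₁(x, y)`, `y' = F₂(x, y)`, where `F₁` and `F₂`
are real analytic functions near the origin without constant and linear terms. -/
def HasNilpotentForm (X : ℝ × ℝ → ℝ × ℝ) (p : ℝ × ℝ) : Prop :=
  ∃ (L : (ℝ × ℝ) ≃ₗ[ℝ] (ℝ × ℝ)) (c : ℝ) (F₁ F₂ : ℝ × ℝ → ℝ),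
    0 < c ∧
    AnalyticAt ℝ F₁ 0 ∧ F₁ 0 = 0 ∧ fderiv ℝ F₁ 0 = 0 ∧
    AnalyticAt ℝ F₂ 0 ∧ F₂ 0 = 0 ∧ fderiv ℝ F₂ 0 = 0 ∧
    ∀ᶠ q in 𝓝 (0 : ℝ × ℝ), c • L (X (p + L.symm q)) = (q.2 + F₁ q, F₂ q)

/-- `p` is a nilpotent center of `X`. -/
def IsNilpotentCenter (X : ℝ × ℝ → ℝ × ℝ) (p : ℝ × ℝ) : Prop :=
  IsCenter X p ∧ HasNilpotentForm X p

/-- There is an orbit of `X`, other than `p` itself, that tends to `p`, in forward or in backward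
time, with a definite tangent at `p`: the direction of `γ t - p` converges. (Whether it does is
independent of the norm used to normalize `γ t - p`.) -/
def HasCharacteristicOrbit (X : ℝ × ℝ → ℝ × ℝ) (p : ℝ × ℝ) : Prop :=
  ∃ (γ : ℝ → ℝ × ℝ) (u : ℝ × ℝ),
    ((∀ t > 0, HasDerivAt γ (X (γ t)) t ∧ γ t ≠ p) ∧ Tendsto γ atTop (𝓝 p) ∧
      Tendsto (fun t => ‖γ t - p‖⁻¹ • (γ t - p)) atTop (𝓝 u)) ∨
    ((∀ t < 0, HasDerivAt γ (X (γ t)) t ∧ γ t ≠ p) ∧ Tendsto γ atBot (𝓝 p) ∧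
      Tendsto (fun t => ‖γ t - p‖⁻¹ • (γ t - p)) atBot (𝓝 u))

/-- `p` is a monodromy singular point of `X`: an isolated singular point without characteristic
orbits. -/
def IsMonodromic (X : ℝ × ℝ → ℝ × ℝ) (p : ℝ × ℝ) : Prop :=
  X p = 0 ∧ (∀ᶠ q in 𝓝[≠] p, X q ≠ 0) ∧ ¬ HasCharacteristicOrbit X p

/-- The system `x' = -y`, `y' = a₁₁xy + a₀₂y² + a₃₀x³ + a₂₁x²y + a₁₂xy² + a₀₃y³`. -/
def cubicField (a₁₁ a₀₂ a₃₀ a₂₁ a₁₂ a₀₃ : ℝ) (q : ℝ × ℝ) : ℝ × ℝ :=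
  (-q.2,
    a₁₁ * q.1 * q.2 + a₀₂ * q.2 ^ 2 + a₃₀ * q.1 ^ 3 + a₂₁ * q.1 ^ 2 * q.2
      + a₁₂ * q.1 * q.2 ^ 2 + a₀₃ * q.2 ^ 3)

/-! ### Ordinary differential equations -/

theorem ContDiff.exists_lipschitzOnWith_closedBall {v : ℝ × ℝ → ℝ × ℝ} (hv : ContDiff ℝ 1 v)
    (R : ℝ) : ∃ K, LipschitzOnWith K v (Metric.closedBall 0 R) :=
  hv.contDiffOn.exists_lipschitzOnWith one_ne_zero (convex_closedBall 0 R)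
    (isCompact_closedBall 0 R)

theorem exists_closedBall_of_continuousOn {f g : ℝ → ℝ × ℝ} {a b : ℝ}
    (hf : ContinuousOn f (Set.Icc a b)) (hg : ContinuousOn g (Set.Icc a b)) :
    ∃ R, ∀ t ∈ Set.Icc a b, f t ∈ Metric.closedBall 0 R ∧ g t ∈ Metric.closedBall 0 R := by
  obtain ⟨R₁, h₁⟩ := (isCompact_Icc.image_of_continuousOn hf).isBounded.subset_closedBall 0
  obtain ⟨R₂, h₂⟩ := (isCompact_Icc.image_of_continuousOn hg).isBounded.subset_closedBall 0
  exact ⟨max R₁ R₂, fun t ht =>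
    ⟨Metric.closedBall_subset_closedBall (le_max_left _ _) (h₁ ⟨t, ht, rfl⟩),
      Metric.closedBall_subset_closedBall (le_max_right _ _) (h₂ ⟨t, ht, rfl⟩)⟩⟩

theorem eqOn_Icc_of_eq_left {v : ℝ × ℝ → ℝ × ℝ} (hv : ContDiff ℝ 1 v) {f g : ℝ → ℝ × ℝ} {a b : ℝ}
    (hf : ∀ t ∈ Set.Icc a b, HasDerivAt f (v (f t)) t)
    (hg : ∀ t ∈ Set.Icc a b, HasDerivAt g (v (g t)) t) (h : f a = g a) :
    Set.EqOn f g (Set.Icc a b) := by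
  have cf : ContinuousOn f (Set.Icc a b) := fun t ht => (hf t ht).continuousAt.continuousWithinAt
  have cg : ContinuousOn g (Set.Icc a b) := fun t ht => (hg t ht).continuousAt.continuousWithinAt
  obtain ⟨R, hR⟩ := exists_closedBall_of_continuousOn cf cg
  obtain ⟨K, hK⟩ := hv.exists_lipschitzOnWith_closedBall R
  exact ODE_solution_unique_of_mem_Icc_right (v := fun _ => v) (s := fun _ => Metric.closedBall 0 R)
    (fun _ _ => hK) cf (fun t ht => (hf t ⟨ht.1, ht.2.le⟩).hasDerivWithinAt)
    (fun t ht => (hR t ⟨ht.1, ht.2.le⟩).1) cg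
    (fun t ht => (hg t ⟨ht.1, ht.2.le⟩).hasDerivWithinAt)
    (fun t ht => (hR t ⟨ht.1, ht.2.le⟩).2) h

theorem eqOn_Icc_of_eq_right {v : ℝ × ℝ → ℝ × ℝ} (hv : ContDiff ℝ 1 v) {f g : ℝ → ℝ × ℝ} {a b : ℝ}
    (hf : ∀ t ∈ Set.Icc a b, HasDerivAt f (v (f t)) t)
    (hg : ∀ t ∈ Set.Icc a b, HasDerivAt g (v (g t)) t) (h : f b = g b) :
    Set.EqOn f g (Set.Icc a b) := by
  have cf : ContinuousOn f (Set.Icc a b) := fun t ht => (hf t ht).continuousAt.continuousWithinAt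
  have cg : ContinuousOn g (Set.Icc a b) := fun t ht => (hg t ht).continuousAt.continuousWithinAt
  obtain ⟨R, hR⟩ := exists_closedBall_of_continuousOn cf cg
  obtain ⟨K, hK⟩ := hv.exists_lipschitzOnWith_closedBall R
  exact ODE_solution_unique_of_mem_Icc_left (v := fun _ => v) (s := fun _ => Metric.closedBall 0 R)
    (fun _ _ => hK) cf (fun t ht => (hf t ⟨ht.1.le, ht.2⟩).hasDerivWithinAt)
    (fun t ht => (hR t ⟨ht.1.le, ht.2⟩).1) cg
    (fun t ht => (hg t ⟨ht.1.le, ht.2⟩).hasDerivWithinAt)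
    (fun t ht => (hR t ⟨ht.1.le, ht.2⟩).2) h

/-- A bounded Lipschitz vector field has global integral curves. -/
theorem exists_integralCurve_of_lipschitzWith {v : ℝ × ℝ → ℝ × ℝ} {K : NNReal}
    (hv : LipschitzWith K v) {B : NNReal} (hB : ∀ q, ‖v q‖ ≤ B) (q₀ : ℝ × ℝ) :
    ∃ γ : ℝ → ℝ × ℝ, γ 0 = q₀ ∧ ∀ t, HasDerivAt γ (v (γ t)) t := by
  have key : ∀ n : ℕ, ∃ γ : ℝ → ℝ × ℝ, γ 0 = q₀ ∧
      ∀ t ∈ Set.Ioo (-(n + 1 : ℝ)) (n + 1), HasDerivAt γ (v (γ t)) t := by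
    intro n
    have h0 : (0 : ℝ) ∈ Set.Icc (-(n + 1 : ℝ)) (n + 1) := by
      constructor <;> linarith [n.cast_nonneg (α := ℝ)]
    have hpl : IsPicardLindelof (fun _ => v) (⟨0, h0⟩ : Set.Icc (-(n + 1 : ℝ)) (n + 1)) q₀
        (B * (n + 1)) 0 B K := by
      refine IsPicardLindelof.of_time_independent (fun x _ => hB x) hv.lipschitzOnWith ?_
      simp
    obtain ⟨γ, h1, h2⟩ := hpl.exists_eq_forall_mem_Icc_hasDerivWithinAt₀
    exact ⟨γ, h1, fun t ht => (h2 t ⟨ht.1.le, ht.2.le⟩).hasDerivAt (Icc_mem_nhds ht.1 ht.2)⟩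
  choose γ hγ0 hγ using key
  have agree : ∀ m n : ℕ, m ≤ n → Set.EqOn (γ m) (γ n) (Set.Ioo (-(m + 1 : ℝ)) (m + 1)) := by
    intro m n hmn
    have hmn' : (m : ℝ) ≤ n := Nat.cast_le.2 hmn
    have hm : (0 : ℝ) ≤ m := Nat.cast_nonneg _
    refine ODE_solution_unique_of_mem_Ioo (v := fun _ => v) (s := fun _ => Set.univ) (t₀ := 0)
      (fun _ _ => hv.lipschitzOnWith) ⟨by linarith, by linarith⟩
      (fun t ht => ⟨hγ m t ht, trivial⟩)
      (fun t ht => ⟨hγ n t ⟨by linarith [ht.1], by linarith [ht.2]⟩, trivial⟩) ?_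
    rw [hγ0, hγ0]
  have hmem : ∀ t : ℝ, t ∈ Set.Ioo (-((⌈|t|⌉₊ : ℝ) + 1)) (⌈|t|⌉₊ + 1) := by
    intro t
    have := Nat.le_ceil |t|
    constructor <;> linarith [neg_abs_le t, le_abs_self t]
  refine ⟨fun t => γ ⌈|t|⌉₊ t, by simpa using hγ0 0, fun t => ?_⟩
  refine (hγ _ t (hmem t)).congr_of_eventuallyEq ?_
  filter_upwards [Ioo_mem_nhds (hmem t).1 (hmem t).2] with s hs
  rcases le_total ⌈|s|⌉₊ ⌈|t|⌉₊ with h | h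
  · exact agree _ _ h (hmem s)
  · exact (agree _ _ h hs).symm

/-- Truncation of the plane to a square. -/
def clampSquare (δ : ℝ) (q : ℝ × ℝ) : ℝ × ℝ := (max (-δ) (min δ q.1), max (-δ) (min δ q.2))

theorem lipschitzWith_clampSquare (δ : ℝ) : LipschitzWith 1 (clampSquare δ) := by
  have h : LipschitzWith 1 fun x : ℝ => max (-δ) (min δ x) :=
    (LipschitzWith.id.const_min δ).const_max (-δ)
  have := (h.comp LipschitzWith.prod_fst).prodMk (h.comp (LipschitzWith.prod_snd (α := ℝ) (β := ℝ)))
  have h' : LipschitzWith 1 fun q : ℝ × ℝ => (max (-δ) (min δ q.1), max (-δ) (min δ q.2)) := by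
    simpa using this
  exact h'

theorem clampSquare_eq_self {δ : ℝ} {q : ℝ × ℝ} (h₁ : |q.1| ≤ δ) (h₂ : |q.2| ≤ δ) :
    clampSquare δ q = q := by
  rw [abs_le] at h₁ h₂
  ext <;> simp [clampSquare, h₁, h₂]

theorem clampSquare_mem {δ : ℝ} (hδ : 0 ≤ δ) (q : ℝ × ℝ) :
    clampSquare δ q ∈ Metric.closedBall (0 : ℝ × ℝ) δ := by
  rw [mem_closedBall_zero_iff, Prod.norm_def, max_le_iff]
  simp only [clampSquare, Real.norm_eq_abs, abs_le]
  refine ⟨⟨le_max_left _ _, max_le (by linarith) (min_le_left _ _)⟩,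
    ⟨le_max_left _ _, max_le (by linarith) (min_le_left _ _)⟩⟩

theorem lipschitz_comp_clampSquare {v : ℝ × ℝ → ℝ × ℝ} (hv : ContDiff ℝ 1 v) {δ : ℝ}
    (hδ : 0 ≤ δ) : (∃ K, LipschitzWith K (v ∘ clampSquare δ)) ∧
      ∃ B : NNReal, ∀ q, ‖(v ∘ clampSquare δ) q‖ ≤ B := by
  constructor
  · obtain ⟨K, hK⟩ := hv.exists_lipschitzOnWith_closedBall δ
    refine ⟨K * 1, ?_⟩
    rw [← lipschitzOnWith_univ]
    exact hK.comp (lipschitzWith_clampSquare δ).lipschitzOnWith fun q _ => clampSquare_mem hδ q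
  · obtain ⟨C, hC⟩ := (isCompact_closedBall (0 : ℝ × ℝ) δ).exists_bound_of_continuousOn
      hv.continuous.continuousOn
    exact ⟨C.toNNReal, fun q => (hC _ (clampSquare_mem hδ q)).trans (Real.le_coe_toNNReal C)⟩

theorem exists_integralCurve_clampSquare {v : ℝ × ℝ → ℝ × ℝ} (hv : ContDiff ℝ 1 v) {δ : ℝ}
    (hδ : 0 ≤ δ) (q₀ : ℝ × ℝ) :
    ∃ γ : ℝ → ℝ × ℝ, γ 0 = q₀ ∧ ∀ t, HasDerivAt γ (v (clampSquare δ (γ t))) t := by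
  obtain ⟨⟨K, hK⟩, B, hB⟩ := lipschitz_comp_clampSquare hv hδ
  exact exists_integralCurve_of_lipschitzWith hK hB q₀

theorem LipschitzWith.eq_of_integralCurves {v : ℝ × ℝ → ℝ × ℝ} {K : NNReal}
    (hv : LipschitzWith K v) {f g : ℝ → ℝ × ℝ} (hf : ∀ t, HasDerivAt f (v (f t)) t)
    (hg : ∀ t, HasDerivAt g (v (g t)) t) {t₀ : ℝ} (h : f t₀ = g t₀) : f = g :=
  ODE_solution_unique_univ (v := fun _ => v) (s := fun _ => Set.univ)
    (fun _ => hv.lipschitzOnWith) (fun t => ⟨hf t, trivial⟩) (fun t => ⟨hg t, trivial⟩) h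

theorem cubicField_contDiff (a c A b d e : ℝ) : ContDiff ℝ 1 (cubicField a c A b d e) := by
  unfold cubicField
  fun_prop

theorem cubicField_zero (a c A b d e : ℝ) : cubicField a c A b d e (0, 0) = 0 := by
  simp [cubicField]

/-! ### Centers are monodromic -/

theorem IsCenter.isMonodromic {X : ℝ × ℝ → ℝ × ℝ} (hX : ContDiff ℝ 1 X) {p : ℝ × ℝ}
    (h : IsCenter X p) : IsMonodromic X p := by
  obtain ⟨hp, U, hU, hc⟩ := h
  refine ⟨hp, ?_, ?_⟩
  · filter_upwards [nhdsWithin_le_nhds hU, self_mem_nhdsWithin] with q hq hq'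
    exact (hc q hq hq').1
  · rintro ⟨γ, u, ⟨hγ, hlim, -⟩ | ⟨hγ, hlim, -⟩⟩
    · obtain ⟨t₀, ht₀U, ht₀⟩ := ((hlim.eventually_mem hU).and (eventually_gt_atTop 0)).exists
      obtain ⟨-, g, hg0, hg, hgU, T, hT, hper⟩ := hc _ ht₀U (hγ t₀ ht₀).2
      have key : ∀ n : ℕ, γ (t₀ + n * T) = γ t₀ := by
        intro n
        have hn : 0 ≤ (n : ℝ) * T := by positivity
        have := eqOn_Icc_of_eq_left hX (f := γ) (g := fun t => g (t - t₀)) (a := t₀)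
          (b := t₀ + n * T) (fun t ht => (hγ t (ht₀.trans_le ht.1)).1)
          (fun t _ => (hg (t - t₀)).comp_sub_const t t₀) (by simp [hg0])
          (Set.right_mem_Icc.2 (by linarith))
        rw [this]
        simpa [hg0] using hper.nat_mul n 0
      have h1 : Tendsto (fun n : ℕ => γ (t₀ + n * T)) atTop (𝓝 p) :=
        hlim.comp (tendsto_atTop_add_const_left _ _
          (tendsto_natCast_atTop_atTop.atTop_mul_const hT))
      simp only [key] at h1
      exact (hγ t₀ ht₀).2 (tendsto_nhds_unique tendsto_const_nhds h1)
    · obtain ⟨t₀, ht₀U, ht₀⟩ := ((hlim.eventually_mem hU).and (eventually_lt_atBot 0)).exists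
      obtain ⟨-, g, hg0, hg, hgU, T, hT, hper⟩ := hc _ ht₀U (hγ t₀ ht₀).2
      have key : ∀ n : ℕ, γ (t₀ - n * T) = γ t₀ := by
        intro n
        have hn : 0 ≤ (n : ℝ) * T := by positivity
        have := eqOn_Icc_of_eq_right hX (f := γ) (g := fun t => g (t - t₀)) (b := t₀)
          (a := t₀ - n * T) (fun t ht => (hγ t (ht.2.trans_lt ht₀)).1)
          (fun t _ => (hg (t - t₀)).comp_sub_const t t₀) (by simp [hg0])
          (Set.left_mem_Icc.2 (by linarith))
        rw [this]
        have h2 := hper.nat_mul n (-(n * T))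
        simp only [neg_add_cancel, hg0] at h2
        simp [h2]
      have h1 : Tendsto (fun n : ℕ => γ (t₀ - n * T)) atTop (𝓝 p) := by
        refine hlim.comp ?_
        simp only [sub_eq_add_neg]
        exact tendsto_atBot_add_const_left _ _ (tendsto_neg_atTop_atBot.comp
          (tendsto_natCast_atTop_atTop.atTop_mul_const hT))
      simp only [key] at h1
      exact (hγ t₀ ht₀).2 (tendsto_nhds_unique tendsto_const_nhds h1)

/-! ### Characteristic orbits -/

theorem forall_pos_or_exists_first_zero {F : ℝ → ℝ} (hF : Continuous F) (h0 : 0 < F 0) :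
    (∀ t, 0 ≤ t → 0 < F t) ∨ ∃ T, 0 < T ∧ F T = 0 ∧ ∀ t, 0 ≤ t → t < T → 0 < F t := by
  by_cases h : ∀ t, 0 ≤ t → 0 < F t
  · exact Or.inl h
  right
  push Not at h
  obtain ⟨t₁, ht₁, hF₁⟩ := h
  set S := {t | 0 ≤ t ∧ F t ≤ 0} with hS
  have hcl : IsClosed S := isClosed_Ici.inter (isClosed_le hF continuous_const)
  have hbd : BddBelow S := ⟨0, fun t ht => ht.1⟩
  have hmem : sInf S ∈ S := hcl.csInf_mem ⟨t₁, ht₁, hF₁⟩ hbd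
  have hbefore : ∀ t, 0 ≤ t → t < sInf S → 0 < F t := by
    intro t ht htS
    by_contra hcon
    exact absurd (csInf_le hbd (show t ∈ S from ⟨ht, not_lt.1 hcon⟩)) (not_le.2 htS)
  have hpos : 0 < sInf S := by
    rcases hmem.1.eq_or_lt with h | h
    · have := hmem.2
      rw [← h] at this
      linarith
    · exact h
  refine ⟨sInf S, hpos, le_antisymm hmem.2 ?_, hbefore⟩
  have hev : ∀ᶠ t in 𝓝[<] (sInf S), 0 ≤ F t := by
    filter_upwards [Ioo_mem_nhdsLT hpos] with t ht
    exact (hbefore t ht.1.le ht.2).le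
  exact ge_of_tendsto (hF.continuousAt.tendsto.mono_left nhdsWithin_le_nhds) hev

theorem deriv_nonpos_of_first_zero {f : ℝ → ℝ} {f' T : ℝ} (hT : 0 < T) (hf : HasDerivAt f f' T)
    (h0 : f T = 0) (hpos : ∀ t, 0 ≤ t → t < T → 0 ≤ f t) : f' ≤ 0 := by
  have h1 := (hasDerivAt_iff_tendsto_slope.1 hf).mono_left
    (nhdsWithin_mono T (show Set.Iio T ⊆ {T}ᶜ from fun x hx => ne_of_lt hx))
  refine le_of_tendsto h1 ?_
  filter_upwards [Ioo_mem_nhdsLT hT] with t ht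
  rw [slope_def_field, h0, sub_zero]
  exact div_nonpos_of_nonneg_of_nonpos (hpos t ht.1.le ht.2) (by linarith [ht.2])

theorem hasCharacteristicOrbit_of_parabolic_sector {a c A b d e lo hi : ℝ} (hlo : 0 < lo)
    {γ : ℝ → ℝ × ℝ} (hγ : ∀ t > 0, HasDerivAt γ (cubicField a c A b d e (γ t)) t)
    (hx : ∀ t > 0, 0 < (γ t).1)
    (hy : ∀ t > 0, lo * (γ t).1 ^ 2 ≤ (γ t).2 ∧ (γ t).2 ≤ hi * (γ t).1 ^ 2) :
    HasCharacteristicOrbit (cubicField a c A b d e) (0, 0) := by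
  have hhi : 0 < hi := by
    have h1 := hy 1 one_pos
    have h2 := hx 1 one_pos
    nlinarith [pow_pos h2 2]
  have hd : ∀ t > 0, HasDerivAt (fun t => ((γ t).1)⁻¹ - lo * t) ((γ t).2 / (γ t).1 ^ 2 - lo) t := by
    intro t ht
    have h1 : HasDerivAt (fun t => (γ t).1) (-(γ t).2) t := (hγ t ht).fst
    have h2 := (h1.inv (hx t ht).ne').sub ((hasDerivAt_id t).const_mul lo)
    exact h2.congr_deriv (by ring)
  have hmono : MonotoneOn (fun t => ((γ t).1)⁻¹ - lo * t) (Set.Ioi 0) := by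
    refine monotoneOn_of_deriv_nonneg (convex_Ioi 0)
      (fun t ht => (hd t ht).continuousAt.continuousWithinAt)
      (fun t ht => (hd t (interior_subset ht)).differentiableAt.differentiableWithinAt) ?_
    intro t ht
    have ht := interior_subset ht
    rw [(hd t ht).deriv, sub_nonneg, le_div_iff₀ (pow_pos (hx t ht) 2)]
    exact (hy t ht).1
  have hbound : ∀ t, 1 < t → (γ t).1 ≤ (lo * (t - 1))⁻¹ := by
    intro t ht
    have h1 := hmono (Set.mem_Ioi.2 one_pos) (Set.mem_Ioi.2 (by linarith : (0:ℝ) < t)) ht.le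
    have h2 : 0 < ((γ 1).1)⁻¹ := inv_pos.2 (hx 1 one_pos)
    simp only at h1
    rw [le_inv_comm₀ (hx t (by linarith)) (mul_pos hlo (by linarith))]
    linarith
  have hx0 : Tendsto (fun t => (γ t).1) atTop (𝓝 0) := by
    have h1 : Tendsto (fun t : ℝ => (lo * (t - 1))⁻¹) atTop (𝓝 0) :=
      tendsto_inv_atTop_zero.comp ((tendsto_atTop_add_const_right _ _ tendsto_id).const_mul_atTop hlo)
    refine squeeze_zero' ?_ ?_ h1
    · filter_upwards [eventually_gt_atTop 0] with t ht using (hx t ht).le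
    · filter_upwards [eventually_gt_atTop 1] with t ht using hbound t ht
  have hhx : Tendsto (fun t => hi * (γ t).1) atTop (𝓝 0) := by simpa using hx0.const_mul hi
  have hhx2 : Tendsto (fun t => hi * (γ t).1 ^ 2) atTop (𝓝 0) := by
    simpa using (hx0.pow 2).const_mul hi
  have hy0 : Tendsto (fun t => (γ t).2) atTop (𝓝 0) := by
    refine squeeze_zero' ?_ ?_ hhx2
    · filter_upwards [eventually_gt_atTop 0] with t ht
      have := hy t ht
      have := hx t ht
      nlinarith [pow_pos this 2]
    · filter_upwards [eventually_gt_atTop 0] with t ht using (hy t ht).2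
  refine ⟨γ, (1, 0), Or.inl ⟨fun t ht => ⟨hγ t ht, fun h => ?_⟩, ?_, ?_⟩⟩
  · have := hx t ht
    rw [h] at this
    exact lt_irrefl _ this
  · exact hx0.prodMk_nhds hy0
  · have hq : Tendsto (fun t => (γ t).2 / (γ t).1) atTop (𝓝 0) := by
      refine squeeze_zero' ?_ ?_ hhx
      · filter_upwards [eventually_gt_atTop 0] with t ht
        have h1 := hy t ht
        have h2 := hx t ht
        exact div_nonneg (by nlinarith [pow_pos h2 2]) h2.le
      · filter_upwards [eventually_gt_atTop 0] with t ht
        rw [div_le_iff₀ (hx t ht)]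
        linarith [(hy t ht).2]
    have h1 : Tendsto (fun t => ((1 : ℝ), (γ t).2 / (γ t).1)) atTop (𝓝 (1, 0)) :=
      tendsto_const_nhds.prodMk_nhds hq
    refine h1.congr' ?_
    filter_upwards [eventually_gt_atTop 0, hhx.eventually_le_const one_pos] with t ht h2
    have h3 := hx t ht
    have h4 : |(γ t).2| ≤ (γ t).1 := by
      rw [abs_of_nonneg (by nlinarith [pow_pos h3 2, hy t ht])]
      nlinarith [(hy t ht).2]
    have h5 : ‖γ t - (0, 0)‖ = (γ t).1 := by
      rw [Prod.norm_def]
      simp only [Prod.fst_sub, Prod.snd_sub, sub_zero, Real.norm_eq_abs]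
      rw [abs_of_pos h3, max_eq_left h4]
    rw [h5]
    ext
    · simp [h3.ne']
    · simp [div_eq_inv_mul]

theorem cubicField_fst_snd_hasDerivAt {a c A b d e σ : ℝ} {γ : ℝ → ℝ × ℝ} {t : ℝ}
    (hγ : HasDerivAt γ (σ • cubicField a c A b d e (clampSquare 1 (γ t))) t)
    (h₁ : |(γ t).1| ≤ 1) (h₂ : |(γ t).2| ≤ 1) :
    HasDerivAt (fun s => (γ s).1) (σ * -(γ t).2) t ∧
      HasDerivAt (fun s => (γ s).2) (σ * (a * (γ t).1 * (γ t).2 + c * (γ t).2 ^ 2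
        + A * (γ t).1 ^ 3 + b * (γ t).1 ^ 2 * (γ t).2 + d * (γ t).1 * (γ t).2 ^ 2
        + e * (γ t).2 ^ 3)) t := by
  rw [clampSquare_eq_self h₁ h₂] at hγ
  exact ⟨hγ.fst, hγ.snd⟩

theorem ne_zero_of_clamped_integralCurve {a c A b d e σ : ℝ} {γ : ℝ → ℝ × ℝ}
    (hγ : ∀ t, HasDerivAt γ (σ • cubicField a c A b d e (clampSquare 1 (γ t))) t)
    {t₀ : ℝ} (h0 : γ t₀ ≠ 0) (t : ℝ) : γ t ≠ 0 := by
  intro ht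
  obtain ⟨⟨K, hK⟩, -⟩ := lipschitz_comp_clampSquare
    ((cubicField_contDiff a c A b d e).const_smul σ) zero_le_one
  have hz : clampSquare 1 (0 : ℝ × ℝ) = 0 := clampSquare_eq_self (by simp) (by simp)
  have hz' : ((fun q => σ • cubicField a c A b d e q) ∘ clampSquare 1) 0 = 0 := by
    rw [Function.comp_apply, hz, show (0 : ℝ × ℝ) = (0, 0) from rfl, cubicField_zero, smul_zero]
    rfl
  have := hK.eq_of_integralCurves (f := γ) (g := fun _ => 0) (t₀ := t) hγ
    (fun s => (hasDerivAt_const s (0 : ℝ × ℝ)).congr_deriv hz'.symm) ht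
  exact h0 (by rw [this])

theorem hasCharacteristicOrbit_of_node {a c A b d e : ℝ} (hA : 0 < A) (ha : a < 0)
    (hdisc : 8 * A ≤ a ^ 2) : HasCharacteristicOrbit (cubicField a c A b d e) (0, 0) := by
  obtain ⟨lo, hlo⟩ : ∃ lo, lo = A / (2 * -a) := ⟨_, rfl⟩
  obtain ⟨hi, hhi⟩ : ∃ hi, hi = -a / 4 := ⟨_, rfl⟩
  have hlo0 : 0 < lo := by rw [hlo]; exact div_pos hA (by linarith)
  have hhi0 : 0 < hi := by rw [hhi]; linarith
  have halo : a * lo = -A / 2 := by have := ha.ne; rw [hlo]; field_simp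
  have hlohi : lo < hi := by
    rw [hlo, hhi, div_lt_div_iff₀ (by linarith) (by norm_num)]
    nlinarith
  obtain ⟨C, hC⟩ : ∃ C, C = |c * hi + b| + 1 := ⟨_, rfl⟩
  have hC0 : 0 < C := by rw [hC]; positivity
  have hC1 : c * hi + b < C := by rw [hC]; linarith [le_abs_self (c * hi + b)]
  have ev : ∀ᶠ x in 𝓝 (0 : ℝ), x < 1 ∧ hi * x < 1 ∧ lo < hi - C * x ∧
      0 < 2 * lo ^ 2 + a * lo + A + x * (c * lo ^ 2 + b * lo) + d * lo ^ 2 * x ^ 2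
        + e * lo ^ 3 * x ^ 3 ∧
      2 * hi * C - 3 * C * (hi - C * x) + c * (hi - C * x) ^ 2 + b * (hi - C * x)
        + x * d * (hi - C * x) ^ 2 + x ^ 2 * e * (hi - C * x) ^ 3 < 0 := by
    refine (eventually_lt_nhds one_pos).and (Eventually.and ?_ (Eventually.and ?_ (Eventually.and ?_ ?_)))
    · exact (by fun_prop : Continuous fun x : ℝ => hi * x).continuousAt.eventually_lt_const (by simp)
    · exact (by fun_prop : Continuous fun x : ℝ => hi - C * x).continuousAt.eventually_const_lt
        (by simpa using hlohi)
    · refine (by fun_prop : Continuous fun x : ℝ => 2 * lo ^ 2 + a * lo + A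
        + x * (c * lo ^ 2 + b * lo) + d * lo ^ 2 * x ^ 2
        + e * lo ^ 3 * x ^ 3).continuousAt.eventually_const_lt ?_
      simp only [zero_mul, mul_zero, ne_eq, OfNat.ofNat_ne_zero, not_false_eq_true, zero_pow]
      nlinarith [pow_pos hlo0 2]
    · refine (by fun_prop : Continuous fun x : ℝ => 2 * hi * C - 3 * C * (hi - C * x)
        + c * (hi - C * x) ^ 2 + b * (hi - C * x)
        + x * d * (hi - C * x) ^ 2 + x ^ 2 * e * (hi - C * x) ^ 3).continuousAt.eventually_lt_const ?_
      simp only [zero_mul, mul_zero, ne_eq, OfNat.ofNat_ne_zero, not_false_eq_true, zero_pow,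
        sub_zero, add_zero]
      nlinarith
  obtain ⟨x₁, hx₁0, hx₁⟩ := mem_nhdsGT_iff_exists_Ioc_subset.1 (nhdsWithin_le_nhds (s := Set.Ioi 0) ev)
  simp only [Set.mem_Ioi] at hx₁0
  have hsm := hx₁ (Set.right_mem_Ioc.2 hx₁0)
  obtain ⟨γ, hγ0, hγ⟩ := exists_integralCurve_clampSquare (cubicField_contDiff a c A b d e)
    zero_le_one (x₁ / 2, (lo + (hi - C * (x₁ / 2))) / 2 * (x₁ / 2) ^ 2)
  have hγ' : ∀ t, HasDerivAt γ ((1 : ℝ) • cubicField a c A b d e (clampSquare 1 (γ t))) t := by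
    simpa using hγ
  have hcont : Continuous γ := continuous_iff_continuousAt.2 fun t => (hγ t).continuousAt
  have hbox : ∀ x y : ℝ, 0 ≤ x → x ≤ x₁ → lo * x ^ 2 ≤ y → y ≤ hi * x ^ 2 - C * x ^ 3 →
      |x| ≤ 1 ∧ |y| ≤ 1 := by
    intro x y h1 h2 h3 h4
    have h5 : x ≤ 1 := h2.trans hsm.1.le
    have h6 : hi * x ≤ 1 := (mul_le_mul_of_nonneg_left h2 hhi0.le).trans hsm.2.1.le
    have h7 : 0 ≤ y := le_trans (by positivity) h3
    have h8 : 0 ≤ C * x ^ 3 := by positivity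
    refine ⟨by rwa [abs_of_nonneg h1], ?_⟩
    rw [abs_of_nonneg h7]
    nlinarith
  set F : ℝ → ℝ := fun t => min (min ((γ t).1) (x₁ - (γ t).1))
    (min ((γ t).2 - lo * (γ t).1 ^ 2) (hi * (γ t).1 ^ 2 - C * (γ t).1 ^ 3 - (γ t).2)) with hF
  have hFc : Continuous F := by fun_prop
  have hF0 : 0 < F 0 := by
    have h1 := hx₁ (show x₁ / 2 ∈ Set.Ioc 0 x₁ from ⟨by linarith, by linarith⟩)
    have h2 := h1.2.2.1
    have h3 : 0 < (x₁ / 2) ^ 2 := by positivity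
    simp only [hF, hγ0, lt_min_iff]
    refine ⟨⟨by linarith, by linarith⟩, by nlinarith, by nlinarith⟩
  have hstay : ∀ t, 0 ≤ t → 0 < F t := by
    rcases forall_pos_or_exists_first_zero hFc hF0 with h | ⟨T, hT, hFT, hbef⟩
    · exact h
    exfalso
    have hge : 0 ≤ F T := hFT.ge
    simp only [hF, le_min_iff] at hge
    obtain ⟨⟨g1, g2⟩, g3, g4⟩ := hge
    obtain ⟨hb1, hb2⟩ := hbox _ _ g1 (by linarith) (by linarith) (by linarith)
    obtain ⟨dx, dy⟩ := cubicField_fst_snd_hasDerivAt (hγ' T) hb1 hb2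
    simp only [one_mul] at dx dy
    have hx0 : 0 < (γ T).1 := by
      rcases g1.eq_or_lt with h | h
      · exfalso
        refine ne_zero_of_clamped_integralCurve hγ' (t₀ := 0) ?_ T ?_
        · rw [hγ0]
          intro h
          have := congrArg Prod.fst h
          simp at this
          linarith
        · rw [← h] at g3 g4
          ext
          · exact h.symm
          · simp only [ne_eq, OfNat.ofNat_ne_zero, not_false_eq_true, zero_pow, mul_zero, sub_zero,
              zero_sub] at g3 g4
            exact le_antisymm (by simpa using g4) g3
      · exact h
    have hy0 : 0 < (γ T).2 := by nlinarith [pow_pos hx0 2]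
    have hbef' : ∀ t, 0 ≤ t → t < T → (0 < (γ t).1 ∧ 0 < x₁ - (γ t).1) ∧
        0 < (γ t).2 - lo * (γ t).1 ^ 2 ∧ 0 < hi * (γ t).1 ^ 2 - C * (γ t).1 ^ 3 - (γ t).2 := by
      intro t h1 h2
      have := hbef t h1 h2
      simpa only [hF, lt_min_iff] using this
    have hsT := hx₁ (show (γ T).1 ∈ Set.Ioc 0 x₁ from ⟨hx0, by linarith⟩)
    have hx3 : 0 < (γ T).1 ^ 3 := by positivity
    simp only [hF] at hFT
    generalize hX : (γ T).1 = x at *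
    generalize hY : (γ T).2 = y at *
    have e2 : 0 < x₁ - x := by
      refine g2.lt_of_ne fun h => ?_
      have := deriv_nonpos_of_first_zero hT (dx.const_sub x₁) (by rw [hX]; exact h.symm)
        fun t h1 h2 => (hbef' t h1 h2).1.2.le
      linarith
    have e3 : 0 < y - lo * x ^ 2 := by
      refine g3.lt_of_ne fun h => ?_
      have h1 := deriv_nonpos_of_first_zero hT (dy.sub ((dx.pow 2).const_mul lo))
        (by simp only [Pi.sub_apply, Pi.pow_apply]; rw [hX, hY]; exact h.symm)
        fun t h1 h2 => (hbef' t h1 h2).2.1.le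
      rw [hX, show y = lo * x ^ 2 by linarith] at h1
      have h2 := mul_pos hx3 hsT.2.2.2.1
      simp only [Nat.cast_ofNat, Nat.reduceSub, pow_one] at h1
      linarith
    have e4 : 0 < hi * x ^ 2 - C * x ^ 3 - y := by
      refine g4.lt_of_ne fun h => ?_
      have h1 := deriv_nonpos_of_first_zero hT
        ((((dx.pow 2).const_mul hi).sub ((dx.pow 3).const_mul C)).sub dy)
        (by simp only [Pi.sub_apply, Pi.pow_apply]; rw [hX, hY]; exact h.symm)
        fun t h1 h2 => (hbef' t h1 h2).2.2.le
      have hy : y = x ^ 2 * (hi - C * x) := by linarith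
      have ha4 : a = -4 * hi := by rw [hhi]; ring
      have h2 := mul_neg_of_pos_of_neg (mul_pos hx0 hx3) hsT.2.2.2.2
      have h3 : 0 ≤ x ^ 3 * (2 * hi ^ 2 - A) :=
        mul_nonneg hx3.le (by rw [ha4] at hdisc; nlinarith)
      rw [hX, hy, ha4] at h1
      simp only [Nat.cast_ofNat, Nat.reduceSub, pow_one] at h1
      linarith
    exact absurd hFT (lt_min (lt_min hx0 e2) (lt_min e3 e4)).ne'
  have hst : ∀ t, 0 ≤ t → (0 < (γ t).1 ∧ 0 < x₁ - (γ t).1) ∧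
      0 < (γ t).2 - lo * (γ t).1 ^ 2 ∧ 0 < hi * (γ t).1 ^ 2 - C * (γ t).1 ^ 3 - (γ t).2 := by
    intro t h1
    have := hstay t h1
    simpa only [hF, lt_min_iff] using this
  refine hasCharacteristicOrbit_of_parabolic_sector (γ := γ) (hi := hi) hlo0 (fun t ht => ?_)
    (fun t ht => (hst t ht.le).1.1) (fun t ht => ?_)
  · obtain ⟨⟨h1, h2⟩, h3, h4⟩ := hst t ht.le
    obtain ⟨hb1, hb2⟩ := hbox _ _ h1.le (by linarith) (by linarith) (by linarith)
    have := hγ t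
    rwa [clampSquare_eq_self hb1 hb2] at this
  · obtain ⟨⟨h1, h2⟩, h3, h4⟩ := hst t ht.le
    have : 0 ≤ C * (γ t).1 ^ 3 := by positivity
    exact ⟨by linarith, by linarith⟩

/-- Near a saddle-like singular point, backward orbits in a parabolic sector leave it through a
transversal. -/
theorem exists_backward_exit_time {a c A b d e lo hi x₁ : ℝ} (hlo : 0 < lo)
    (hx₁ : x₁ ≤ 1) (hhi : hi * x₁ ≤ 1)
    (hG : ∀ x, 0 < x → x ≤ x₁ → 2 * lo ^ 2 + a * lo + A + x * (c * lo ^ 2 + b * lo)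
        + d * lo ^ 2 * x ^ 2 + e * lo ^ 3 * x ^ 3 < 0 ∧
      0 < 2 * hi ^ 2 + a * hi + A + x * (c * hi ^ 2 + b * hi)
        + d * hi ^ 2 * x ^ 2 + e * hi ^ 3 * x ^ 3)
    {γ : ℝ → ℝ × ℝ}
    (hγ : ∀ t, HasDerivAt γ ((-1 : ℝ) • cubicField a c A b d e (clampSquare 1 (γ t))) t)
    (h0 : 0 < (γ 0).1) (h1 : (γ 0).1 < x₁) (h2 : lo * (γ 0).1 ^ 2 < (γ 0).2)
    (h3 : (γ 0).2 < hi * (γ 0).1 ^ 2) :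
    ∃ T, 0 < T ∧ (γ 0).1⁻¹ - x₁⁻¹ ≤ hi * T ∧ (γ T).1 = x₁ ∧ ∀ t, 0 ≤ t → t ≤ T →
      0 < (γ t).1 ∧ (γ t).1 ≤ x₁ ∧ lo * (γ t).1 ^ 2 ≤ (γ t).2 ∧ (γ t).2 ≤ hi * (γ t).1 ^ 2 := by
  have hcont : Continuous γ := continuous_iff_continuousAt.2 fun t => (hγ t).continuousAt
  obtain ⟨x₀, hx₀⟩ : ∃ x₀, x₀ = (γ 0).1 := ⟨_, rfl⟩
  rw [← hx₀] at h0 h1 h2 h3 ⊢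
  have hlohi : lo < hi := by
    have : 0 < x₀ ^ 2 := by positivity
    nlinarith
  have hhi0 : 0 < hi := hlo.trans hlohi
  have hbox : ∀ x y : ℝ, 0 ≤ x → x ≤ x₁ → lo * x ^ 2 ≤ y → y ≤ hi * x ^ 2 →
      |x| ≤ 1 ∧ |y| ≤ 1 := by
    intro x y g1 g2 g3 g4
    have h5 : x ≤ 1 := g2.trans hx₁
    have h6 : hi * x ≤ 1 := (mul_le_mul_of_nonneg_left g2 hhi0.le).trans hhi
    have h7 : 0 ≤ y := le_trans (by positivity) g3
    refine ⟨by rwa [abs_of_nonneg g1], ?_⟩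
    rw [abs_of_nonneg h7]
    nlinarith
  set F : ℝ → ℝ := fun t => min (min ((γ t).1 - x₀ / 2) (x₁ - (γ t).1))
    (min ((γ t).2 - lo * (γ t).1 ^ 2) (hi * (γ t).1 ^ 2 - (γ t).2)) with hF
  have hFc : Continuous F := by fun_prop
  have hF0 : 0 < F 0 := by
    simp only [hF, lt_min_iff, ← hx₀]
    refine ⟨⟨by linarith, by linarith⟩, by linarith, by linarith⟩
  have hFi : ∀ t, 0 < F t → ((0 < (γ t).1 - x₀ / 2 ∧ 0 < x₁ - (γ t).1) ∧
      0 < (γ t).2 - lo * (γ t).1 ^ 2 ∧ 0 < hi * (γ t).1 ^ 2 - (γ t).2) := fun t ht => by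
    simpa only [hF, lt_min_iff] using ht
  have hdinv : ∀ t, 0 < F t → ∀ k : ℝ,
      HasDerivAt (fun t => ((γ t).1)⁻¹ + k * t) (-(γ t).2 / (γ t).1 ^ 2 + k) t := by
    intro t ht k
    obtain ⟨⟨g1, g2⟩, g3, g4⟩ := hFi t ht
    obtain ⟨hb1, hb2⟩ := hbox (γ t).1 (γ t).2 (by linarith) (by linarith) (by linarith)
      (by linarith)
    have dx := (cubicField_fst_snd_hasDerivAt (hγ t) hb1 hb2).1
    have := (dx.inv (by linarith : 0 < (γ t).1).ne').add ((hasDerivAt_id t).const_mul k)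
    exact this.congr_deriv (by ring)
  rcases forall_pos_or_exists_first_zero hFc hF0 with hall | ⟨T, hT, hFT, hbef⟩
  · exfalso
    have hanti : AntitoneOn (fun t => ((γ t).1)⁻¹ + lo * t) (Set.Ici 0) := by
      refine antitoneOn_of_deriv_nonpos (convex_Ici 0)
        (fun t ht => (hdinv t (hall t ht) lo).continuousAt.continuousWithinAt)
        (fun t ht => (hdinv t (hall t (interior_subset ht)) lo).differentiableAt.differentiableWithinAt) ?_
      intro t ht
      have ht := interior_subset ht
      rw [(hdinv t (hall t ht) lo).deriv]
      obtain ⟨⟨g1, g2⟩, g3, g4⟩ := hFi t (hall t ht)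
      have : 0 < (γ t).1 := by linarith
      have : lo ≤ (γ t).2 / (γ t).1 ^ 2 := by
        rw [le_div_iff₀ (by positivity)]; linarith
      rw [neg_div]; linarith
    have hs : (0 : ℝ) ≤ x₀⁻¹ / lo := by positivity
    have h4 := hanti (Set.mem_Ici.2 le_rfl) (Set.mem_Ici.2 hs) hs
    have h5 := (hFi _ (hall _ hs)).1.1
    have h6 : 0 < ((γ (x₀⁻¹ / lo)).1)⁻¹ := inv_pos.2 (by linarith)
    simp only [← hx₀, mul_div_cancel₀ _ hlo.ne', mul_zero, add_zero] at h4
    linarith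
  have hge : 0 ≤ F T := hFT.ge
  simp only [hF, le_min_iff] at hge
  obtain ⟨⟨g1, g2⟩, g3, g4⟩ := hge
  have hmono : MonotoneOn (fun t => ((γ t).1)⁻¹ + hi * t) (Set.Icc 0 T) := by
    refine monotoneOn_of_deriv_nonneg (convex_Icc 0 T) ?_ ?_ ?_
    · have hne : ∀ t ∈ Set.Icc 0 T, (γ t).1 ≠ 0 := by
        intro t ht
        rcases ht.2.eq_or_lt with h | h
        · rw [h]; exact (by linarith : 0 < (γ T).1).ne'
        · have := (hFi t (hbef t ht.1 h)).1.1
          exact (by linarith : 0 < (γ t).1).ne'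
      exact ((hcont.fst.continuousOn).inv₀ hne).add (by fun_prop)
    · intro t ht
      rw [interior_Icc] at ht
      exact (hdinv t (hbef t ht.1.le ht.2) hi).differentiableAt.differentiableWithinAt
    · intro t ht
      rw [interior_Icc] at ht
      rw [(hdinv t (hbef t ht.1.le ht.2) hi).deriv]
      obtain ⟨⟨g1, g2⟩, g3, g4⟩ := hFi t (hbef t ht.1.le ht.2)
      have : 0 < (γ t).1 := by linarith
      have : (γ t).2 / (γ t).1 ^ 2 ≤ hi := by
        rw [div_le_iff₀ (by positivity)]; linarith
      rw [neg_div]; linarith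
  obtain ⟨hb1, hb2⟩ := hbox (γ T).1 (γ T).2 (by linarith) (by linarith) (by linarith) (by linarith)
  obtain ⟨dx, dy⟩ := cubicField_fst_snd_hasDerivAt (hγ T) hb1 hb2
  have hx0 : 0 < (γ T).1 := by linarith
  have hy0 : 0 < (γ T).2 := by nlinarith [pow_pos hx0 2]
  have hbef' := fun t h1 h2 => hFi t (hbef t h1 h2)
  have hsT := hG _ hx0 (by linarith)
  have hx3 : 0 < (γ T).1 ^ 3 := by positivity
  have hxT : (γ T).1 = x₁ := by
    by_contra hne
    simp only [hF] at hFT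
    generalize hX : (γ T).1 = x at *
    generalize hY : (γ T).2 = y at *
    have e2 : 0 < x₁ - x := g2.lt_of_ne fun h => hne (by linarith)
    have e1 : 0 < x - x₀ / 2 := by
      refine g1.lt_of_ne fun h => ?_
      have := deriv_nonpos_of_first_zero hT (dx.sub_const (x₀ / 2)) (by rw [hX]; exact h.symm)
        fun t h1 h2 => (hbef' t h1 h2).1.1.le
      linarith
    have e3 : 0 < y - lo * x ^ 2 := by
      refine g3.lt_of_ne fun h => ?_
      have h1 := deriv_nonpos_of_first_zero hT (dy.sub ((dx.pow 2).const_mul lo))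
        (by simp only [Pi.sub_apply, Pi.pow_apply]; rw [hX, hY]; exact h.symm)
        fun t h1 h2 => (hbef' t h1 h2).2.1.le
      rw [hX, show y = lo * x ^ 2 by linarith] at h1
      have h2 := mul_neg_of_pos_of_neg hx3 hsT.1
      simp only [Nat.cast_ofNat, Nat.reduceSub, pow_one] at h1
      linarith
    have e4 : 0 < hi * x ^ 2 - y := by
      refine g4.lt_of_ne fun h => ?_
      have h1 := deriv_nonpos_of_first_zero hT
        (((dx.pow 2).const_mul hi).sub dy)
        (by simp only [Pi.sub_apply, Pi.pow_apply]; rw [hX, hY]; exact h.symm)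
        fun t h1 h2 => (hbef' t h1 h2).2.2.le
      rw [hX, show y = hi * x ^ 2 by linarith] at h1
      have h2 := mul_pos hx3 hsT.2
      simp only [Nat.cast_ofNat, Nat.reduceSub, pow_one] at h1
      linarith
    exact absurd hFT (lt_min (lt_min e1 e2) (lt_min e3 e4)).ne'
  refine ⟨T, hT, ?_, hxT, fun t ht1 ht2 => ?_⟩
  · have := hmono (Set.left_mem_Icc.2 hT.le) (Set.right_mem_Icc.2 hT.le) hT.le
    simp only [← hx₀, hxT, mul_zero, add_zero] at this
    linarith
  · rcases ht2.eq_or_lt with h | h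
    · rw [h]; exact ⟨hx0, by linarith, by linarith, by linarith⟩
    · obtain ⟨⟨g1, g2⟩, g3, g4⟩ := hbef' t ht1 h
      exact ⟨by linarith, by linarith, by linarith, by linarith⟩

theorem hasCharacteristicOrbit_of_saddle {a c A b d e : ℝ} (hA : A < 0) :
    HasCharacteristicOrbit (cubicField a c A b d e) (0, 0) := by
  obtain ⟨lo, hlo0, hlo⟩ : ∃ lo : ℝ, 0 < lo ∧ 2 * lo ^ 2 + a * lo + A < 0 := by
    have : ∀ᶠ x in 𝓝[>] (0 : ℝ), 2 * x ^ 2 + a * x + A < 0 :=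
      nhdsWithin_le_nhds ((by fun_prop : Continuous fun x : ℝ =>
        2 * x ^ 2 + a * x + A).continuousAt.eventually_lt_const (by simpa using hA))
    obtain ⟨x, h1, h2⟩ := ((eventually_mem_nhdsWithin (s := Set.Ioi (0 : ℝ))).and this).exists
    exact ⟨x, h1, h2⟩
  obtain ⟨hi, hlohi, hhi⟩ : ∃ hi : ℝ, lo < hi ∧ 0 < 2 * hi ^ 2 + a * hi + A := by
    refine ⟨lo + |a| + |A| + 1, by linarith [abs_nonneg a, abs_nonneg A], ?_⟩
    have h1 := neg_abs_le a
    have h2 := neg_abs_le A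
    have h3 := abs_nonneg a
    have h4 := abs_nonneg A
    nlinarith [mul_nonneg h3 h4, mul_nonneg hlo0.le h4, mul_nonneg hlo0.le h3]
  have hhi0 : 0 < hi := hlo0.trans hlohi
  have ev : ∀ᶠ x in 𝓝 (0 : ℝ), x < 1 ∧ hi * x < 1 ∧
      2 * lo ^ 2 + a * lo + A + x * (c * lo ^ 2 + b * lo) + d * lo ^ 2 * x ^ 2
        + e * lo ^ 3 * x ^ 3 < 0 ∧
      0 < 2 * hi ^ 2 + a * hi + A + x * (c * hi ^ 2 + b * hi) + d * hi ^ 2 * x ^ 2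
        + e * hi ^ 3 * x ^ 3 := by
    refine (eventually_lt_nhds one_pos).and (Eventually.and ?_ (Eventually.and ?_ ?_))
    · exact (by fun_prop : Continuous fun x : ℝ => hi * x).continuousAt.eventually_lt_const (by simp)
    · exact (by fun_prop : Continuous fun x : ℝ => 2 * lo ^ 2 + a * lo + A
        + x * (c * lo ^ 2 + b * lo) + d * lo ^ 2 * x ^ 2
        + e * lo ^ 3 * x ^ 3).continuousAt.eventually_lt_const (by simpa using hlo)
    · exact (by fun_prop : Continuous fun x : ℝ => 2 * hi ^ 2 + a * hi + A
        + x * (c * hi ^ 2 + b * hi) + d * hi ^ 2 * x ^ 2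
        + e * hi ^ 3 * x ^ 3).continuousAt.eventually_const_lt (by simpa using hhi)
  obtain ⟨x₁, hx₁0, hx₁⟩ := mem_nhdsGT_iff_exists_Ioc_subset.1 (nhdsWithin_le_nhds (s := Set.Ioi 0) ev)
  simp only [Set.mem_Ioi] at hx₁0
  have hsm := hx₁ (Set.right_mem_Ioc.2 hx₁0)
  have hv := cubicField_contDiff a c A b d e
  obtain ⟨x, hx⟩ : ∃ x : ℕ → ℝ, x = fun n : ℕ => x₁ / (n + 2 : ℝ) := ⟨_, rfl⟩
  have hxpos : ∀ n, 0 < x n := fun n => by rw [hx]; positivity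
  have hxlt : ∀ n, x n < x₁ := fun n => by
    rw [hx]; exact div_lt_self hx₁0 (by linarith [n.cast_nonneg (α := ℝ)])
  have key : ∀ n : ℕ, ∃ (σ : ℝ → ℝ × ℝ) (T : ℝ),
      (∀ t, HasDerivAt σ (cubicField a c A b d e (clampSquare 1 (σ t))) t) ∧
      (x n)⁻¹ - x₁⁻¹ ≤ hi * T ∧ (σ 0).1 = x₁ ∧ 0 < T ∧ ∀ t, 0 ≤ t → t ≤ T →
      0 < (σ t).1 ∧ (σ t).1 ≤ x₁ ∧ lo * (σ t).1 ^ 2 ≤ (σ t).2 ∧ (σ t).2 ≤ hi * (σ t).1 ^ 2 := by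
    intro n
    obtain ⟨γ, hγ0, hγ⟩ := exists_integralCurve_clampSquare (hv.const_smul (-1 : ℝ)) zero_le_one
      (x n, (lo + hi) / 2 * x n ^ 2)
    have h2 : 0 < x n ^ 2 := pow_pos (hxpos n) 2
    obtain ⟨T, hT, h3, h4, h5⟩ := exists_backward_exit_time (γ := γ) hlo0 hsm.1.le hsm.2.1.le
      (fun x h1 h2 => (hx₁ ⟨h1, h2⟩).2.2) hγ (by rw [hγ0]; exact hxpos n)
      (by rw [hγ0]; exact hxlt n) (by rw [hγ0]; simp only; nlinarith)
      (by rw [hγ0]; simp only; nlinarith)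
    rw [hγ0] at h3
    refine ⟨fun t => γ (T - t), T, fun t => ?_, h3, by simpa using h4, hT,
      fun t ht1 ht2 => h5 (T - t) (by linarith) (by linarith)⟩
    have := (hγ (T - t)).comp_const_sub T t
    simpa using this
  choose σ T hσ hT hσ0 hTpos hσin using key
  have hy : ∀ n, (σ n 0).2 ∈ Set.Icc (lo * x₁ ^ 2) (hi * x₁ ^ 2) := fun n => by
    have := (hσin n 0 le_rfl (hTpos n).le).2.2
    rw [hσ0] at this
    exact this
  obtain ⟨y, hyI, φ, hφ, hlim⟩ := isCompact_Icc.tendsto_subseq hy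
  obtain ⟨g, hg0, hg⟩ := exists_integralCurve_clampSquare hv zero_le_one (x₁, y)
  obtain ⟨⟨K, hK⟩, -⟩ := lipschitz_comp_clampSquare hv zero_le_one
  have hconv : ∀ t, 0 ≤ t → Tendsto (fun n => σ (φ n) t) atTop (𝓝 (g t)) := by
    intro t ht
    have h1 : ∀ n, dist (σ (φ n) t) (g t) ≤ dist (σ (φ n) 0) (g 0) * Real.exp (K * (t - 0)) :=
      fun n => dist_le_of_trajectories_ODE (v := fun _ => cubicField a c A b d e ∘ clampSquare 1)
        (fun _ => hK) (fun s _ => (hσ (φ n) s).continuousAt.continuousWithinAt)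
        (fun s _ => (hσ (φ n) s).hasDerivWithinAt)
        (fun s _ => (hg s).continuousAt.continuousWithinAt)
        (fun s _ => (hg s).hasDerivWithinAt) le_rfl t ⟨ht, le_rfl⟩
    have h2 : Tendsto (fun n => σ (φ n) 0) atTop (𝓝 (g 0)) := by
      rw [hg0]
      have : Tendsto (fun n => ((σ (φ n) 0).1, (σ (φ n) 0).2)) atTop (𝓝 (x₁, y)) := by
        refine Tendsto.prodMk_nhds ?_ hlim
        simp only [hσ0]
        exact tendsto_const_nhds
      exact this
    rw [tendsto_iff_dist_tendsto_zero] at h2 ⊢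
    refine squeeze_zero (fun _ => dist_nonneg) h1 ?_
    simpa using h2.mul_const (Real.exp (K * (t - 0)))
  have hTlim : Tendsto T atTop atTop := by
    have h1 : Tendsto (fun n : ℕ => ((n : ℝ) + 1) * (x₁ * hi)⁻¹) atTop atTop :=
      (tendsto_atTop_add_const_right _ _ tendsto_natCast_atTop_atTop).atTop_mul_const
        (inv_pos.2 (mul_pos hx₁0 hhi0))
    refine tendsto_atTop_mono (fun n => ?_) h1
    have h2 := hT n
    rw [← div_eq_mul_inv, div_le_iff₀ (mul_pos hx₁0 hhi0)]
    have h3 : (x n)⁻¹ = ((n : ℝ) + 2) * x₁⁻¹ := by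
      rw [hx]; field_simp
    rw [h3] at h2
    have h4 := mul_le_mul_of_nonneg_right h2 hx₁0.le
    have h5 : x₁⁻¹ * x₁ = 1 := inv_mul_cancel₀ hx₁0.ne'
    nlinarith
  have hin : ∀ t, 0 ≤ t → 0 ≤ (g t).1 ∧ (g t).1 ≤ x₁ ∧ lo * (g t).1 ^ 2 ≤ (g t).2 ∧
      (g t).2 ≤ hi * (g t).1 ^ 2 := by
    intro t ht
    have hev : ∀ᶠ n in atTop, t ≤ T (φ n) :=
      (hTlim.comp hφ.tendsto_atTop).eventually_ge_atTop t
    have hc := hconv t ht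
    have c1 := (continuous_fst.tendsto (g t)).comp hc
    have c2 := (continuous_snd.tendsto (g t)).comp hc
    refine ⟨ge_of_tendsto c1 ?_, le_of_tendsto c1 ?_, le_of_tendsto_of_tendsto ((c1.pow 2).const_mul lo) c2 ?_,
      le_of_tendsto_of_tendsto c2 ((c1.pow 2).const_mul hi) ?_⟩
    · filter_upwards [hev] with n hn using (hσin _ t ht hn).1.le
    · filter_upwards [hev] with n hn using (hσin _ t ht hn).2.1
    · filter_upwards [hev] with n hn using (hσin _ t ht hn).2.2.1
    · filter_upwards [hev] with n hn using (hσin _ t ht hn).2.2.2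
  have hgne : ∀ t, g t ≠ 0 := ne_zero_of_clamped_integralCurve (σ := 1) (by simpa using hg) (t₀ := 0)
    (by
      rw [hg0]
      intro h
      exact hx₁0.ne' (congrArg Prod.fst h))
  have hgpos : ∀ t, 0 ≤ t → 0 < (g t).1 := by
    intro t ht
    obtain ⟨h1, -, h3, h4⟩ := hin t ht
    refine h1.lt_of_ne fun h => hgne t ?_
    rw [← h] at h3 h4
    ext
    · exact h.symm
    · exact le_antisymm (by simpa using h4) (by simpa using h3)
  refine hasCharacteristicOrbit_of_parabolic_sector (γ := g) (hi := hi) hlo0 (fun t ht => ?_)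
    (fun t ht => hgpos t ht.le) (fun t ht => (hin t ht.le).2.2)
  obtain ⟨h1, h2, h3, h4⟩ := hin t ht.le
  have h5 : (g t).1 ≤ 1 := h2.trans hsm.1.le
  have h6 : hi * (g t).1 ≤ 1 := (mul_le_mul_of_nonneg_left h2 hhi0.le).trans hsm.2.1.le
  have h7 : 0 ≤ (g t).2 := le_trans (by positivity) h3
  have := hg t
  rwa [clampSquare_eq_self (by rwa [abs_of_nonneg h1]) (by rw [abs_of_nonneg h7]; nlinarith)] at this

theorem HasCharacteristicOrbit.reflect_snd {a c A b d e : ℝ}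
    (h : HasCharacteristicOrbit (cubicField (-a) c A (-b) d (-e)) (0, 0)) :
    HasCharacteristicOrbit (cubicField a c A b d e) (0, 0) := by
  obtain ⟨γ, u, h⟩ := h
  have hd : ∀ t, HasDerivAt γ (cubicField (-a) c A (-b) d (-e) (γ (-(-t)))) (-(-t)) →
      HasDerivAt (fun s => ((γ (-s)).1, -(γ (-s)).2))
        (cubicField a c A b d e ((γ t).1, -(γ t).2)) (-t) := by
    intro t h
    rw [neg_neg] at h
    have h1 : HasDerivAt (fun s => γ (-s)) (-cubicField (-a) c A (-b) d (-e) (γ t)) (-t) := by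
      have h' : HasDerivAt γ (cubicField (-a) c A (-b) d (-e) (γ t)) (-(-t)) := by rwa [neg_neg]
      simpa [Function.comp_def] using h'.scomp (-t) (hasDerivAt_neg (-t))
    have hx : HasDerivAt (fun s => (γ (-s)).1) (-cubicField (-a) c A (-b) d (-e) (γ t)).1 (-t) :=
      h1.fst
    have hy : HasDerivAt (fun s => (γ (-s)).2) (-cubicField (-a) c A (-b) d (-e) (γ t)).2 (-t) :=
      h1.snd
    refine (hx.prodMk hy.neg).congr_deriv ?_
    simp only [cubicField]
    ext <;> simp <;> ring
  have hn : ∀ q : ℝ × ℝ, ‖(q.1, -q.2) - ((0, 0) : ℝ × ℝ)‖ = ‖q - (0, 0)‖ := by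
    intro q; simp [Prod.norm_def]
  have hS : Continuous fun q : ℝ × ℝ => (q.1, -q.2) := by fun_prop
  have hne : ∀ q : ℝ × ℝ, q ≠ (0, 0) → (q.1, -q.2) ≠ ((0, 0) : ℝ × ℝ) := by
    intro q hq h
    apply hq
    simp only [Prod.mk.injEq, neg_eq_zero] at h
    exact Prod.ext h.1 h.2
  have hdir : ∀ q : ℝ × ℝ, ‖(q.1, -q.2) - ((0, 0) : ℝ × ℝ)‖⁻¹ • ((q.1, -q.2) - ((0, 0) : ℝ × ℝ)) =
      ((‖q - (0, 0)‖⁻¹ • (q - (0, 0))).1, -(‖q - (0, 0)‖⁻¹ • (q - (0, 0))).2) := by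
    intro q; rw [hn]; simp
  refine ⟨fun s => ((γ (-s)).1, -(γ (-s)).2), (u.1, -u.2), ?_⟩
  have h0 : Tendsto (fun q : ℝ × ℝ => (q.1, -q.2)) (𝓝 (0, 0)) (𝓝 (0, 0)) := by
    have := hS.tendsto (0, 0)
    simpa using this
  rcases h with ⟨h1, h2, h3⟩ | ⟨h1, h2, h3⟩
  · refine Or.inr ⟨fun t ht => ⟨?_, hne _ (h1 (-t) (by linarith)).2⟩, ?_, ?_⟩
    · have := hd (-t) (by rw [neg_neg]; simpa using (h1 (-t) (by linarith)).1)
      rwa [neg_neg] at this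
    · exact h0.comp (h2.comp tendsto_neg_atBot_atTop)
    · simp only [hdir]
      exact (hS.tendsto u).comp (h3.comp tendsto_neg_atBot_atTop)
  · refine Or.inl ⟨fun t ht => ⟨?_, hne _ (h1 (-t) (by linarith)).2⟩, ?_, ?_⟩
    · have := hd (-t) (by rw [neg_neg]; simpa using (h1 (-t) (by linarith)).1)
      rwa [neg_neg] at this
    · exact h0.comp (h2.comp tendsto_neg_atTop_atBot)
    · simp only [hdir]
      exact (hS.tendsto u).comp (h3.comp tendsto_neg_atTop_atBot)

/-- A monodromic nilpotent singular point has `a₃₀ > 0` and negative discriminant. -/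
theorem IsMonodromic.pos_and_discrim_neg {a c A b d e : ℝ}
    (h : IsMonodromic (cubicField a c A b d e) (0, 0)) : 0 < A ∧ a ^ 2 < 8 * A := by
  obtain ⟨-, hiso, hno⟩ := h
  have hA0 : A ≠ 0 := by
    rintro rfl
    have h1 : Tendsto (fun x : ℝ => (x, (0 : ℝ))) (𝓝[≠] 0) (𝓝[≠] (0, 0)) := by
      refine tendsto_nhdsWithin_iff.2 ⟨?_, ?_⟩
      · exact ((by fun_prop : Continuous fun x : ℝ => (x, (0 : ℝ))).tendsto 0).mono_left
          nhdsWithin_le_nhds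
      · filter_upwards [self_mem_nhdsWithin] with x hx h
        exact hx (congrArg Prod.fst h)
    obtain ⟨x, hx⟩ := (h1.eventually hiso).exists
    exact hx (by simp [cubicField])
  have hA : 0 < A := by
    by_contra hcon
    exact hno (hasCharacteristicOrbit_of_saddle (lt_of_le_of_ne (not_lt.1 hcon) hA0))
  refine ⟨hA, ?_⟩
  by_contra hcon
  rw [not_lt] at hcon
  have ha : a ≠ 0 := by rintro rfl; norm_num at hcon; linarith
  rcases ha.lt_or_gt with ha | ha
  · exact hno (hasCharacteristicOrbit_of_node hA ha hcon)
  · exact hno (hasCharacteristicOrbit_of_node hA (by linarith) (by rwa [neg_sq])).reflect_snd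

/-! ### Linear changes of variables -/

theorem IsCenter.conj {X Y : ℝ × ℝ → ℝ × ℝ} (S : (ℝ × ℝ) ≃L[ℝ] (ℝ × ℝ)) {τ : ℝ} (hτ : τ ≠ 0)
    (hY : ∀ q, Y (S q) = τ • S (X q)) (h : IsCenter X (0, 0)) : IsCenter Y (0, 0) := by
  obtain ⟨h0, U, hU, hc⟩ := h
  have hS0 : S (0, 0) = (0, 0) := S.map_zero
  refine ⟨?_, S.symm ⁻¹' U, ?_, fun q hq hq0 => ?_⟩
  · rw [← hS0, hY, h0]
    simp
  · exact S.symm.continuous.continuousAt.preimage_mem_nhds (by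
      rwa [show S.symm (0, 0) = (0, 0) from S.symm.map_zero])
  · have hne : S.symm q ≠ (0, 0) := fun h => hq0 (by rw [← hS0, ← h, S.apply_symm_apply])
    obtain ⟨hX, γ, hγ0, hγ, hγU, T, hT, hper⟩ := hc _ hq hne
    refine ⟨?_, fun t => S (γ (τ * t)), by simp [hγ0], fun t => ?_, fun t => ⟨?_, ?_⟩, T / |τ|,
      div_pos hT (abs_pos.2 hτ), fun t => ?_⟩
    · rw [← S.apply_symm_apply q, hY]
      refine smul_ne_zero hτ fun h => hX ?_
      exact S.injective (by rw [h, map_zero])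
    · rw [hY]
      have h1 : HasDerivAt (fun t => γ (τ * t)) (τ • X (γ (τ * t))) t := by
        have h2 : HasDerivAt (fun t => τ * t) τ t := by simpa using (hasDerivAt_id t).const_mul τ
        simpa [Function.comp_def] using (hγ (τ * t)).scomp t h2
      have h3 := S.hasFDerivAt.comp_hasDerivAt t h1
      simpa [Function.comp_def] using h3
    · simpa using (hγU (τ * t)).1
    · intro h
      exact (hγU (τ * t)).2 (S.injective (h.trans hS0.symm))
    · simp only
      congr 1
      rw [mul_add]
      rcases hτ.lt_or_gt with h | h
      · rw [abs_of_neg h, show τ * t + τ * (T / -τ) = τ * t - T by field_simp; ring]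
        exact hper.sub_eq _
      · rw [abs_of_pos h, mul_div_cancel₀ _ hτ]
        exact hper _

/-- The linear change of variables `(x, y) ↦ (r x, s y)`. -/
noncomputable def scaleEquiv (r s : ℝ) (hr : r ≠ 0) (hs : s ≠ 0) : (ℝ × ℝ) ≃L[ℝ] (ℝ × ℝ) :=
  (ContinuousLinearEquiv.smulLeft (Units.mk0 r hr)).prodCongr
    (ContinuousLinearEquiv.smulLeft (Units.mk0 s hs))

theorem scaleEquiv_apply (r s : ℝ) (hr : r ≠ 0) (hs : s ≠ 0) (q : ℝ × ℝ) :
    scaleEquiv r s hr hs q = (r * q.1, s * q.2) := rfl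

theorem IsCenter.cubicField_mirror {a c A b d e : ℝ}
    (h : IsCenter (cubicField a c A b d e) (0, 0)) :
    IsCenter (cubicField a (-c) A (-b) d (-e)) (0, 0) := by
  refine h.conj (scaleEquiv (-1) 1 (by norm_num) one_ne_zero) (τ := -1) (by norm_num) fun q => ?_
  simp only [scaleEquiv_apply, cubicField, Prod.smul_mk, smul_eq_mul]
  ext <;> ring

theorem IsCenter.cubicField_scale {a c A b d e : ℝ} {s : ℝ} (hs : s ≠ 0)
    (h : IsCenter (cubicField a c A b d e) (0, 0)) :
    IsCenter (cubicField (a / s) c (A / s ^ 2) (b / s) d (e * s)) (0, 0) := by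
  refine h.conj (scaleEquiv 1 s⁻¹ one_ne_zero (inv_ne_zero hs)) (τ := s⁻¹) (inv_ne_zero hs)
    fun q => ?_
  simp only [scaleEquiv_apply, cubicField, Prod.smul_mk, smul_eq_mul]
  ext
  · ring
  · field_simp

/-! ### Curves turning around a focus -/

/-- The complex coordinate `ω ξ² + i (4 η + a ξ²)`, in which the leading part
`ξ' = -η, η' = a ξ η + ξ³` becomes `ζ' = ξ (a + i ω) / 2 * ζ` if `ω² = 8 - a²`. -/
noncomputable def focusCoord (a ω ξ η : ℝ) : ℂ := ((ω * ξ ^ 2 : ℝ) : ℂ) + ((4 * η + a * ξ ^ 2 : ℝ) : ℂ) * Complex.I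

theorem focusCoord_re (a ω ξ η : ℝ) : (focusCoord a ω ξ η).re = ω * ξ ^ 2 := by
  rw [focusCoord]; simp only [Complex.add_re, Complex.ofReal_re, Complex.re_ofReal_mul, Complex.I_re]; ring

theorem focusCoord_im (a ω ξ η : ℝ) : (focusCoord a ω ξ η).im = 4 * η + a * ξ ^ 2 := by
  rw [focusCoord]; simp only [Complex.add_im, Complex.ofReal_im, Complex.im_ofReal_mul, Complex.I_im]; ring

theorem focusCoord_ne_zero {a ω ξ η : ℝ} (hω : 0 < ω) (h : ¬(ξ = 0 ∧ η = 0)) :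
    focusCoord a ω ξ η ≠ 0 := by
  intro h0
  have h1 := focusCoord_re a ω ξ η
  have h2 := focusCoord_im a ω ξ η
  rw [h0, Complex.zero_re] at h1
  rw [h0, Complex.zero_im] at h2
  have h3 : ξ = 0 := by
    rcases mul_eq_zero.1 h1.symm with h | h
    · exact absurd h hω.ne'
    · exact pow_eq_zero_iff two_ne_zero |>.1 h
  rw [h3] at h2
  exact h ⟨h3, by linarith⟩

theorem focusCoord_mem_slitPlane {a ω ξ η : ℝ} (hω : 0 < ω) (h : ¬(ξ = 0 ∧ η = 0)) :
    focusCoord a ω ξ η ∈ Complex.slitPlane := by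
  have hne := focusCoord_ne_zero (a := a) hω h
  rw [Complex.mem_slitPlane_iff]
  by_contra hcon
  push Not at hcon
  have h1 := focusCoord_re a ω ξ η
  have : 0 ≤ ω * ξ ^ 2 := by positivity
  exact hne (Complex.ext (by rw [Complex.zero_re]; linarith [hcon.1]) (by simpa using hcon.2))

theorem abs_arg_focusCoord_le {a ω ξ η : ℝ} (hω : 0 < ω) :
    |(focusCoord a ω ξ η).arg| ≤ Real.pi / 2 := by
  rw [Complex.abs_arg_le_pi_div_two_iff, focusCoord_re]
  positivity

/-- A curve `(ξ, η)` solving `ξ' = -m η`, `η' = m ξ (a η + ξ² + n)` at the times in `I`, with a small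
perturbation `n` and time factor `m`. -/
structure IsFocusCurve (a ω m₀ : ℝ) (ξ η m n : ℝ → ℝ) (I : Set ℝ) : Prop where
  deriv_fst : ∀ t ∈ I, HasDerivAt ξ (-(m t * η t)) t
  deriv_snd : ∀ t ∈ I, HasDerivAt η (m t * ξ t * (a * η t + ξ t ^ 2 + n t)) t
  le_factor : ∀ t ∈ I, m₀ ≤ m t
  small : ∀ t ∈ I, 16 * |n t| ≤ ω * ‖focusCoord a ω (ξ t) (η t)‖
  ne_zero : ∀ t ∈ I, ¬(ξ t = 0 ∧ η t = 0)

section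

variable {a ω m₀ : ℝ} {ξ η m n : ℝ → ℝ} {I : Set ℝ}

theorem IsFocusCurve.hasDerivAt_log (hω : 0 < ω) (hω2 : ω ^ 2 = 8 - a ^ 2)
    (h : IsFocusCurve a ω m₀ ξ η m n I) {t : ℝ} (ht : t ∈ I) :
    HasDerivAt (fun t => Real.log ‖focusCoord a ω (ξ t) (η t)‖)
      (m t * ξ t * (a / 2 + 4 * (n t / ‖focusCoord a ω (ξ t) (η t)‖) *
        Real.sin (focusCoord a ω (ξ t) (η t)).arg)) t ∧
    HasDerivAt (fun t => (focusCoord a ω (ξ t) (η t)).arg)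
      (m t * ξ t * (ω / 2 + 4 * (n t / ‖focusCoord a ω (ξ t) (η t)‖) *
        Real.cos (focusCoord a ω (ξ t) (η t)).arg)) t := by
  have dξ := h.deriv_fst t ht
  have dη := h.deriv_snd t ht
  have hne := focusCoord_ne_zero (a := a) hω (h.ne_zero t ht)
  have hsl := focusCoord_mem_slitPlane (a := a) hω (h.ne_zero t ht)
  have h1 : HasDerivAt (fun t => focusCoord a ω (ξ t) (η t))
      ((m t * ξ t : ℝ) * (((a / 2 : ℝ) + (ω / 2 : ℝ) * Complex.I) * focusCoord a ω (ξ t) (η t)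
        + (4 * n t : ℝ) * Complex.I)) t := by
    have h2 := (((dξ.pow 2).const_mul ω).ofReal_comp).add
      ((((dη.const_mul 4).add ((dξ.pow 2).const_mul a)).ofReal_comp).mul_const Complex.I)
    refine h2.congr_deriv ?_
    apply Complex.ext
    · simp only [Complex.add_re, Complex.add_im, Complex.mul_re, Complex.mul_im, Complex.ofReal_re,
        Complex.ofReal_im, Complex.I_re, Complex.I_im, focusCoord_re, focusCoord_im, Nat.cast_ofNat,
        Nat.reduceSub, pow_one]
      ring
    · simp only [Complex.add_re, Complex.add_im, Complex.mul_re, Complex.mul_im, Complex.ofReal_re,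
        Complex.ofReal_im, Complex.I_re, Complex.I_im, focusCoord_re, focusCoord_im, Nat.cast_ofNat,
        Nat.reduceSub, pow_one]
      linear_combination (-(m t * ξ t ^ 3) / 2) * hω2
  have h2 := h1.clog_real hsl
  have h3 : ((m t * ξ t : ℝ) * (((a / 2 : ℝ) + (ω / 2 : ℝ) * Complex.I) * focusCoord a ω (ξ t) (η t)
        + (4 * n t : ℝ) * Complex.I)) / focusCoord a ω (ξ t) (η t) =
      (m t * ξ t : ℝ) * (((a / 2 : ℝ) + (ω / 2 : ℝ) * Complex.I)
        + (4 * n t : ℝ) * (Complex.I / focusCoord a ω (ξ t) (η t))) := by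
    field_simp
  rw [h3] at h2
  have hr : 0 < ‖focusCoord a ω (ξ t) (η t)‖ := norm_pos_iff.2 hne
  have h4 : Complex.I / focusCoord a ω (ξ t) (η t) =
      ((Real.sin (focusCoord a ω (ξ t) (η t)).arg / ‖focusCoord a ω (ξ t) (η t)‖ : ℝ) : ℂ)
      + ((Real.cos (focusCoord a ω (ξ t) (η t)).arg / ‖focusCoord a ω (ξ t) (η t)‖ : ℝ) : ℂ)
        * Complex.I := by
    generalize focusCoord a ω (ξ t) (η t) = z at hne hr
    rw [Complex.sin_arg, Complex.cos_arg hne]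
    apply Complex.ext
    · simp [Complex.div_re, Complex.normSq_eq_norm_sq]
      field_simp
    · simp [Complex.div_im, Complex.normSq_eq_norm_sq]
      field_simp
  rw [h4] at h2
  constructor
  · have h5 := Complex.reCLM.hasFDerivAt.comp_hasDerivAt t h2
    simp only [Complex.reCLM_apply, Function.comp_def, Complex.log_re] at h5
    refine h5.congr_deriv ?_
    simp only [Complex.add_re, Complex.add_im, Complex.mul_re, Complex.mul_im, Complex.ofReal_re,
        Complex.ofReal_im, Complex.I_re, Complex.I_im]
    ring
  · have h5 := Complex.imCLM.hasFDerivAt.comp_hasDerivAt t h2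
    simp only [Complex.imCLM_apply, Function.comp_def, Complex.log_im] at h5
    refine h5.congr_deriv ?_
    simp only [Complex.add_re, Complex.add_im, Complex.mul_re, Complex.mul_im, Complex.ofReal_re,
        Complex.ofReal_im, Complex.I_re, Complex.I_im]
    ring

theorem IsFocusCurve.abs_ratio_le (hω : 0 < ω) (h : IsFocusCurve a ω m₀ ξ η m n I) {t : ℝ}
    (ht : t ∈ I) : |n t / ‖focusCoord a ω (ξ t) (η t)‖| ≤ ω / 16 := by
  have hr : 0 < ‖focusCoord a ω (ξ t) (η t)‖ :=
    norm_pos_iff.2 (focusCoord_ne_zero (a := a) hω (h.ne_zero t ht))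
  rw [abs_div, abs_of_pos hr, div_le_div_iff₀ hr (by norm_num)]
  linarith [h.small t ht]

theorem IsFocusCurve.abs_log_sub_le (hω : 0 < ω) (hω2 : ω ^ 2 = 8 - a ^ 2) (hm : 0 < m₀)
    (h : IsFocusCurve a ω m₀ ξ η m n I) {s t : ℝ} (hst : s ≤ t) (hI : Set.Icc s t ⊆ I)
    (hξ : ∀ u ∈ Set.Icc s t, 0 ≤ ξ u) :
    |Real.log ‖focusCoord a ω (ξ t) (η t)‖ - Real.log ‖focusCoord a ω (ξ s) (η s)‖| ≤
      (2 * |a| + ω) / ω * ((focusCoord a ω (ξ t) (η t)).arg - (focusCoord a ω (ξ s) (η s)).arg) := by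
  have key : ∀ σ : ℝ, |σ| ≤ 1 → MonotoneOn (fun t => (2 * |a| + ω) / ω *
      (focusCoord a ω (ξ t) (η t)).arg + σ * Real.log ‖focusCoord a ω (ξ t) (η t)‖)
      (Set.Icc s t) := by
    intro σ hσ
    have hd := fun u (hu : u ∈ Set.Icc s t) =>
      ((h.hasDerivAt_log hω hω2 (hI hu)).2.const_mul ((2 * |a| + ω) / ω)).add
      ((h.hasDerivAt_log hω hω2 (hI hu)).1.const_mul σ)
    refine monotoneOn_of_deriv_nonneg (convex_Icc s t)
      (fun u hu => (hd u hu).continuousAt.continuousWithinAt)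
      (fun u hu => (hd u (interior_subset hu)).differentiableAt.differentiableWithinAt) ?_
    intro u hu
    have hu := interior_subset hu
    refine le_of_le_of_eq ?_ (hd u hu).deriv.symm
    have hκ := h.abs_ratio_le hω (hI hu)
    set κ := n u / ‖focusCoord a ω (ξ u) (η u)‖
    set θ := (focusCoord a ω (ξ u) (η u)).arg
    have hmξ : 0 ≤ m u * ξ u := mul_nonneg (hm.le.trans (h.le_factor u (hI hu))) (hξ u hu)
    have hc : |4 * κ * Real.cos θ| ≤ ω / 4 := by
      rw [abs_mul, abs_mul, abs_of_pos (by norm_num : (0:ℝ) < 4)]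
      nlinarith [abs_nonneg κ, abs_nonneg (Real.cos θ), Real.abs_cos_le_one θ]
    have hs : |4 * κ * Real.sin θ| ≤ ω / 4 := by
      rw [abs_mul, abs_mul, abs_of_pos (by norm_num : (0:ℝ) < 4)]
      nlinarith [abs_nonneg κ, abs_nonneg (Real.sin θ), Real.abs_sin_le_one θ]
    have h1 : |σ * (a / 2 + 4 * κ * Real.sin θ)| ≤ |a| / 2 + ω / 4 := by
      rw [abs_mul]
      have h2 : |a / 2 + 4 * κ * Real.sin θ| ≤ |a| / 2 + ω / 4 := by
        refine (abs_add_le _ _).trans (add_le_add ?_ hs)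
        rw [abs_div, abs_of_pos (by norm_num : (0:ℝ) < 2)]
      nlinarith [abs_nonneg (a / 2 + 4 * κ * Real.sin θ), abs_nonneg σ]
    have h2 : |a| / 2 + ω / 4 ≤ (2 * |a| + ω) / ω * (ω / 2 + 4 * κ * Real.cos θ) := by
      have : |a| / 2 + ω / 4 = (2 * |a| + ω) / ω * (ω / 4) := by field_simp; ring
      rw [this]
      refine mul_le_mul_of_nonneg_left ?_ (by positivity)
      linarith [(abs_le.1 hc).1]
    have h3 := mul_nonneg hmξ (by linarith [(abs_le.1 h1).1] :
      0 ≤ (2 * |a| + ω) / ω * (ω / 2 + 4 * κ * Real.cos θ) + σ * (a / 2 + 4 * κ * Real.sin θ))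
    linarith
  have k1 := key 1 (by simp) (Set.left_mem_Icc.2 hst) (Set.right_mem_Icc.2 hst) hst
  have k2 := key (-1) (by simp) (Set.left_mem_Icc.2 hst) (Set.right_mem_Icc.2 hst) hst
  simp only at k1 k2
  rw [abs_le]
  constructor <;> linarith

/-- The constant bounding the growth of `‖ζ‖` during a half-turn. -/
noncomputable def turnConst (a ω : ℝ) : ℝ := Real.exp ((2 * |a| + ω) / ω * Real.pi)

theorem turnConst_pos (a ω : ℝ) : 0 < turnConst a ω := Real.exp_pos _

theorem IsFocusCurve.norm_le (hω : 0 < ω) (hω2 : ω ^ 2 = 8 - a ^ 2) (hm : 0 < m₀)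
    (h : IsFocusCurve a ω m₀ ξ η m n I) {s t : ℝ} (hst : s ≤ t) (hI : Set.Icc s t ⊆ I)
    (hξ : ∀ u ∈ Set.Icc s t, 0 ≤ ξ u) :
    ‖focusCoord a ω (ξ t) (η t)‖ ≤ turnConst a ω * ‖focusCoord a ω (ξ s) (η s)‖ ∧
    ‖focusCoord a ω (ξ s) (η s)‖ ≤ turnConst a ω * ‖focusCoord a ω (ξ t) (η t)‖ := by
  have h1 := h.abs_log_sub_le hω hω2 hm hst hI hξ
  have h2 : (focusCoord a ω (ξ t) (η t)).arg - (focusCoord a ω (ξ s) (η s)).arg ≤ Real.pi := by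
    have := (abs_le.1 (abs_arg_focusCoord_le (a := a) (ξ := ξ t) (η := η t) hω)).2
    have := (abs_le.1 (abs_arg_focusCoord_le (a := a) (ξ := ξ s) (η := η s) hω)).1
    linarith
  have h3 := h1.trans (mul_le_mul_of_nonneg_left h2 (by positivity))
  have hs : 0 < ‖focusCoord a ω (ξ s) (η s)‖ := norm_pos_iff.2
    (focusCoord_ne_zero hω (h.ne_zero s (hI (Set.left_mem_Icc.2 hst))))
  have ht : 0 < ‖focusCoord a ω (ξ t) (η t)‖ := norm_pos_iff.2
    (focusCoord_ne_zero hω (h.ne_zero t (hI (Set.right_mem_Icc.2 hst))))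
  rw [abs_le] at h3
  rw [turnConst]
  constructor
  · rw [← Real.log_le_log_iff ht (by positivity), Real.log_mul (Real.exp_pos _).ne' hs.ne',
      Real.log_exp]
    linarith
  · rw [← Real.log_le_log_iff hs (by positivity), Real.log_mul (Real.exp_pos _).ne' ht.ne',
      Real.log_exp]
    linarith

theorem focusCoord_bounds {a ω ξ η P : ℝ} (hω : 0 < ω) (h : ‖focusCoord a ω ξ η‖ ≤ P) :
    ξ ^ 2 ≤ P / ω ∧ |η| ≤ (P + |a| * (P / ω)) / 4 := by
  have h1 := (Complex.abs_re_le_norm (focusCoord a ω ξ η)).trans h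
  have h2 := (Complex.abs_im_le_norm (focusCoord a ω ξ η)).trans h
  rw [focusCoord_re, abs_of_nonneg (by positivity)] at h1
  rw [focusCoord_im] at h2
  have h3 : ξ ^ 2 ≤ P / ω := by rw [le_div_iff₀ hω]; linarith
  refine ⟨h3, ?_⟩
  have h4 : |4 * η| ≤ |4 * η + a * ξ ^ 2| + |a * ξ ^ 2| := by
    have := abs_sub (4 * η + a * ξ ^ 2) (a * ξ ^ 2)
    simpa using this
  rw [abs_mul, abs_mul a, abs_of_pos (by norm_num : (0:ℝ) < 4), abs_of_nonneg (sq_nonneg ξ)] at h4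
  have h5 := mul_le_mul_of_nonneg_left h3 (abs_nonneg a)
  linarith

theorem norm_focusCoord_le (a : ℝ) {ω : ℝ} (hω : 0 < ω) (ξ η : ℝ) :
    ‖focusCoord a ω ξ η‖ ≤ (ω + |a|) * ξ ^ 2 + 4 * |η| := by
  have h1 := Complex.norm_le_abs_re_add_abs_im (focusCoord a ω ξ η)
  rw [focusCoord_re, focusCoord_im, abs_of_nonneg (by positivity)] at h1
  have h2 := abs_add_le (4 * η) (a * ξ ^ 2)
  rw [abs_mul, abs_mul a, abs_of_pos (by norm_num : (0:ℝ) < 4), abs_of_nonneg (sq_nonneg ξ)] at h2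
  linarith

/-- A focus curve cannot stay in `ξ > 0` forever. -/
theorem IsFocusCurve.exists_nonpos (hω : 0 < ω) (hω2 : ω ^ 2 = 8 - a ^ 2) (hm : 0 < m₀)
    (h : IsFocusCurve a ω m₀ ξ η m n I) (hI : ∀ t, 0 ≤ t → t ∈ I) (h0 : ∀ t, 0 ≤ t → 0 ≤ ξ t) :
    False := by
  set ρ := fun t => ‖focusCoord a ω (ξ t) (η t)‖ with hρ
  have hb := fun t (ht : 0 ≤ t) => h.norm_le hω hω2 hm ht (fun u hu => hI u hu.1)
    (fun u hu => h0 u hu.1)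
  have hc := turnConst_pos a ω
  have hρ0 : 0 < ρ 0 := norm_pos_iff.2 (focusCoord_ne_zero hω (h.ne_zero 0 (hI 0 le_rfl)))
  obtain ⟨P, hP⟩ : ∃ P, P = turnConst a ω * ρ 0 := ⟨_, rfl⟩
  obtain ⟨p, hp⟩ : ∃ p, p = ρ 0 / turnConst a ω := ⟨_, rfl⟩
  have hP0 : 0 < P := by rw [hP]; positivity
  have hp0 : 0 < p := by rw [hp]; positivity
  have hup : ∀ t, 0 ≤ t → ρ t ≤ P := fun t ht => by rw [hP]; exact (hb t ht).1
  have hlow : ∀ t, 0 ≤ t → p ≤ ρ t := fun t ht => by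
    rw [hp, div_le_iff₀ hc]; linarith [(hb t ht).2]
  obtain ⟨X, hX⟩ : ∃ X, X = Real.sqrt (P / ω) := ⟨_, rfl⟩
  obtain ⟨H, hH⟩ : ∃ H, H = (P + |a| * (P / ω)) / 4 := ⟨_, rfl⟩
  have hX0 : 0 ≤ X := by rw [hX]; positivity
  have hH0 : 0 ≤ H := by rw [hH]; positivity
  have hξX : ∀ t, 0 ≤ t → ξ t ≤ X := fun t ht => by
    rw [hX]; exact Real.le_sqrt_of_sq_le (focusCoord_bounds hω (hup t ht)).1
  have hηH : ∀ t, 0 ≤ t → |η t| ≤ H := fun t ht => by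
    rw [hH]; exact (focusCoord_bounds hω (hup t ht)).2
  obtain ⟨M, hM⟩ : ∃ M, M = X * (|a| * H + X ^ 2 + ω * P) := ⟨_, rfl⟩
  obtain ⟨K, hK⟩ : ∃ K, K = 4 * (M + 1) / ω := ⟨_, rfl⟩
  have hM0 : 0 ≤ M := by rw [hM]; positivity
  have hK0 : 0 ≤ K := by rw [hK]; positivity
  obtain ⟨D, hD⟩ : ∃ D, D = (ω + |a|) * X + 8 / p := ⟨_, rfl⟩
  have hD0 : 0 < D := by rw [hD]; positivity
  obtain ⟨δ, hδ⟩ : ∃ δ, δ = m₀ * (p / (2 * D)) := ⟨_, rfl⟩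
  have hδ0 : 0 < δ := by rw [hδ]; positivity
  have hd : ∀ t, 0 ≤ t → ∃ f', HasDerivAt (fun t => K * (focusCoord a ω (ξ t) (η t)).arg
      - ξ t * η t - δ * t) f' t ∧ 0 ≤ f' := by
    intro t ht
    have d1 := (h.hasDerivAt_log hω hω2 (hI t ht)).2.const_mul K
    have d2 := (h.deriv_fst t (hI t ht)).mul (h.deriv_snd t (hI t ht))
    refine ⟨_, (d1.sub d2).sub ((hasDerivAt_id t).const_mul δ), ?_⟩
    have hκ := h.abs_ratio_le hω (hI t ht)
    have hmt := h.le_factor t (hI t ht)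
    have hmt0 : 0 < m t := hm.trans_le hmt
    have hn := h.small t (hI t ht)
    have hu : ‖focusCoord a ω (ξ t) (η t)‖ ≤ P := hup t ht
    have hl : p ≤ ‖focusCoord a ω (ξ t) (η t)‖ := hlow t ht
    have hl2 := norm_focusCoord_le a hω (ξ t) (η t)
    have hx := hξX t ht
    have hy := hηH t ht
    have hx0 := h0 t ht
    set κ := n t / ‖focusCoord a ω (ξ t) (η t)‖
    set θ := (focusCoord a ω (ξ t) (η t)).arg
    have hcs : |4 * κ * Real.cos θ| ≤ ω / 4 := by
      rw [abs_mul, abs_mul, abs_of_pos (by norm_num : (0:ℝ) < 4)]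
      nlinarith [abs_nonneg κ, abs_nonneg (Real.cos θ), Real.abs_cos_le_one θ]
    have e1 : (M + 1) * ξ t ≤ K * (ω / 2 + 4 * κ * Real.cos θ) * ξ t := by
      refine mul_le_mul_of_nonneg_right ?_ hx0
      have : M + 1 = K * (ω / 4) := by rw [hK]; field_simp
      rw [this]
      exact mul_le_mul_of_nonneg_left (by linarith [(abs_le.1 hcs).1]) hK0
    have hn' : |n t| ≤ ω * P := by nlinarith [abs_nonneg (n t)]
    have e2 : ξ t ^ 2 * (a * η t + ξ t ^ 2 + n t) ≤ M * ξ t := by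
      have f1 : a * η t + ξ t ^ 2 + n t ≤ |a| * H + X ^ 2 + ω * P := by
        have g1 : a * η t ≤ |a| * H := (le_abs_self _).trans (by
          rw [abs_mul]; exact mul_le_mul_of_nonneg_left hy (abs_nonneg a))
        have g2 : ξ t ^ 2 ≤ X ^ 2 := pow_le_pow_left₀ hx0 hx 2
        linarith [le_abs_self (n t)]
      have f2 : 0 ≤ |a| * H + X ^ 2 + ω * P := by positivity
      calc ξ t ^ 2 * (a * η t + ξ t ^ 2 + n t) ≤ ξ t ^ 2 * (|a| * H + X ^ 2 + ω * P) :=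
            mul_le_mul_of_nonneg_left f1 (sq_nonneg _)
        _ = ξ t * (ξ t * (|a| * H + X ^ 2 + ω * P)) := by ring
        _ ≤ ξ t * (X * (|a| * H + X ^ 2 + ω * P)) :=
            mul_le_mul_of_nonneg_left (mul_le_mul_of_nonneg_right hx f2) hx0
        _ = M * ξ t := by rw [hM]; ring
    have e3 : p / (2 * D) ≤ ξ t + η t ^ 2 := by
      rw [div_le_iff₀ (by positivity)]
      have g1 : 4 * |η t| ≤ p / 2 + 8 / p * η t ^ 2 := by
        have : p / 2 + 8 / p * η t ^ 2 - 4 * |η t| = (p - 4 * |η t|) ^ 2 / (2 * p) := by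
          rw [← sq_abs (η t)]; field_simp; ring
        have : 0 ≤ (p - 4 * |η t|) ^ 2 / (2 * p) := by positivity
        linarith
      have g2 : (ω + |a|) * ξ t ^ 2 ≤ (ω + |a|) * X * ξ t := by
        rw [mul_assoc, sq]
        exact mul_le_mul_of_nonneg_left (mul_le_mul_of_nonneg_right hx hx0) (by positivity)
      have g3 : (ω + |a|) * X * ξ t + 8 / p * η t ^ 2 ≤ D * (ξ t + η t ^ 2) := by
        have q1 : 0 ≤ (ω + |a|) * X * η t ^ 2 := by positivity
        have q2 : 0 ≤ 8 / p * ξ t := by positivity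
        rw [hD]; linarith
      linarith
    have e4 : 0 ≤ K * (ω / 2 + 4 * κ * Real.cos θ) * ξ t + η t ^ 2
        - ξ t ^ 2 * (a * η t + ξ t ^ 2 + n t) - p / (2 * D) := by linarith
    have e5 := mul_nonneg hmt0.le e4
    have e6 : m₀ * (p / (2 * D)) ≤ m t * (p / (2 * D)) :=
      mul_le_mul_of_nonneg_right hmt (by positivity)
    rw [← hδ] at e6
    linarith
  choose! f' hf' hf'0 using hd
  have hmono : MonotoneOn (fun t => K * (focusCoord a ω (ξ t) (η t)).arg
      - ξ t * η t - δ * t) (Set.Ici 0) := by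
    refine monotoneOn_of_deriv_nonneg (convex_Ici 0)
      (fun t ht => (hf' t ht).continuousAt.continuousWithinAt)
      (fun t ht => (hf' t (interior_subset ht)).differentiableAt.differentiableWithinAt) ?_
    intro t ht
    rw [(hf' t (interior_subset ht)).deriv]
    exact hf'0 t (interior_subset ht)
  have hB : ∀ t, 0 ≤ t → |K * (focusCoord a ω (ξ t) (η t)).arg - ξ t * η t| ≤ K * Real.pi + X * H := by
    intro t ht
    refine (abs_sub _ _).trans (add_le_add ?_ ?_)
    · rw [abs_mul, abs_of_nonneg hK0]
      refine mul_le_mul_of_nonneg_left ?_ hK0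
      linarith [abs_arg_focusCoord_le (a := a) (ξ := ξ t) (η := η t) hω, Real.pi_pos]
    · rw [abs_mul, abs_of_nonneg (h0 t ht)]
      exact mul_le_mul (hξX t ht) (hηH t ht) (abs_nonneg _) hX0
  obtain ⟨s, hs⟩ : ∃ s, s = (2 * (K * Real.pi + X * H) + 1) / δ := ⟨_, rfl⟩
  have hs0 : 0 ≤ s := by
    rw [hs]
    have := Real.pi_pos
    positivity
  have h1 := hmono (Set.mem_Ici.2 le_rfl) (Set.mem_Ici.2 hs0) hs0
  have h2 := abs_le.1 (hB 0 le_rfl)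
  have h3 := abs_le.1 (hB s hs0)
  have h4 : δ * s = 2 * (K * Real.pi + X * H) + 1 := by rw [hs]; field_simp
  simp only at h1
  linarith [h2.1, h3.2]
end

section

variable {a ω m₀ ρ : ℝ} {ξ η m n : ℝ → ℝ} {I : Set ℝ}

/-- Starting in `ξ > 0`, or at `ξ = 0, η < 0`, a focus curve reaches `ξ = 0, η > 0`. -/
theorem IsFocusCurve.exists_half_turn (hω : 0 < ω) (hω2 : ω ^ 2 = 8 - a ^ 2) (hm : 0 < m₀)
    (h : IsFocusCurve a ω m₀ ξ η m n I) (hIo : IsOpen I) (h0 : (0 : ℝ) ∈ I)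
    (hstart : 0 < ξ 0 ∨ (ξ 0 = 0 ∧ η 0 < 0))
    (hclose : ∀ T > 0, (∀ t ∈ Set.Ico 0 T, t ∈ I ∧ ‖focusCoord a ω (ξ t) (η t)‖ ≤ ρ) → T ∈ I)
    (hρ : turnConst a ω * ‖focusCoord a ω (ξ 0) (η 0)‖ ≤ ρ) :
    ∃ T > 0, (∀ t ∈ Set.Icc 0 T, t ∈ I ∧
        ‖focusCoord a ω (ξ t) (η t)‖ ≤ turnConst a ω * ‖focusCoord a ω (ξ 0) (η 0)‖) ∧
      (∀ t ∈ Set.Ioo 0 T, 0 < ξ t) ∧ ξ T = 0 ∧ 0 < η T := by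
  have hmpos : ∀ t ∈ I, 0 < m t := fun t ht => hm.trans_le (h.le_factor t ht)
  have hinit : ∀ᶠ t in 𝓝[>] (0 : ℝ), t ∈ I ∧ 0 < ξ t := by
    refine Filter.Eventually.and (mem_nhdsWithin_of_mem_nhds (hIo.mem_nhds h0)) ?_
    rcases hstart with hs | ⟨hs, hs'⟩
    · exact mem_nhdsWithin_of_mem_nhds ((h.deriv_fst 0 h0).continuousAt.eventually (lt_mem_nhds hs))
    · have hd : 0 < -(m 0 * η 0) := by nlinarith [hmpos 0 h0]
      have h1 := (hasDerivAt_iff_tendsto_slope.1 (h.deriv_fst 0 h0)).eventually (lt_mem_nhds hd)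
      have h2 := nhdsWithin_mono (0 : ℝ) (fun x (hx : x ∈ Set.Ioi (0 : ℝ)) => ne_of_gt hx) h1
      filter_upwards [h2, self_mem_nhdsWithin] with t ht ht0
      simp only [slope_def_field, hs, sub_zero, div_pos_iff] at ht
      have ht0' : (0:ℝ) < t := ht0
      rcases ht with ht | ht
      · exact ht.1
      · linarith [ht.2]
  obtain ⟨ε, hε, hεI⟩ := mem_nhdsGT_iff_exists_Ioo_subset.1 hinit
  have hε : (0:ℝ) < ε := hε
  obtain ⟨S, hS⟩ : ∃ S : Set ℝ, S = {t | 0 < t ∧ (t ∉ I ∨ ξ t ≤ 0)} := ⟨_, rfl⟩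
  have hnS : ∀ t, 0 < t → t ∉ S → t ∈ I ∧ 0 < ξ t := by
    intro t ht htS
    rw [hS] at htS
    by_contra hcon
    exact htS ⟨ht, by
      by_cases hI : t ∈ I
      · right; by_contra hx; exact hcon ⟨hI, not_le.1 hx⟩
      · exact Or.inl hI⟩
  have h00 : 0 ≤ ξ 0 := by rcases hstart with hs | hs <;> linarith [hs]
  have hSne : S.Nonempty := by
    by_contra hcon
    rw [Set.not_nonempty_iff_eq_empty] at hcon
    have hall : ∀ t, 0 < t → t ∈ I ∧ 0 < ξ t := fun t ht => hnS t ht (by rw [hcon]; simp)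
    refine h.exists_nonpos hω hω2 hm (fun t ht => ?_) (fun t ht => ?_)
    · rcases ht.eq_or_lt with rfl | ht
      · exact h0
      · exact (hall t ht).1
    · rcases ht.eq_or_lt with rfl | ht
      · exact h00
      · exact (hall t ht).2.le
  have hbdd : BddBelow S := ⟨0, fun t ht => by rw [hS] at ht; exact ht.1.le⟩
  obtain ⟨T, hT⟩ : ∃ T, T = sInf S := ⟨_, rfl⟩
  have hεT : ε ≤ T := by
    rw [hT]
    refine le_csInf hSne fun t ht => ?_
    rw [hS] at ht
    by_contra hlt
    have := hεI ⟨ht.1, not_le.1 hlt⟩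
    rcases ht.2 with h' | h'
    · exact h' this.1
    · linarith [this.2]
  have hT0 : 0 < T := hε.trans_le hεT
  have hin : ∀ t ∈ Set.Ioo 0 T, t ∈ I ∧ 0 < ξ t := fun t ht =>
    hnS t ht.1 (fun hmem => absurd (csInf_le hbdd hmem) (by rw [← hT]; exact not_le.2 ht.2))
  have hIco : ∀ t ∈ Set.Ico 0 T, t ∈ I ∧ 0 ≤ ξ t := by
    intro t ht
    rcases ht.1.eq_or_lt with rfl | h'
    · exact ⟨h0, h00⟩
    · exact ⟨(hin t ⟨h', ht.2⟩).1, (hin t ⟨h', ht.2⟩).2.le⟩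
  have hTI : T ∈ I := by
    refine hclose T hT0 fun t ht => ⟨(hIco t ht).1, ?_⟩
    refine le_trans (h.norm_le hω hω2 hm ht.1 (fun u hu => ?_) (fun u hu => ?_)).1 hρ
    · exact (hIco u ⟨hu.1, hu.2.trans_lt ht.2⟩).1
    · exact (hIco u ⟨hu.1, hu.2.trans_lt ht.2⟩).2
  have hcT := (h.deriv_fst T hTI).continuousAt
  have hleft : ∀ᶠ t in 𝓝[<] T, t ∈ Set.Ioo 0 T := Ioo_mem_nhdsLT hT0
  have hξT : 0 ≤ ξ T := by
    refine ge_of_tendsto (hcT.tendsto.mono_left (nhdsWithin_le_nhds (s := Set.Iio T))) ?_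
    filter_upwards [hleft] with t ht using (hin t ht).2.le
  have hIcc : ∀ t ∈ Set.Icc 0 T, t ∈ I ∧ 0 ≤ ξ t := by
    intro t ht
    rcases ht.2.eq_or_lt with rfl | h'
    · exact ⟨hTI, hξT⟩
    · exact hIco t ⟨ht.1, h'⟩
  have hξT0 : ξ T = 0 := by
    by_contra hne
    have hpos : 0 < ξ T := lt_of_le_of_ne hξT (Ne.symm hne)
    have hev : ∀ᶠ t in 𝓝 T, t ∈ I ∧ 0 < ξ t :=
      Filter.Eventually.and (hIo.mem_nhds hTI) (hcT.eventually (lt_mem_nhds hpos))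
    obtain ⟨δ, hδ, hball⟩ := Metric.eventually_nhds_iff.1 hev
    obtain ⟨s, hsS, hs⟩ := exists_lt_of_csInf_lt hSne (show sInf S < T + δ by rw [← hT]; linarith)
    have hsT : T ≤ s := hT ▸ csInf_le hbdd hsS
    have := hball (show dist s T < δ by rw [Real.dist_eq, abs_of_nonneg (by linarith)]; linarith)
    rw [hS] at hsS
    rcases hsS.2 with h' | h'
    · exact h' this.1
    · linarith [this.2]
  refine ⟨T, hT0, fun t ht => ⟨(hIcc t ht).1, ?_⟩, fun t ht => (hin t ht).2, hξT0, ?_⟩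
  · exact (h.norm_le hω hω2 hm ht.1 (fun u hu => (hIcc u ⟨hu.1, hu.2.trans ht.2⟩).1)
      (fun u hu => (hIcc u ⟨hu.1, hu.2.trans ht.2⟩).2)).1
  · by_contra hneg
    have hη : η T ≠ 0 := fun hη => h.ne_zero T hTI ⟨hξT0, hη⟩
    have hη' : η T < 0 := lt_of_le_of_ne (not_lt.1 hneg) hη
    have hd : 0 < -(m T * η T) := by nlinarith [hmpos T hTI]
    have h1 := (hasDerivAt_iff_tendsto_slope.1 (h.deriv_fst T hTI)).eventually (lt_mem_nhds hd)
    have h2 := nhdsWithin_mono T (fun x (hx : x ∈ Set.Iio T) => ne_of_lt hx) h1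
    obtain ⟨t, ht, htT⟩ := ((Filter.Eventually.and h2 hleft)).exists
    simp only [slope_def_field, hξT0, sub_zero, div_pos_iff] at ht
    have := (hin t htT).2
    rcases ht with ht | ht
    · linarith [ht.2, htT.2]
    · linarith [ht.1]

theorem norm_focusCoord_neg (a ω ξ η : ℝ) :
    ‖focusCoord (-a) ω (-ξ) (-η)‖ = ‖focusCoord a ω ξ η‖ := by
  rw [← Complex.norm_conj (focusCoord a ω ξ η)]
  congr 1
  apply Complex.ext
  · rw [Complex.conj_re, focusCoord_re, focusCoord_re]; ring
  · rw [Complex.conj_im, focusCoord_im, focusCoord_im]; ring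

theorem norm_focusCoord_neg_fst (a ω ξ η : ℝ) :
    ‖focusCoord a ω (-ξ) η‖ = ‖focusCoord a ω ξ η‖ := by
  rw [focusCoord, focusCoord, neg_sq]

/-- The rotation by a half-turn turns focus curves into focus curves. -/
theorem IsFocusCurve.neg (h : IsFocusCurve a ω m₀ ξ η m n I) :
    IsFocusCurve (-a) ω m₀ (fun t => -ξ t) (fun t => -η t) m n I where
  deriv_fst t ht := (h.deriv_fst t ht).neg.congr_deriv (by ring)
  deriv_snd t ht := (h.deriv_snd t ht).neg.congr_deriv (by ring)
  le_factor := h.le_factor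
  small t ht := by rw [norm_focusCoord_neg]; exact h.small t ht
  ne_zero t ht hc := h.ne_zero t ht ⟨neg_eq_zero.1 hc.1, neg_eq_zero.1 hc.2⟩

/-- Reversing the time and reflecting `ξ`. -/
theorem IsFocusCurve.reverse (h : IsFocusCurve a ω m₀ ξ η m n I) (s : ℝ) :
    IsFocusCurve a ω m₀ (fun t => -ξ (s - t)) (fun t => η (s - t)) (fun t => m (s - t))
      (fun t => n (s - t)) ((fun t => s - t) ⁻¹' I) where
  deriv_fst t ht := ((h.deriv_fst (s - t) ht).comp_const_sub s t).neg.congr_deriv (by ring)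
  deriv_snd t ht := ((h.deriv_snd (s - t) ht).comp_const_sub s t).congr_deriv (by ring)
  le_factor t ht := h.le_factor (s - t) ht
  small t ht := by rw [norm_focusCoord_neg_fst]; exact h.small (s - t) ht
  ne_zero t ht hc := h.ne_zero (s - t) ht ⟨neg_eq_zero.1 hc.1, hc.2⟩

theorem focusCoord_of_fst_eq_zero (a ω : ℝ) (η : ℝ) : focusCoord a ω 0 η = (4 * η : ℝ) * Complex.I := by
  simp [focusCoord]

theorem arg_focusCoord_of_neg {η : ℝ} (a ω : ℝ) (hη : η < 0) :
    (focusCoord a ω 0 η).arg = -(Real.pi / 2) := by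
  rw [focusCoord_of_fst_eq_zero, show ((4 * η : ℝ) : ℂ) * Complex.I
    = ((-(4 * η) : ℝ) : ℂ) * (-Complex.I) by push_cast; ring,
    Complex.arg_real_mul _ (by linarith : 0 < -(4 * η)), Complex.arg_neg_I]

theorem arg_focusCoord_of_pos {η : ℝ} (a ω : ℝ) (hη : 0 < η) :
    (focusCoord a ω 0 η).arg = Real.pi / 2 := by
  rw [focusCoord_of_fst_eq_zero, Complex.arg_real_mul _ (by linarith : 0 < 4 * η), Complex.arg_I]

theorem norm_focusCoord_fst_zero (a ω η : ℝ) : ‖focusCoord a ω 0 η‖ = 4 * |η| := by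
  rw [focusCoord_of_fst_eq_zero, norm_mul, Complex.norm_I, mul_one, Complex.norm_real,
    Real.norm_eq_abs, abs_mul, abs_of_pos (by norm_num : (0:ℝ) < 4)]

/-- A half-turn of a focus curve can be parametrized by the angle. -/
theorem IsFocusCurve.exists_polar (hω : 0 < ω) (hω2 : ω ^ 2 = 8 - a ^ 2) (hm : 0 < m₀)
    (h : IsFocusCurve a ω m₀ ξ η m n I) {T : ℝ} (hT : 0 < T) (hI : Set.Icc 0 T ⊆ I)
    (hpos : ∀ t ∈ Set.Ioo 0 T, 0 < ξ t) (hξ0 : ξ 0 = 0) (hξT : ξ T = 0) (hη0 : η 0 < 0)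
    (hηT : 0 < η T) :
    ∃ τ : ℝ → ℝ, Continuous τ ∧ τ (-(Real.pi / 2)) = 0 ∧ τ (Real.pi / 2) = T ∧
      (∀ θ, τ θ ∈ Set.Icc 0 T) ∧
      ∀ θ ∈ Set.Ioo (-(Real.pi / 2)) (Real.pi / 2), τ θ ∈ Set.Ioo 0 T ∧
        (focusCoord a ω (ξ (τ θ)) (η (τ θ))).arg = θ ∧
        HasDerivAt (fun θ => Real.log ‖focusCoord a ω (ξ (τ θ)) (η (τ θ))‖)
          ((a / 2 + 4 * (n (τ θ) / ‖focusCoord a ω (ξ (τ θ)) (η (τ θ))‖) * Real.sin θ) /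
           (ω / 2 + 4 * (n (τ θ) / ‖focusCoord a ω (ξ (τ θ)) (η (τ θ))‖) * Real.cos θ)) θ := by
  set g : ℝ → ℝ := fun t => (focusCoord a ω (ξ t) (η t)).arg with hg
  have hd := fun t (ht : t ∈ Set.Icc 0 T) => h.hasDerivAt_log hω hω2 (hI ht)
  have hcont : ContinuousOn g (Set.Icc 0 T) := fun t ht =>
    (hd t ht).2.continuousAt.continuousWithinAt
  have hDpos : ∀ t ∈ Set.Icc 0 T, 0 < ω / 2 + 4 * (n t / ‖focusCoord a ω (ξ t) (η t)‖) *
      Real.cos (focusCoord a ω (ξ t) (η t)).arg := by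
    intro t ht
    have hκ := h.abs_ratio_le hω (hI ht)
    set κ := n t / ‖focusCoord a ω (ξ t) (η t)‖
    set θ := (focusCoord a ω (ξ t) (η t)).arg
    have hcs : |4 * κ * Real.cos θ| ≤ ω / 4 := by
      rw [abs_mul, abs_mul, abs_of_pos (by norm_num : (0:ℝ) < 4)]
      nlinarith [abs_nonneg κ, abs_nonneg (Real.cos θ), Real.abs_cos_le_one θ]
    linarith [(abs_le.1 hcs).1]
  have hgpos : ∀ t ∈ Set.Ioo 0 T, 0 < m t * ξ t * (ω / 2 + 4 *
      (n t / ‖focusCoord a ω (ξ t) (η t)‖) * Real.cos (focusCoord a ω (ξ t) (η t)).arg) :=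
    fun t ht => mul_pos (mul_pos (hm.trans_le (h.le_factor t (hI (Set.Ioo_subset_Icc_self ht))))
      (hpos t ht)) (hDpos t (Set.Ioo_subset_Icc_self ht))
  have hmono : StrictMonoOn g (Set.Icc 0 T) := by
    refine strictMonoOn_of_deriv_pos (convex_Icc 0 T) hcont fun t ht => ?_
    rw [interior_Icc] at ht
    rw [(hd t (Set.Ioo_subset_Icc_self ht)).2.deriv]
    exact hgpos t ht
  have hg0 : g 0 = -(Real.pi / 2) := by rw [hg]; simp only; rw [hξ0]; exact arg_focusCoord_of_neg a ω hη0
  have hgT : g T = Real.pi / 2 := by rw [hg]; simp only; rw [hξT]; exact arg_focusCoord_of_pos a ω hηT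
  have hmaps : Set.MapsTo g (Set.Icc 0 T) (Set.Icc (-(Real.pi / 2)) (Real.pi / 2)) := fun t _ =>
    abs_le.1 (abs_arg_focusCoord_le hω)
  have hsurj : Set.SurjOn g (Set.Icc 0 T) (Set.Icc (-(Real.pi / 2)) (Real.pi / 2)) := by
    have := intermediate_value_Icc hT.le hcont
    rwa [hg0, hgT] at this
  have hbij : Function.Bijective (hmaps.restrict g _ _) :=
    ⟨hmaps.restrict_inj.2 hmono.injOn, hmaps.restrict_surjective_iff.2 hsurj⟩
  have hrc : Continuous (hmaps.restrict g _ _) := hcont.mapsToRestrict hmaps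
  obtain ⟨H, hH⟩ : ∃ H : Set.Icc 0 T ≃ₜ Set.Icc (-(Real.pi / 2)) (Real.pi / 2),
      ∀ x, (H x : ℝ) = g x :=
    ⟨Continuous.homeoOfEquivCompactToT2 (f := Equiv.ofBijective _ hbij) hrc, fun x => rfl⟩
  have hpi : -(Real.pi / 2) ≤ Real.pi / 2 := by linarith [Real.pi_pos]
  obtain ⟨τ, hτ⟩ : ∃ τ : ℝ → ℝ, τ = fun θ => (H.symm (Set.projIcc _ _ hpi θ) : ℝ) := ⟨_, rfl⟩
  have hτc : Continuous τ := by
    rw [hτ]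
    exact continuous_subtype_val.comp (H.symm.continuous.comp continuous_projIcc)
  have hτmem : ∀ θ, τ θ ∈ Set.Icc 0 T := fun θ => by rw [hτ]; exact Subtype.mem _
  have hgτ : ∀ θ ∈ Set.Icc (-(Real.pi / 2)) (Real.pi / 2), g (τ θ) = θ := by
    intro θ hθ
    rw [hτ]
    simp only
    rw [← hH, Homeomorph.apply_symm_apply, Set.projIcc_of_mem hpi hθ]
  have hτ0 : τ (-(Real.pi / 2)) = 0 := by
    refine hmono.injOn (hτmem _) (Set.left_mem_Icc.2 hT.le) ?_
    rw [hg0, hgτ _ (Set.left_mem_Icc.2 hpi)]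
  have hτT : τ (Real.pi / 2) = T := by
    refine hmono.injOn (hτmem _) (Set.right_mem_Icc.2 hT.le) ?_
    rw [hgT, hgτ _ (Set.right_mem_Icc.2 hpi)]
  refine ⟨τ, hτc, hτ0, hτT, hτmem, fun θ hθ => ?_⟩
  have hθ' := Set.Ioo_subset_Icc_self hθ
  have hτo : τ θ ∈ Set.Ioo 0 T := by
    refine ⟨lt_of_le_of_ne (hτmem θ).1 fun hc => ?_, lt_of_le_of_ne (hτmem θ).2 fun hc => ?_⟩
    · have := hgτ θ hθ'
      rw [← hc, hg0] at this
      linarith [hθ.1]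
    · have := hgτ θ hθ'
      rw [hc, hgT] at this
      linarith [hθ.2]
  have harg : (focusCoord a ω (ξ (τ θ)) (η (τ θ))).arg = θ := hgτ θ hθ'
  refine ⟨hτo, harg, ?_⟩
  have hev : ∀ᶠ y in 𝓝 θ, g (τ y) = y := by
    filter_upwards [Ioo_mem_nhds hθ.1 hθ.2] with y hy using hgτ y (Set.Ioo_subset_Icc_self hy)
  have d1 := HasDerivAt.of_local_left_inverse hτc.continuousAt (hd (τ θ) (hτmem θ)).2
    (hgpos (τ θ) hτo).ne' hev
  have d2 := HasDerivAt.comp θ (hd (τ θ) (hτmem θ)).1 d1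
  refine d2.congr_deriv ?_
  have hm' : 0 < m (τ θ) * ξ (τ θ) :=
    mul_pos (hm.trans_le (h.le_factor _ (hI (hτmem θ)))) (hpos _ hτo)
  have hD := hDpos (τ θ) (hτmem θ)
  rw [harg] at hD ⊢
  rw [← div_eq_mul_inv]
  exact mul_div_mul_left _ _ hm'.ne'
end

theorem pos_of_deriv_bounds {x y A B c : ℝ} (hxy : x < y) (hA : 0 ≤ A) (hB : 0 ≤ B) (hc : 0 < c)
    (K : ℕ) {w : ℝ → ℝ} (hw : Continuous w) (hwpos : 0 < ∫ t in x..y, w t) :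
    ∃ ρ₀ > 0, ∀ ρ, 0 < ρ → ρ < ρ₀ → ∀ s s' : ℝ → ℝ, ContinuousOn s (Set.Icc x y) → s x = 0 →
      (∀ t ∈ Set.Ioo x y, HasDerivAt s (s' t) t) →
      (∀ t ∈ Set.Ioo x y, |s' t| ≤ A * ρ ^ K + B * ρ * |s t|) →
      (∀ t ∈ Set.Ioo x y, c * ρ ^ K * w t - B * ρ * |s t| - B * ρ ^ (K + 1) ≤ s' t) → 0 < s y := by
  obtain ⟨D, hD⟩ : ∃ D, D = B * (2 * A * (y - x) + 1) := ⟨_, rfl⟩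
  obtain ⟨W, hW⟩ : ∃ W, W = ∫ t in x..y, w t := ⟨_, rfl⟩
  have hyx : 0 < y - x := sub_pos.2 hxy
  have hD0 : 0 ≤ D := by rw [hD]; positivity
  rw [← hW] at hwpos
  refine ⟨min (1 / (2 * B * (y - x) + 1)) (c * W / (D * (y - x) + 1)), by positivity, ?_⟩
  intro ρ hρ hρ0 s s' hs hsx hds h1 h2
  have hρ1 : ρ * (2 * B * (y - x) + 1) < 1 :=
    (lt_div_iff₀ (by positivity)).1 (hρ0.trans_le (min_le_left _ _))
  have hρ2 : ρ * (D * (y - x) + 1) < c * W :=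
    (lt_div_iff₀ (by positivity)).1 (hρ0.trans_le (min_le_right _ _))
  have hρK : 0 < ρ ^ K := pow_pos hρ K
  obtain ⟨t₀, ht₀, hmax⟩ := isCompact_Icc.exists_isMaxOn (Set.nonempty_Icc.2 hxy.le) hs.abs
  obtain ⟨M, hM⟩ : ∃ M, M = |s t₀| := ⟨_, rfl⟩
  have hsM : ∀ t ∈ Set.Icc x y, |s t| ≤ M := fun t ht => hM ▸ hmax ht
  have hM0 : 0 ≤ M := hM ▸ abs_nonneg _
  obtain ⟨E, hE⟩ : ∃ E, E = A * ρ ^ K + B * ρ * M := ⟨_, rfl⟩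
  have hE0 : 0 ≤ E := by rw [hE]; positivity
  have mono : ∀ f f' : ℝ → ℝ, ContinuousOn f (Set.Icc x y) →
      (∀ t ∈ Set.Ioo x y, HasDerivAt f (f' t) t) → (∀ t ∈ Set.Ioo x y, 0 ≤ f' t) →
      MonotoneOn f (Set.Icc x y) := by
    intro f f' hf hd hn
    refine monotoneOn_of_deriv_nonneg (convex_Icc x y) hf (fun t ht => ?_) fun t ht => ?_
    · exact (hd t (by rwa [interior_Icc] at ht)).differentiableAt.differentiableWithinAt
    · rw [interior_Icc] at ht
      rw [(hd t ht).deriv]; exact hn t ht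
  have hs'E : ∀ t ∈ Set.Ioo x y, |s' t| ≤ E := fun t ht => (h1 t ht).trans (by
    rw [hE]
    have := mul_le_mul_of_nonneg_left (hsM t (Set.Ioo_subset_Icc_self ht)) (by positivity : 0 ≤ B * ρ)
    linarith)
  have m1 := mono (fun t => s t + E * t) (fun t => s' t + E * 1) (hs.add (by fun_prop))
    (fun t ht => (hds t ht).add ((hasDerivAt_id t).const_mul E))
    (fun t ht => by linarith [(abs_le.1 (hs'E t ht)).1])
  have m2 := mono (fun t => E * t - s t) (fun t => E * 1 - s' t)
    (ContinuousOn.sub (by fun_prop) hs)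
    (fun t ht => ((hasDerivAt_id t).const_mul E).sub (hds t ht))
    (fun t ht => by linarith [(abs_le.1 (hs'E t ht)).2])
  have n1 := m1 (Set.left_mem_Icc.2 hxy.le) ht₀ ht₀.1
  have n2 := m2 (Set.left_mem_Icc.2 hxy.le) ht₀ ht₀.1
  simp only [hsx] at n1 n2
  have hMle : M ≤ E * (y - x) := by
    have : E * (t₀ - x) ≤ E * (y - x) := mul_le_mul_of_nonneg_left (by linarith [ht₀.2]) hE0
    rw [hM, abs_le]; constructor <;> linarith
  have hM2 : M ≤ 2 * A * (y - x) * ρ ^ K := by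
    have e1 : B * ρ * (y - x) * M ≤ 1 / 2 * M := mul_le_mul_of_nonneg_right (by linarith) hM0
    rw [hE] at hMle
    linarith
  have dW := fun t => (hw.integral_hasStrictDerivAt x t).hasDerivAt
  have m3 := mono (fun t => s t - c * ρ ^ K * (∫ u in x..t, w u) + D * ρ ^ (K + 1) * t)
    (fun t => s' t - c * ρ ^ K * w t + D * ρ ^ (K + 1) * 1)
    ((hs.sub (ContinuousOn.const_smul (c := c * ρ ^ K)
      (fun t _ => (dW t).continuousAt.continuousWithinAt))).add (by fun_prop))
    (fun t ht => ((hds t ht).sub ((dW t).const_mul _)).add ((hasDerivAt_id t).const_mul _))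
    (fun t ht => by
      have e1 := h2 t ht
      have e2 : B * ρ * |s t| ≤ B * ρ * (2 * A * (y - x) * ρ ^ K) :=
        mul_le_mul_of_nonneg_left ((hsM t (Set.Ioo_subset_Icc_self ht)).trans hM2) (by positivity)
      have e3 : D * ρ ^ (K + 1) * 1 = B * ρ * (2 * A * (y - x) * ρ ^ K) + B * ρ ^ (K + 1) := by
        rw [hD]; ring
      linarith)
  have n3 := m3 (Set.left_mem_Icc.2 hxy.le) (Set.right_mem_Icc.2 hxy.le) hxy.le
  simp only [hsx, intervalIntegral.integral_same, ← hW] at n3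
  have e : 0 < ρ ^ K * (c * W - ρ * (D * (y - x) + 1)) := mul_pos hρK (by linarith)
  have e2 : ρ ^ K * (c * W - ρ * (D * (y - x) + 1)) =
    c * ρ ^ K * W - D * ρ ^ (K + 1) * (y - x) - ρ ^ (K + 1) := by ring
  have : 0 < ρ ^ (K + 1) := by positivity
  linarith

/-- The asymptotic conditions on two perturbations `N₁, N₂`: `N₂ - N₁` has the leading term
`W ξ ^ K η` for the weights `(1, 2)` of `(ξ, η)`, up to higher order, and `N₂ / r²` is Lipschitz
continuous in `r`. -/
def HasTurnExpansion (N₁ N₂ : ℝ → ℝ → ℝ) (K : ℕ) (W : ℝ) : Prop :=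
  ∀ R : ℝ, ∃ r₀ > 0, ∃ B ≥ 0, ∀ k l : ℝ, 0 ≤ k → k ≤ R → |l| ≤ R →
    (∀ r, 0 < r → r < r₀ →
      |N₂ (r * k) (r ^ 2 * l) - N₁ (r * k) (r ^ 2 * l) - W * r ^ (K + 2) * (k ^ K * l)|
        ≤ B * r ^ (K + 3)) ∧
    ∀ r₁ r₂, 0 < r₁ → r₁ < r₀ → 0 < r₂ → r₂ < r₀ →
      |N₂ (r₂ * k) (r₂ ^ 2 * l) / r₂ ^ 2 - N₂ (r₁ * k) (r₁ ^ 2 * l) / r₁ ^ 2| ≤ B * |r₂ - r₁|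

theorem turn_quotient_sub {a ω θ κ₁ κ₂ : ℝ} (hω : 0 < ω)
    (h₁ : ω / 2 + 4 * κ₁ * Real.cos θ ≠ 0) (h₂ : ω / 2 + 4 * κ₂ * Real.cos θ ≠ 0) :
    (a / 2 + 4 * κ₂ * Real.sin θ) / (ω / 2 + 4 * κ₂ * Real.cos θ)
      - (a / 2 + 4 * κ₁ * Real.sin θ) / (ω / 2 + 4 * κ₁ * Real.cos θ)
    = 8 * ω * ((Real.sin θ - a * (Real.cos θ / ω)) / 4) * (κ₂ - κ₁) /
      ((ω / 2 + 4 * κ₁ * Real.cos θ) * (ω / 2 + 4 * κ₂ * Real.cos θ)) := by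
  rw [div_sub_div _ _ h₂ h₁, mul_comm (ω / 2 + 4 * κ₁ * Real.cos θ)]
  congr 1
  field_simp
  ring

theorem abs_exp_half_sub_le {L₁ L₂ P : ℝ} (h₁ : Real.exp (L₁ / 2) ≤ P) (h₂ : Real.exp (L₂ / 2) ≤ P) :
    |Real.exp (L₂ / 2) - Real.exp (L₁ / 2)| ≤ P * |L₂ - L₁| := by
  have hP : 0 ≤ P := (Real.exp_pos _).le.trans h₁
  have key : ∀ u v : ℝ, Real.exp v ≤ P → Real.exp v - Real.exp u ≤ P * |v - u| := by
    intro u v hv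
    have h1 := Real.add_one_le_exp (u - v)
    have h2 : Real.exp u = Real.exp v * Real.exp (u - v) := by rw [← Real.exp_add]; ring_nf
    have h3 : Real.exp v * (1 - Real.exp (u - v)) ≤ Real.exp v * |v - u| :=
      mul_le_mul_of_nonneg_left (by linarith [le_abs_self (v - u)]) (Real.exp_pos v).le
    have h4 := mul_le_mul_of_nonneg_right hv (abs_nonneg (v - u))
    rw [h2]; linarith
  have e : |L₂ / 2 - L₁ / 2| ≤ |L₂ - L₁| := by
    rw [← sub_div, abs_div, abs_of_pos (by norm_num : (0:ℝ) < 2)]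
    linarith [abs_nonneg (L₂ - L₁)]
  have e' : |L₁ / 2 - L₂ / 2| ≤ |L₂ - L₁| := by rw [abs_sub_comm]; exact e
  have := mul_le_mul_of_nonneg_left e hP
  have := mul_le_mul_of_nonneg_left e' hP
  rw [abs_le]
  constructor
  · linarith [key (L₂ / 2) (L₁ / 2) h₁]
  · linarith [key (L₁ / 2) (L₂ / 2) h₂]

/-- The coordinate `ξ` on the curve `‖ζ‖ = 1` as a function of the angle. -/
noncomputable def turnFst (ω θ : ℝ) : ℝ := Real.sqrt (Real.cos θ / ω)

/-- The coordinate `η` on the curve `‖ζ‖ = 1` as a function of the angle. -/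
noncomputable def turnSnd (a ω θ : ℝ) : ℝ := (Real.sin θ - a * (Real.cos θ / ω)) / 4

theorem turnFst_nonneg (ω θ : ℝ) : 0 ≤ turnFst ω θ := Real.sqrt_nonneg _

theorem turnFst_le {ω : ℝ} (hω : 0 < ω) (θ : ℝ) : turnFst ω θ ≤ 1 + 1 / ω := by
  refine Real.sqrt_le_iff.2 ⟨by positivity, ?_⟩
  have h1 : Real.cos θ / ω ≤ 1 / ω := by gcongr; exact Real.cos_le_one θ
  have h2 : 0 < 1 / ω := by positivity
  nlinarith

theorem abs_turnSnd_le {ω : ℝ} (hω : 0 < ω) (a θ : ℝ) : |turnSnd a ω θ| ≤ 1 + |a| / ω := by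
  rw [turnSnd, abs_div, abs_of_pos (by norm_num : (0:ℝ) < 4)]
  have h1 := abs_sub (Real.sin θ) (a * (Real.cos θ / ω))
  have h2 : |a * (Real.cos θ / ω)| ≤ |a| / ω := by
    rw [abs_mul, abs_div, abs_of_pos hω, ← mul_div_assoc]
    gcongr
    exact mul_le_of_le_one_right (abs_nonneg a) (Real.abs_cos_le_one θ)
  have h3 := Real.abs_sin_le_one θ
  have h4 : 0 ≤ |a| / ω := by positivity
  linarith

theorem continuous_turnFst (ω : ℝ) : Continuous (turnFst ω) := by unfold turnFst; fun_prop

theorem continuous_turnSnd (a ω : ℝ) : Continuous (turnSnd a ω) := by unfold turnSnd; fun_prop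

theorem integral_turn_pos {ω : ℝ} (hω : 0 < ω) (a : ℝ) (K : ℕ) :
    0 < ∫ θ in (-(Real.pi / 2))..(Real.pi / 2), turnFst ω θ ^ K * turnSnd a ω θ ^ 2 := by
  have hpi := Real.pi_pos
  refine intervalIntegral.integral_pos (by linarith)
    (((continuous_turnFst ω).pow K).mul ((continuous_turnSnd a ω).pow 2)).continuousOn
    (fun θ _ => mul_nonneg (pow_nonneg (turnFst_nonneg ω θ) K) (sq_nonneg _)) ?_
  have hcos : ∀ θ, θ = Real.pi / 4 ∨ θ = -(Real.pi / 4) → 0 < turnFst ω θ := by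
    intro θ hθ
    refine Real.sqrt_pos.2 (div_pos (Real.cos_pos_of_mem_Ioo ?_) hω)
    rcases hθ with rfl | rfl <;> constructor <;> linarith
  have hc4 : 0 < Real.cos (Real.pi / 4) := Real.cos_pos_of_mem_Ioo ⟨by linarith, by linarith⟩
  have hs4 : 0 < Real.sin (Real.pi / 4) := Real.sin_pos_of_pos_of_lt_pi (by linarith) (by linarith)
  rcases le_or_gt 0 a with ha | ha
  · refine ⟨-(Real.pi / 4), ⟨by linarith, by linarith⟩, ?_⟩
    have : turnSnd a ω (-(Real.pi / 4)) ≠ 0 := by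
      have : 0 ≤ a * (Real.cos (Real.pi / 4) / ω) := by positivity
      rw [turnSnd, Real.sin_neg, Real.cos_neg]
      apply ne_of_lt
      linarith
    have := hcos _ (Or.inr rfl)
    positivity
  · refine ⟨Real.pi / 4, ⟨by linarith, by linarith⟩, ?_⟩
    have : turnSnd a ω (Real.pi / 4) ≠ 0 := by
      have : 0 < (-a) * (Real.cos (Real.pi / 4) / ω) := mul_pos (by linarith) (by positivity)
      rw [turnSnd]
      apply ne_of_gt
      linarith
    have := hcos _ (Or.inl rfl)
    positivity

theorem turn_deriv_sub {a ω W B P R r₀ θ κ₁ κ₂ r₁ r₂ s : ℝ} {N₁ N₂ : ℝ → ℝ → ℝ} {K : ℕ} (hω : 0 < ω)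
    (hB : 0 ≤ B) (hP : P < r₀)
    (hexp : ∀ k l : ℝ, 0 ≤ k → k ≤ R → |l| ≤ R →
      (∀ r, 0 < r → r < r₀ →
        |N₂ (r * k) (r ^ 2 * l) - N₁ (r * k) (r ^ 2 * l) - W * r ^ (K + 2) * (k ^ K * l)|
          ≤ B * r ^ (K + 3)) ∧
      ∀ r₁ r₂, 0 < r₁ → r₁ < r₀ → 0 < r₂ → r₂ < r₀ →
        |N₂ (r₂ * k) (r₂ ^ 2 * l) / r₂ ^ 2 - N₂ (r₁ * k) (r₁ ^ 2 * l) / r₁ ^ 2| ≤ B * |r₂ - r₁|)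
    (hkR : turnFst ω θ ≤ R) (hlR : |turnSnd a ω θ| ≤ R)
    (hκ₁ : |κ₁| ≤ ω / 16) (hκ₂ : |κ₂| ≤ ω / 16)
    (hk₁ : κ₁ = N₁ (r₁ * turnFst ω θ) (r₁ ^ 2 * turnSnd a ω θ) / r₁ ^ 2)
    (hk₂ : κ₂ = N₂ (r₂ * turnFst ω θ) (r₂ ^ 2 * turnSnd a ω θ) / r₂ ^ 2)
    (hr₁0 : 0 < r₁) (hr₂0 : 0 < r₂) (hr₁P : r₁ ≤ P) (hr₂P : r₂ ≤ P)
    (hrr : |r₂ - r₁| ≤ P * |s|) :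
    ∃ Q e : ℝ, 8 / ω ≤ Q ∧ Q ≤ 128 / ω ∧ |e| ≤ B * P * |s| + B * P ^ (K + 1) ∧
      (a / 2 + 4 * κ₂ * Real.sin θ) / (ω / 2 + 4 * κ₂ * Real.cos θ)
      - (a / 2 + 4 * κ₁ * Real.sin θ) / (ω / 2 + 4 * κ₁ * Real.cos θ)
      = Q * (W * r₁ ^ K * (turnFst ω θ ^ K * turnSnd a ω θ ^ 2)) + Q * turnSnd a ω θ * e := by
  have hD : ∀ κ : ℝ, |κ| ≤ ω / 16 → ω / 4 ≤ ω / 2 + 4 * κ * Real.cos θ ∧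
      ω / 2 + 4 * κ * Real.cos θ ≤ ω := by
    intro κ hκ
    have hcs : |4 * κ * Real.cos θ| ≤ ω / 4 := by
      rw [abs_mul, abs_mul, abs_of_pos (by norm_num : (0:ℝ) < 4)]
      nlinarith [abs_nonneg κ, abs_nonneg (Real.cos θ), Real.abs_cos_le_one θ]
    constructor <;> linarith [(abs_le.1 hcs).1, (abs_le.1 hcs).2]
  obtain ⟨u₁, v₁⟩ := hD _ hκ₁
  obtain ⟨u₂, v₂⟩ := hD _ hκ₂
  have hsub := turn_quotient_sub (a := a) (θ := θ) (κ₁ := κ₁) (κ₂ := κ₂) hω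
    (by intro h; linarith) (by intro h; linarith)
  generalize ω / 2 + 4 * κ₁ * Real.cos θ = D₁ at *
  generalize ω / 2 + 4 * κ₂ * Real.cos θ = D₂ at *
  have hD₁ : 0 < D₁ := by linarith
  have hD₂ : 0 < D₂ := by linarith
  have hE := hexp (turnFst ω θ) (turnSnd a ω θ) (turnFst_nonneg ω θ) hkR hlR
  have hl := turnSnd.eq_1 a ω θ
  have e1 := hE.1 r₁ hr₁0 (hr₁P.trans_lt hP)
  have e2 := hE.2 r₁ r₂ hr₁0 (hr₁P.trans_lt hP) hr₂0 (hr₂P.trans_lt hP)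
  generalize turnFst ω θ = k at *
  generalize turnSnd a ω θ = l at *
  refine ⟨8 * ω / (D₁ * D₂), κ₂ - κ₁ - W * r₁ ^ K * (k ^ K * l), ?_, ?_, ?_, ?_⟩
  · rw [div_le_div_iff₀ hω (by positivity)]
    linarith [mul_le_mul v₁ v₂ hD₂.le hω.le]
  · rw [div_le_div_iff₀ (by positivity) hω]
    linarith [mul_le_mul u₁ u₂ (by positivity) hD₁.le]
  · have e3 : κ₂ - κ₁ - W * r₁ ^ K * (k ^ K * l) =
        (N₂ (r₂ * k) (r₂ ^ 2 * l) / r₂ ^ 2 - N₂ (r₁ * k) (r₁ ^ 2 * l) / r₁ ^ 2) +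
        (N₂ (r₁ * k) (r₁ ^ 2 * l) - N₁ (r₁ * k) (r₁ ^ 2 * l) - W * r₁ ^ (K + 2) * (k ^ K * l))
          / r₁ ^ 2 := by
      rw [hk₁, hk₂]; field_simp; ring
    rw [e3]
    refine (abs_add_le _ _).trans (add_le_add (e2.trans ?_) ?_)
    · rw [mul_assoc]; exact mul_le_mul_of_nonneg_left hrr hB
    · rw [abs_div, abs_of_pos (by positivity : 0 < r₁ ^ 2), div_le_iff₀ (by positivity)]
      refine e1.trans ?_
      have : r₁ ^ (K + 1) ≤ P ^ (K + 1) := pow_le_pow_left₀ hr₁0.le hr₁P _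
      have := mul_le_mul_of_nonneg_right (mul_le_mul_of_nonneg_left this hB) (sq_nonneg r₁)
      calc B * r₁ ^ (K + 3) = B * r₁ ^ (K + 1) * r₁ ^ 2 := by ring
        _ ≤ _ := this
  · rw [hsub, ← hl]
    ring

theorem log_lt_of_hasTurnExpansion {a ω W c : ℝ} {N₁ N₂ : ℝ → ℝ → ℝ} {K : ℕ} (hω : 0 < ω)
    (hW : 0 < W) (hN : HasTurnExpansion N₁ N₂ K W) (hc : 1 ≤ c) :
    ∃ ρ₀ > 0, ∀ ρ, 0 < ρ → ρ < ρ₀ → ∀ L₁ L₂ κ₁ κ₂ : ℝ → ℝ,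
      ContinuousOn L₁ (Set.Icc (-(Real.pi / 2)) (Real.pi / 2)) →
      ContinuousOn L₂ (Set.Icc (-(Real.pi / 2)) (Real.pi / 2)) →
      L₁ (-(Real.pi / 2)) = L₂ (-(Real.pi / 2)) →
      (∀ θ, ρ / c ≤ Real.exp (L₁ θ / 2) ∧ Real.exp (L₁ θ / 2) ≤ c * ρ) →
      (∀ θ, ρ / c ≤ Real.exp (L₂ θ / 2) ∧ Real.exp (L₂ θ / 2) ≤ c * ρ) →
      (∀ θ ∈ Set.Ioo (-(Real.pi / 2)) (Real.pi / 2), |κ₁ θ| ≤ ω / 16 ∧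
        κ₁ θ = N₁ (Real.exp (L₁ θ / 2) * turnFst ω θ) (Real.exp (L₁ θ / 2) ^ 2 * turnSnd a ω θ)
          / Real.exp (L₁ θ / 2) ^ 2 ∧
        HasDerivAt L₁ ((a / 2 + 4 * κ₁ θ * Real.sin θ) / (ω / 2 + 4 * κ₁ θ * Real.cos θ)) θ) →
      (∀ θ ∈ Set.Ioo (-(Real.pi / 2)) (Real.pi / 2), |κ₂ θ| ≤ ω / 16 ∧
        κ₂ θ = N₂ (Real.exp (L₂ θ / 2) * turnFst ω θ) (Real.exp (L₂ θ / 2) ^ 2 * turnSnd a ω θ)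
          / Real.exp (L₂ θ / 2) ^ 2 ∧
        HasDerivAt L₂ ((a / 2 + 4 * κ₂ θ * Real.sin θ) / (ω / 2 + 4 * κ₂ θ * Real.cos θ)) θ) →
      L₁ (Real.pi / 2) < L₂ (Real.pi / 2) := by
  obtain ⟨R, hR⟩ : ∃ R, R = (1 + 1 / ω) + (1 + |a| / ω) := ⟨_, rfl⟩
  have hR0 : 0 < R := by rw [hR]; positivity
  have hkR : ∀ θ, turnFst ω θ ≤ R := fun θ => (turnFst_le hω θ).trans (by
    have : 0 ≤ |a| / ω := by positivity
    linarith)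
  have hlR : ∀ θ, |turnSnd a ω θ| ≤ R := fun θ => (abs_turnSnd_le hω a θ).trans (by
    have : 0 ≤ 1 / ω := by positivity
    linarith)
  obtain ⟨r₀, hr₀, B, hB, hexp⟩ := hN R
  have hc0 : 0 < c := by linarith
  obtain ⟨B', hB'⟩ : ∃ B', B' = 128 / ω * R * B * c ^ (K + 1) := ⟨_, rfl⟩
  have hB'0 : 0 ≤ B' := by rw [hB']; positivity
  obtain ⟨A, hA⟩ : ∃ A, A = 128 / ω * W * c ^ K * R ^ (K + 2) + B' := ⟨_, rfl⟩
  have hA0 : 0 ≤ A := by rw [hA]; positivity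
  obtain ⟨ρ₁, hρ₁, hmain⟩ := pos_of_deriv_bounds (x := -(Real.pi / 2)) (y := Real.pi / 2)
    (w := fun θ => turnFst ω θ ^ K * turnSnd a ω θ ^ 2)
    (by linarith [Real.pi_pos]) hA0 hB'0 (by positivity : 0 < 8 / ω * W / c ^ K) K
    (((continuous_turnFst ω).pow K).mul ((continuous_turnSnd a ω).pow 2))
    (integral_turn_pos hω a K)
  refine ⟨min (min ρ₁ 1) (r₀ / c), by positivity, ?_⟩
  intro ρ hρ hρlt L₁ L₂ κ₁ κ₂ hL₁ hL₂ h0 hb₁ hb₂ h₁ h₂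
  have hρ1 : ρ < ρ₁ := hρlt.trans_le ((min_le_left _ _).trans (min_le_left _ _))
  have hρone : ρ < 1 := hρlt.trans_le ((min_le_left _ _).trans (min_le_right _ _))
  have hρr : c * ρ < r₀ := by
    have := (lt_div_iff₀ hc0).1 (hρlt.trans_le (min_le_right _ _))
    linarith
  have key : ∀ θ ∈ Set.Ioo (-(Real.pi / 2)) (Real.pi / 2), ∃ d₁ d₂ Q e : ℝ,
      HasDerivAt L₁ d₁ θ ∧ HasDerivAt L₂ d₂ θ ∧ 8 / ω ≤ Q ∧ Q ≤ 128 / ω ∧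
      |e| ≤ B * (c * ρ) * |L₂ θ - L₁ θ| + B * (c * ρ) ^ (K + 1) ∧
      d₂ - d₁ = Q * (W * Real.exp (L₁ θ / 2) ^ K * (turnFst ω θ ^ K * turnSnd a ω θ ^ 2))
        + Q * turnSnd a ω θ * e := by
    intro θ hθ
    obtain ⟨hκ₁, hk₁, hd₁⟩ := h₁ θ hθ
    obtain ⟨hκ₂, hk₂, hd₂⟩ := h₂ θ hθ
    obtain ⟨Q, e, q₁, q₂, q₃, q₄⟩ := turn_deriv_sub (s := L₂ θ - L₁ θ) hω hB hρr hexp (hkR θ) (hlR θ)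
      hκ₁ hκ₂ hk₁ hk₂ (Real.exp_pos _) (Real.exp_pos _) (hb₁ θ).2 (hb₂ θ).2
      (abs_exp_half_sub_le (hb₁ θ).2 (hb₂ θ).2)
    exact ⟨_, _, Q, e, hd₁, hd₂, q₁, q₂, q₃, q₄⟩
  choose! d₁ d₂ Q e k₁ k₂ k₃ k₄ k₅ k₆ using key
  have hss := hmain ρ hρ hρ1 (fun θ => L₂ θ - L₁ θ) (fun θ => d₂ θ - d₁ θ) (hL₂.sub hL₁)
    (by rw [h0, sub_self]) (fun θ hθ => (k₂ θ hθ).sub (k₁ θ hθ)) ?_ ?_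
  · linarith
  all_goals
    intro θ hθ
    rw [k₆ θ hθ]
    have q1 := k₃ θ hθ
    have q2 := k₄ θ hθ
    have q3 := k₅ θ hθ
    have q0 : 0 < Q θ := lt_of_lt_of_le (by positivity) q1
    have hel : |Q θ * turnSnd a ω θ * e θ| ≤ B' * ρ * |L₂ θ - L₁ θ| + B' * ρ ^ (K + 1) := by
      rw [abs_mul, abs_mul, abs_of_pos q0]
      have f1 : Q θ * |turnSnd a ω θ| ≤ 128 / ω * R :=
        mul_le_mul q2 (hlR θ) (abs_nonneg _) (by positivity)
      have f2 := mul_le_mul f1 q3 (abs_nonneg _) (by positivity)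
      refine f2.trans ?_
      have f3 : c ≤ c ^ (K + 1) := le_self_pow₀ hc (by omega)
      have f4 : 128 / ω * R * (B * (c * ρ) * |L₂ θ - L₁ θ|) ≤ B' * ρ * |L₂ θ - L₁ θ| := by
        have := mul_le_mul_of_nonneg_left f3
          (by positivity : 0 ≤ 128 / ω * R * B * ρ * |L₂ θ - L₁ θ|)
        rw [hB']
        linarith
      have f5 : 128 / ω * R * (B * (c * ρ) ^ (K + 1)) = B' * ρ ^ (K + 1) := by
        rw [hB', mul_pow]; ring
      linarith
    have hw0 : 0 ≤ turnFst ω θ ^ K * turnSnd a ω θ ^ 2 :=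
      mul_nonneg (pow_nonneg (turnFst_nonneg ω θ) K) (sq_nonneg _)
    have hwR : turnFst ω θ ^ K * turnSnd a ω θ ^ 2 ≤ R ^ (K + 2) := by
      rw [pow_add, ← sq_abs (turnSnd a ω θ)]
      exact mul_le_mul (pow_le_pow_left₀ (turnFst_nonneg ω θ) (hkR θ) K)
        (pow_le_pow_left₀ (abs_nonneg _) (hlR θ) 2) (by positivity) (by positivity)
    have g1 : Real.exp (L₁ θ / 2) ^ K ≤ (c * ρ) ^ K := pow_le_pow_left₀ (Real.exp_pos _).le (hb₁ θ).2 K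
    have g2 : (ρ / c) ^ K ≤ Real.exp (L₁ θ / 2) ^ K := pow_le_pow_left₀ (by positivity) (hb₁ θ).1 K
    have g3 : 0 < Real.exp (L₁ θ / 2) ^ K := pow_pos (Real.exp_pos _) K
    generalize turnFst ω θ ^ K * turnSnd a ω θ ^ 2 = w at *
    generalize Real.exp (L₁ θ / 2) ^ K = E at *
  · have h1 : |Q θ * (W * E * w)| ≤ 128 / ω * W * c ^ K * R ^ (K + 2) * ρ ^ K := by
      rw [abs_of_nonneg (by positivity)]
      calc Q θ * (W * E * w) ≤ 128 / ω * (W * (c * ρ) ^ K * R ^ (K + 2)) := by gcongr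
        _ = _ := by rw [mul_pow]; ring
    refine (abs_add_le _ _).trans ((add_le_add h1 hel).trans ?_)
    have h2 : B' * ρ ^ (K + 1) ≤ B' * ρ ^ K := by
      rw [pow_succ]
      exact mul_le_mul_of_nonneg_left (mul_le_of_le_one_right (by positivity) hρone.le) hB'0
    rw [hA]
    linarith
  · have h1 : 8 / ω * W / c ^ K * ρ ^ K * w ≤ Q θ * (W * E * w) := by
      calc 8 / ω * W / c ^ K * ρ ^ K * w = 8 / ω * (W * (ρ / c) ^ K * w) := by
            rw [div_pow]; field_simp
        _ ≤ _ := by gcongr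
    have := (abs_le.1 hel).1
    linarith

theorem one_le_turnConst {ω : ℝ} (hω : 0 < ω) (a : ℝ) : 1 ≤ turnConst a ω :=
  Real.one_le_exp (mul_nonneg (by positivity) Real.pi_pos.le)

theorem polar_coords {a ω ξ η : ℝ} (hω : 0 < ω) (hξ : 0 ≤ ξ)
    (hne : focusCoord a ω ξ η ≠ 0) :
    ξ = Real.exp (Real.log ‖focusCoord a ω ξ η‖ / 2) * turnFst ω (focusCoord a ω ξ η).arg ∧
    η = Real.exp (Real.log ‖focusCoord a ω ξ η‖ / 2) ^ 2 * turnSnd a ω (focusCoord a ω ξ η).arg := by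
  have hr : 0 < ‖focusCoord a ω ξ η‖ := norm_pos_iff.2 hne
  have hsq : Real.exp (Real.log ‖focusCoord a ω ξ η‖ / 2) ^ 2 = ‖focusCoord a ω ξ η‖ := by
    rw [← Real.exp_nat_mul, Nat.cast_ofNat, mul_div_cancel₀ _ two_ne_zero, Real.exp_log hr]
  have hre := focusCoord_re a ω ξ η
  have him := focusCoord_im a ω ξ η
  have hcos := Complex.cos_arg hne
  have hsin := Complex.sin_arg (focusCoord a ω ξ η)
  have hexp := Real.exp_pos (Real.log ‖focusCoord a ω ξ η‖ / 2)
  have h2 : Real.cos (focusCoord a ω ξ η).arg / ω = ξ ^ 2 / ‖focusCoord a ω ξ η‖ := by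
    rw [hcos, hre]; field_simp
  constructor
  · have h3 : Real.cos (focusCoord a ω ξ η).arg / ω =
        ξ ^ 2 / Real.exp (Real.log ‖focusCoord a ω ξ η‖ / 2) ^ 2 := by rw [h2, hsq]
    rw [turnFst, h3, Real.sqrt_div (sq_nonneg _), Real.sqrt_sq hξ, Real.sqrt_sq hexp.le]
    field_simp
  · rw [turnSnd, h2, hsq, hsin, him]
    field_simp
    ring

/-- Comparison of two half-turns starting at the same point. -/
theorem IsFocusCurve.lt_of_hasTurnExpansion {a ω m₀ W : ℝ} {N₁ N₂ : ℝ → ℝ → ℝ} {K : ℕ} (hω : 0 < ω)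
    (hω2 : ω ^ 2 = 8 - a ^ 2) (hm : 0 < m₀) (hW : 0 < W) (hN : HasTurnExpansion N₁ N₂ K W) :
    ∃ p₀ > 0, ∀ (ξ₁ η₁ m₁ ξ₂ η₂ m₂ : ℝ → ℝ) (I₁ I₂ : Set ℝ) (T₁ T₂ : ℝ),
      IsFocusCurve a ω m₀ ξ₁ η₁ m₁ (fun t => N₁ (ξ₁ t) (η₁ t)) I₁ →
      IsFocusCurve a ω m₀ ξ₂ η₂ m₂ (fun t => N₂ (ξ₂ t) (η₂ t)) I₂ →
      0 < T₁ → 0 < T₂ → Set.Icc 0 T₁ ⊆ I₁ → Set.Icc 0 T₂ ⊆ I₂ →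
      (∀ t ∈ Set.Ioo 0 T₁, 0 < ξ₁ t) → (∀ t ∈ Set.Ioo 0 T₂, 0 < ξ₂ t) →
      ξ₁ 0 = 0 → ξ₁ T₁ = 0 → ξ₂ 0 = 0 → ξ₂ T₂ = 0 →
      η₁ 0 = η₂ 0 → η₁ 0 < 0 → -p₀ < η₁ 0 → 0 < η₁ T₁ → 0 < η₂ T₂ → η₁ T₁ < η₂ T₂ := by
  obtain ⟨ρ₀, hρ₀, hmain⟩ := log_lt_of_hasTurnExpansion (a := a) hω hW hN (one_le_turnConst hω a)
  refine ⟨ρ₀ ^ 2 / 4, by positivity, ?_⟩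
  intro ξ₁ η₁ m₁ ξ₂ η₂ m₂ I₁ I₂ T₁ T₂ h₁ h₂ hT₁ hT₂ hI₁ hI₂ hp₁ hp₂ hz₁ hz₁' hz₂ hz₂' h0 hneg hsmall
    hq₁ hq₂
  obtain ⟨ρ, hρ⟩ : ∃ ρ, ρ = Real.sqrt (4 * -η₁ 0) := ⟨_, rfl⟩
  have hρ0 : 0 < ρ := by rw [hρ]; exact Real.sqrt_pos.2 (by linarith)
  have hρsq : ρ ^ 2 = 4 * -η₁ 0 := by rw [hρ]; exact Real.sq_sqrt (by linarith)
  have hρρ₀ : ρ < ρ₀ := by rw [hρ]; exact (Real.sqrt_lt' hρ₀).2 (by linarith)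
  have hc1 := one_le_turnConst hω a
  have hc0 := turnConst_pos a ω
  have half : ∀ (N : ℝ → ℝ → ℝ) (ξ η m : ℝ → ℝ) (I : Set ℝ) (T : ℝ),
      IsFocusCurve a ω m₀ ξ η m (fun t => N (ξ t) (η t)) I → 0 < T → Set.Icc 0 T ⊆ I →
      (∀ t ∈ Set.Ioo 0 T, 0 < ξ t) → ξ 0 = 0 → ξ T = 0 → η 0 = η₁ 0 → 0 < η T →
      ∃ L κ : ℝ → ℝ, ContinuousOn L (Set.Icc (-(Real.pi / 2)) (Real.pi / 2)) ∧
        L (-(Real.pi / 2)) = Real.log (ρ ^ 2) ∧ L (Real.pi / 2) = Real.log (4 * η T) ∧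
        (∀ θ, ρ / turnConst a ω ≤ Real.exp (L θ / 2) ∧ Real.exp (L θ / 2) ≤ turnConst a ω * ρ) ∧
        (∀ θ ∈ Set.Ioo (-(Real.pi / 2)) (Real.pi / 2), |κ θ| ≤ ω / 16 ∧
          κ θ = N (Real.exp (L θ / 2) * turnFst ω θ) (Real.exp (L θ / 2) ^ 2 * turnSnd a ω θ)
            / Real.exp (L θ / 2) ^ 2 ∧
          HasDerivAt L ((a / 2 + 4 * κ θ * Real.sin θ) / (ω / 2 + 4 * κ θ * Real.cos θ)) θ) := by
    intro N ξ η m I T h hT hI hp hz hz' hη hηT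
    obtain ⟨τ, hτc, hτ0, hτT, hτm, hτ⟩ := h.exists_polar hω hω2 hm hT hI hp hz hz'
      (by rw [hη]; exact hneg) hηT
    have hξ0 : ∀ t ∈ Set.Icc 0 T, 0 ≤ ξ t := by
      intro t ht
      rcases ht.1.eq_or_lt with rfl | h'
      · exact hz.ge
      rcases ht.2.eq_or_lt with rfl | h''
      · exact hz'.ge
      · exact (hp t ⟨h', h''⟩).le
    have hne : ∀ t ∈ Set.Icc 0 T, focusCoord a ω (ξ t) (η t) ≠ 0 := fun t ht =>
      focusCoord_ne_zero hω (h.ne_zero t (hI ht))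
    have hsq : ∀ θ, Real.exp (Real.log ‖focusCoord a ω (ξ (τ θ)) (η (τ θ))‖ / 2) ^ 2 =
        ‖focusCoord a ω (ξ (τ θ)) (η (τ θ))‖ := fun θ => by
      rw [← Real.exp_nat_mul, Nat.cast_ofNat, mul_div_cancel₀ _ two_ne_zero,
        Real.exp_log (norm_pos_iff.2 (hne _ (hτm θ)))]
    have hn0 : ‖focusCoord a ω (ξ 0) (η 0)‖ = ρ ^ 2 := by
      rw [hz, norm_focusCoord_fst_zero, hη, abs_of_neg hneg, hρsq]
    refine ⟨fun θ => Real.log ‖focusCoord a ω (ξ (τ θ)) (η (τ θ))‖,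
      fun θ => N (ξ (τ θ)) (η (τ θ)) / ‖focusCoord a ω (ξ (τ θ)) (η (τ θ))‖, ?_, ?_, ?_, ?_, ?_⟩
    · intro θ _
      have := ((h.hasDerivAt_log hω hω2 (hI (hτm θ))).1.continuousAt).comp hτc.continuousAt
      exact this.continuousWithinAt
    · simp only [hτ0, hn0]
    · simp only [hτT]
      rw [hz', norm_focusCoord_fst_zero, abs_of_pos hηT]
    · intro θ
      simp only
      obtain ⟨b1, b2⟩ := h.norm_le hω hω2 hm (hτm θ).1
        (fun u hu => hI ⟨hu.1, hu.2.trans (hτm θ).2⟩) (fun u hu => hξ0 u ⟨hu.1, hu.2.trans (hτm θ).2⟩)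
      rw [hn0, ← hsq θ] at b1 b2
      have hE := Real.exp_pos (Real.log ‖focusCoord a ω (ξ (τ θ)) (η (τ θ))‖ / 2)
      generalize Real.exp (Real.log ‖focusCoord a ω (ξ (τ θ)) (η (τ θ))‖ / 2) = E at *
      generalize turnConst a ω = c at *
      have hcc : c ≤ c ^ 2 := le_self_pow₀ hc1 two_ne_zero
      constructor
      · rw [div_le_iff₀ hc0]
        refine le_of_sq_le_sq ?_ (by positivity)
        rw [mul_pow]
        have := mul_le_mul_of_nonneg_left hcc (sq_nonneg E)
        linarith
      · refine le_of_sq_le_sq ?_ (by positivity)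
        rw [mul_pow]
        have := mul_le_mul_of_nonneg_left hcc (sq_nonneg ρ)
        linarith
    · intro θ hθ
      obtain ⟨hθ1, hθ2, hθ3⟩ := hτ θ hθ
      refine ⟨h.abs_ratio_le hω (hI (hτm θ)), ?_, hθ3⟩
      obtain ⟨e1, e2⟩ := polar_coords hω (hξ0 _ (hτm θ)) (hne _ (hτm θ))
      rw [hθ2] at e1 e2
      simp only
      rw [← e1, ← e2, hsq]
  obtain ⟨L₁, κ₁, a1, a2, a3, a4, a5⟩ := half N₁ ξ₁ η₁ m₁ I₁ T₁ h₁ hT₁ hI₁ hp₁ hz₁ hz₁' rfl hq₁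
  obtain ⟨L₂, κ₂, b1, b2, b3, b4, b5⟩ := half N₂ ξ₂ η₂ m₂ I₂ T₂ h₂ hT₂ hI₂ hp₂ hz₂ hz₂' h0.symm hq₂
  have := hmain ρ hρ0 hρρ₀ L₁ L₂ κ₁ κ₂ a1 b1 (a2.trans b2.symm) a4 b4 a5 b5
  rw [a3, b3, Real.log_lt_log_iff (by linarith) (by linarith)] at this
  linarith

/-- Coordinates near the origin in which the integral curves of `X` are focus curves with the
perturbation `N`. The second coordinate axis is preserved pointwise. -/
structure FocusChart (X : ℝ × ℝ → ℝ × ℝ) (a ω m₀ : ℝ) (N : ℝ → ℝ → ℝ) where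
  dom : Set (ℝ × ℝ)
  core : Set (ℝ × ℝ)
  radius : ℝ
  fst : ℝ × ℝ → ℝ
  snd : ℝ × ℝ → ℝ
  factor : ℝ × ℝ → ℝ
  isOpen_dom : IsOpen dom
  zero_mem : (0 : ℝ × ℝ) ∈ dom
  radius_pos : 0 < radius
  isClosed_core : IsClosed core
  core_subset : core ⊆ dom
  mem_core : ∀ q ∈ dom, ‖focusCoord a ω (fst q) (snd q)‖ ≤ radius → q ∈ core
  deriv_fst : ∀ (γ : ℝ → ℝ × ℝ) (t : ℝ), γ t ∈ dom → HasDerivAt γ (X (γ t)) t →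
    HasDerivAt (fun t => fst (γ t)) (-(factor (γ t) * snd (γ t))) t
  deriv_snd : ∀ (γ : ℝ → ℝ × ℝ) (t : ℝ), γ t ∈ dom → HasDerivAt γ (X (γ t)) t →
    HasDerivAt (fun t => snd (γ t)) (factor (γ t) * fst (γ t) *
      (a * snd (γ t) + fst (γ t) ^ 2 + N (fst (γ t)) (snd (γ t)))) t
  le_factor : ∀ q ∈ dom, m₀ ≤ factor q
  small : ∀ q ∈ dom, 16 * |N (fst q) (snd q)| ≤ ω * ‖focusCoord a ω (fst q) (snd q)‖
  fst_eq_zero : ∀ q ∈ dom, fst q = 0 → q.1 = 0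
  eq_of_fst : ∀ q ∈ dom, q.1 = 0 → fst q = 0 ∧ snd q = q.2
  dom_subset : dom ⊆ Metric.ball 0 1
  tendsto_norm : Tendsto (fun q => ‖focusCoord a ω (fst q) (snd q)‖) (𝓝 0) (𝓝 0)

section

variable {X : ℝ × ℝ → ℝ × ℝ} {a ω m₀ : ℝ} {N : ℝ → ℝ → ℝ}

theorem FocusChart.isFocusCurve (C : FocusChart X a ω m₀ N) {γ : ℝ → ℝ × ℝ}
    (hγ : ∀ t, HasDerivAt γ (X (γ t)) t) (hne : ∀ t, γ t ≠ 0) :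
    IsFocusCurve a ω m₀ (fun t => C.fst (γ t)) (fun t => C.snd (γ t)) (fun t => C.factor (γ t))
      (fun t => N (C.fst (γ t)) (C.snd (γ t))) (γ ⁻¹' C.dom) where
  deriv_fst t ht := C.deriv_fst γ t ht (hγ t)
  deriv_snd t ht := C.deriv_snd γ t ht (hγ t)
  le_factor t ht := C.le_factor _ ht
  small t ht := C.small _ ht
  ne_zero t ht hc := by
    have h1 := C.fst_eq_zero _ ht hc.1
    have h2 := (C.eq_of_fst _ ht h1).2
    exact hne t (Prod.ext h1 (by rw [← h2, hc.2]; rfl))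

theorem FocusChart.mem_dom_of_Ico (C : FocusChart X a ω m₀ N) {γ : ℝ → ℝ × ℝ}
    (hγ : Continuous γ) {T : ℝ} (hT : 0 < T)
    (h : ∀ t ∈ Set.Ico 0 T, γ t ∈ C.dom ∧ ‖focusCoord a ω (C.fst (γ t)) (C.snd (γ t))‖ ≤ C.radius) :
    γ T ∈ C.dom := by
  refine C.core_subset (C.isClosed_core.mem_of_tendsto
    (hγ.continuousAt.tendsto.mono_left (nhdsWithin_le_nhds (s := Set.Iio T))) ?_)
  filter_upwards [Ioo_mem_nhdsLT hT] with t ht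
  have := h t ⟨ht.1.le, ht.2⟩
  exact C.mem_core _ this.1 this.2

theorem FocusChart.exists_right_half_turn (C : FocusChart X a ω m₀ N) (hω : 0 < ω)
    (hω2 : ω ^ 2 = 8 - a ^ 2) (hm : 0 < m₀) {γ : ℝ → ℝ × ℝ}
    (hγ : ∀ t, HasDerivAt γ (X (γ t)) t) (hne : ∀ t, γ t ≠ 0) (h0 : γ 0 ∈ C.dom)
    (hstart : 0 < C.fst (γ 0) ∨ (C.fst (γ 0) = 0 ∧ C.snd (γ 0) < 0))
    (hρ : turnConst a ω * ‖focusCoord a ω (C.fst (γ 0)) (C.snd (γ 0))‖ ≤ C.radius) :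
    ∃ T > 0, (∀ t ∈ Set.Icc 0 T, γ t ∈ C.dom ∧ ‖focusCoord a ω (C.fst (γ t)) (C.snd (γ t))‖ ≤
        turnConst a ω * ‖focusCoord a ω (C.fst (γ 0)) (C.snd (γ 0))‖) ∧
      (∀ t ∈ Set.Ioo 0 T, 0 < C.fst (γ t)) ∧ C.fst (γ T) = 0 ∧ 0 < C.snd (γ T) := by
  have hc : Continuous γ := continuous_iff_continuousAt.2 fun t => (hγ t).continuousAt
  exact (C.isFocusCurve hγ hne).exists_half_turn hω hω2 hm (C.isOpen_dom.preimage hc) h0 hstart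
    (fun T hT h => C.mem_dom_of_Ico hc hT h) hρ

theorem FocusChart.exists_left_half_turn (C : FocusChart X a ω m₀ N) (hω : 0 < ω)
    (hω2 : ω ^ 2 = 8 - a ^ 2) (hm : 0 < m₀) {γ : ℝ → ℝ × ℝ}
    (hγ : ∀ t, HasDerivAt γ (X (γ t)) t) (hne : ∀ t, γ t ≠ 0) (h0 : γ 0 ∈ C.dom)
    (hstart : C.fst (γ 0) < 0 ∨ (C.fst (γ 0) = 0 ∧ 0 < C.snd (γ 0)))
    (hρ : turnConst a ω * ‖focusCoord a ω (C.fst (γ 0)) (C.snd (γ 0))‖ ≤ C.radius) :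
    ∃ T > 0, (∀ t ∈ Set.Icc 0 T, γ t ∈ C.dom ∧ ‖focusCoord a ω (C.fst (γ t)) (C.snd (γ t))‖ ≤
        turnConst a ω * ‖focusCoord a ω (C.fst (γ 0)) (C.snd (γ 0))‖) ∧
      (∀ t ∈ Set.Ioo 0 T, C.fst (γ t) < 0) ∧ C.fst (γ T) = 0 ∧ C.snd (γ T) < 0 := by
  have hc : Continuous γ := continuous_iff_continuousAt.2 fun t => (hγ t).continuousAt
  have htc : turnConst (-a) ω = turnConst a ω := by rw [turnConst, turnConst, abs_neg]
  have := (C.isFocusCurve hγ hne).neg.exists_half_turn (ρ := C.radius) hω (by rw [neg_sq]; exact hω2) hm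
    (C.isOpen_dom.preimage hc) h0
    (by rcases hstart with h | h
        · left; linarith
        · right; exact ⟨by linarith [h.1], by linarith [h.2]⟩)
    (fun T hT h => C.mem_dom_of_Ico hc hT fun t ht => by
      have := h t ht
      rwa [norm_focusCoord_neg] at this)
    (by rwa [norm_focusCoord_neg, htc])
  simp only [norm_focusCoord_neg, htc, Left.neg_pos_iff, neg_eq_zero] at this
  exact this

/-- The system is not a center if the half-turns on the two sides of the axis do not agree. -/
theorem FocusChart.not_isCenter (C : FocusChart X a ω m₀ N) (hω : 0 < ω)
    (hω2 : ω ^ 2 = 8 - a ^ 2) (hm : 0 < m₀) {K : ℕ} {W : ℝ} (hW : 0 < W)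
    (hN : HasTurnExpansion N (fun ξ η => N (-ξ) η) K W) : ¬ IsCenter X 0 := by
  rintro ⟨-, U, hU, hcen⟩
  obtain ⟨p₀, hp₀, hcomp⟩ := IsFocusCurve.lt_of_hasTurnExpansion (m₀ := m₀) hω hω2 hm hW hN
  have hc0 := turnConst_pos a ω
  have hc1 := one_le_turnConst hω a
  have hev : ∀ᶠ y : ℝ in 𝓝 0, ((0 : ℝ), y) ∈ U ∩ C.dom := by
    have hcont : ContinuousAt (fun y : ℝ => ((0 : ℝ), y)) 0 := by fun_prop
    exact hcont.eventually (Filter.inter_mem hU (C.isOpen_dom.mem_nhds C.zero_mem))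
  obtain ⟨δ, hδ, hball⟩ := Metric.eventually_nhds_iff.1 hev
  obtain ⟨b, hb⟩ : ∃ b, b = min (δ / 2) (min (C.radius / (4 * turnConst a ω ^ 2))
    (p₀ / (2 * turnConst a ω))) := ⟨_, rfl⟩
  have hr := C.radius_pos
  have hb0 : 0 < b := by rw [hb]; positivity
  have hbδ : b < δ := by
    have : b ≤ δ / 2 := by rw [hb]; exact min_le_left _ _
    linarith
  have hbr : turnConst a ω ^ 2 * (4 * b) ≤ C.radius := by
    have : b ≤ C.radius / (4 * turnConst a ω ^ 2) := by
      rw [hb]; exact (min_le_right _ _).trans (min_le_left _ _)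
    rw [le_div_iff₀ (by positivity)] at this
    linarith
  have hbp : turnConst a ω * b < p₀ := by
    have : b ≤ p₀ / (2 * turnConst a ω) := by
      rw [hb]; exact (min_le_right _ _).trans (min_le_right _ _)
    rw [le_div_iff₀ (by positivity)] at this
    linarith
  have hin : ∀ y, 0 < y → y ≤ b → ((0 : ℝ), y) ∈ U ∩ C.dom := fun y hy hyb => hball (by
    rw [Real.dist_eq, sub_zero, abs_of_pos hy]; linarith)
  obtain ⟨-, γ, hγ0, hγ, hγU, T, hT, hper⟩ := hcen (0, b) (hin b hb0 le_rfl).1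
    (fun h => hb0.ne' (congrArg Prod.snd h))
  have hne : ∀ t, γ t ≠ 0 := fun t => (hγU t).2
  have hcγ : Continuous γ := continuous_iff_continuousAt.2 fun t => (hγ t).continuousAt
  obtain ⟨S, hS⟩ : ∃ S : Set ℝ, S = Set.Icc 0 T ∩ {t | (γ t).1 = 0 ∧ 0 ≤ (γ t).2} := ⟨_, rfl⟩
  have hScomp : IsCompact S := by
    rw [hS]
    refine isCompact_Icc.inter_right (IsClosed.and ?_ ?_)
    · exact isClosed_eq (continuous_fst.comp hcγ) continuous_const
    · exact isClosed_le continuous_const (continuous_snd.comp hcγ)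
  have hSne : S.Nonempty := ⟨0, by
    rw [hS]; exact ⟨⟨le_rfl, hT.le⟩, by simp [hγ0], by simp [hγ0, hb0.le]⟩⟩
  obtain ⟨t₀, ht₀, hmin⟩ := hScomp.exists_isMinOn hSne (continuous_snd.comp hcγ).continuousOn
  have hmin' : ∀ t, (γ t).1 = 0 → 0 ≤ (γ t).2 → (γ t₀).2 ≤ (γ t).2 := by
    intro t h1 h2
    obtain ⟨s, hs, hst⟩ := hper.exists_mem_Ico₀ hT t
    rw [hst] at h1 h2 ⊢
    exact hmin (by rw [hS]; exact ⟨Set.Ico_subset_Icc_self hs, h1, h2⟩)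
  have ht₀' : (γ t₀).1 = 0 ∧ 0 ≤ (γ t₀).2 := by rw [hS] at ht₀; exact ht₀.2
  obtain ⟨q, hq⟩ : ∃ q, q = (γ t₀).2 := ⟨_, rfl⟩
  have hγt₀ : γ t₀ = (0, q) := Prod.ext ht₀'.1 hq.symm
  have hq0 : 0 < q := by
    refine lt_of_le_of_ne (hq ▸ ht₀'.2) fun h => hne t₀ ?_
    rw [hγt₀, ← h]; rfl
  have hqb : q ≤ b := by
    have := hmin' 0 (by simp [hγ0]) (by simp [hγ0, hb0.le])
    rw [hγ0, ← hq] at this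
    exact this
  have hqdom := (hin q hq0 hqb).2
  have hq1 := C.eq_of_fst _ hqdom rfl
  simp only at hq1
  -- the left half-turn
  obtain ⟨γ₁, hγ₁⟩ : ∃ γ₁ : ℝ → ℝ × ℝ, γ₁ = fun t => γ (t + t₀) := ⟨_, rfl⟩
  have hγ₁d : ∀ t, HasDerivAt γ₁ (X (γ₁ t)) t := fun t => by
    rw [hγ₁]; exact (hγ (t + t₀)).comp_add_const t t₀
  have hγ₁ne : ∀ t, γ₁ t ≠ 0 := fun t => by rw [hγ₁]; exact hne _
  have hγ₁0 : γ₁ 0 = (0, q) := by rw [hγ₁]; simp [hγt₀]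
  have hn1 : ‖focusCoord a ω (C.fst (γ₁ 0)) (C.snd (γ₁ 0))‖ = 4 * q := by
    rw [hγ₁0, hq1.1, hq1.2, norm_focusCoord_fst_zero, abs_of_pos hq0]
  have hbr' : turnConst a ω ^ 2 * (4 * q) ≤ C.radius := by
    refine le_trans ?_ hbr
    gcongr
  obtain ⟨T₁, hT₁, hL1, hL2, hL3, hL4⟩ := C.exists_left_half_turn hω hω2 hm hγ₁d hγ₁ne
    (by rw [hγ₁0]; exact hqdom) (by rw [hγ₁0, hq1.1, hq1.2]; exact Or.inr ⟨rfl, hq0⟩) (by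
      rw [hn1]
      refine le_trans ?_ hbr'
      gcongr
      exact le_self_pow₀ hc1 two_ne_zero)
  have hp := (hL1 T₁ ⟨hT₁.le, le_rfl⟩)
  rw [hn1] at hp
  -- the right half-turn
  obtain ⟨γ₂, hγ₂⟩ : ∃ γ₂ : ℝ → ℝ × ℝ, γ₂ = fun t => γ₁ (t + T₁) := ⟨_, rfl⟩
  have hγ₂d : ∀ t, HasDerivAt γ₂ (X (γ₂ t)) t := fun t => by
    rw [hγ₂]; exact (hγ₁d (t + T₁)).comp_add_const t T₁
  have hγ₂ne : ∀ t, γ₂ t ≠ 0 := fun t => by rw [hγ₂]; exact hγ₁ne _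
  have hγ₂0 : γ₂ 0 = γ₁ T₁ := by rw [hγ₂]; simp
  obtain ⟨T₂, hT₂, hR1, hR2, hR3, hR4⟩ := C.exists_right_half_turn hω hω2 hm hγ₂d hγ₂ne
    (by rw [hγ₂0]; exact hp.1) (by rw [hγ₂0]; exact Or.inr ⟨hL3, hL4⟩) (by
      rw [hγ₂0]
      refine le_trans (mul_le_mul_of_nonneg_left hp.2 hc0.le) ?_
      linarith)
  have hpq : -C.snd (γ₁ T₁) ≤ turnConst a ω * q := by
    have := hp.2
    rw [hL3, norm_focusCoord_fst_zero, abs_of_neg hL4] at this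
    linarith
  have hfin := hcomp (fun t => C.fst (γ₂ t)) (fun t => C.snd (γ₂ t)) (fun t => C.factor (γ₂ t))
    (fun t => -C.fst (γ₁ (T₁ - t))) (fun t => C.snd (γ₁ (T₁ - t))) (fun t => C.factor (γ₁ (T₁ - t)))
    (γ₂ ⁻¹' C.dom) ((fun t => T₁ - t) ⁻¹' (γ₁ ⁻¹' C.dom)) T₂ T₁ (C.isFocusCurve hγ₂d hγ₂ne)
    (by
      have := (C.isFocusCurve hγ₁d hγ₁ne).reverse T₁
      simp only [neg_neg]
      exact this) hT₂ hT₁ (fun t ht => (hR1 t ht).1)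
    (fun t ht => (hL1 (T₁ - t) ⟨by linarith [ht.2], by linarith [ht.1]⟩).1) hR2
    (fun t ht => by
      have := hL2 (T₁ - t) ⟨by linarith [ht.2], by linarith [ht.1]⟩
      linarith)
    (by rw [hγ₂0]; exact hL3) hR3 (by rw [sub_zero, hL3, neg_zero])
    (by rw [sub_self, hγ₁0, hq1.1, neg_zero]) (by rw [hγ₂0, sub_zero])
    (by rw [hγ₂0]; exact hL4)
    (by
      rw [hγ₂0]
      have : turnConst a ω * q ≤ turnConst a ω * b := by gcongr
      linarith) hR4 (by rw [sub_self, hγ₁0, hq1.2]; exact hq0)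
  simp only [sub_self] at hfin
  rw [hγ₁0, hq1.2] at hfin
  have hend := hR1 T₂ ⟨hT₂.le, le_rfl⟩
  have hx := C.fst_eq_zero _ hend.1 hR3
  have hy := (C.eq_of_fst _ hend.1 hx).2
  rw [hy] at hfin hR4
  have hγ₂γ : γ₂ T₂ = γ (T₂ + T₁ + t₀) := by rw [hγ₂, hγ₁]
  rw [hγ₂γ] at hfin hR4 hx
  have := hmin' _ hx hR4.le
  linarith

theorem hasDerivAt_mirror {Y : ℝ × ℝ → ℝ × ℝ}
    (hY : ∀ q, Y q = ((X (-q.1, q.2)).1, -(X (-q.1, q.2)).2)) {γ : ℝ → ℝ × ℝ} {t : ℝ}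
    (h : HasDerivAt γ (Y (γ t)) t) :
    HasDerivAt (fun s => (-(γ (-s)).1, (γ (-s)).2)) (X (-(γ t).1, (γ t).2)) (-t) := by
  have h1 : HasDerivAt (fun s => γ (-s)) (-Y (γ t)) (-t) := by
    have hγ' : HasDerivAt γ (Y (γ t)) (- -t) := by rwa [neg_neg]
    exact (hγ'.scomp (-t) (hasDerivAt_neg (-t))).congr_deriv (by simp)
  have h2 := (ContinuousLinearMap.fst ℝ ℝ ℝ).hasFDerivAt.comp_hasDerivAt (-t) h1
  have h3 := (ContinuousLinearMap.snd ℝ ℝ ℝ).hasFDerivAt.comp_hasDerivAt (-t) h1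
  refine (h2.neg.prodMk h3).congr_deriv ?_
  rw [hY]
  ext <;> simp

/-- The chart of the system reflected by `(x, t) ↦ (-x, -t)`. -/
noncomputable def FocusChart.mirror {Y : ℝ × ℝ → ℝ × ℝ} (C : FocusChart X a ω m₀ N)
    (hY : ∀ q, Y q = ((X (-q.1, q.2)).1, -(X (-q.1, q.2)).2)) :
    FocusChart Y a ω m₀ (fun ξ η => N (-ξ) η) where
  dom := (fun q : ℝ × ℝ => (-q.1, q.2)) ⁻¹' C.dom
  core := (fun q : ℝ × ℝ => (-q.1, q.2)) ⁻¹' C.core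
  radius := C.radius
  fst q := -C.fst (-q.1, q.2)
  snd q := C.snd (-q.1, q.2)
  factor q := C.factor (-q.1, q.2)
  isOpen_dom := C.isOpen_dom.preimage (by fun_prop)
  zero_mem := by
    simpa using show ((0 : ℝ), (0 : ℝ)) ∈ C.dom from C.zero_mem
  radius_pos := C.radius_pos
  isClosed_core := C.isClosed_core.preimage (by fun_prop)
  core_subset q hq := C.core_subset hq
  mem_core q hq h := C.mem_core _ hq (by rwa [norm_focusCoord_neg_fst] at h)
  deriv_fst γ t ht hγ := by
    have h := C.deriv_fst (fun s => (-(γ (-s)).1, (γ (-s)).2)) (-t)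
      (by rw [neg_neg]; exact ht) (by rw [neg_neg]; exact hasDerivAt_mirror hY hγ)
    have h2 : HasDerivAt (fun s => C.fst (-(γ (- -s)).1, (γ (- -s)).2)) _ t :=
      h.scomp t (hasDerivAt_neg t)
    simp only [neg_neg] at h2
    exact h2.neg.congr_deriv (by simp)
  deriv_snd γ t ht hγ := by
    have h := C.deriv_snd (fun s => (-(γ (-s)).1, (γ (-s)).2)) (-t)
      (by rw [neg_neg]; exact ht) (by rw [neg_neg]; exact hasDerivAt_mirror hY hγ)
    have h2 : HasDerivAt (fun s => C.snd (-(γ (- -s)).1, (γ (- -s)).2)) _ t :=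
      h.scomp t (hasDerivAt_neg t)
    simp only [neg_neg] at h2 ⊢
    exact h2.congr_deriv (by rw [smul_eq_mul]; ring)
  le_factor q hq := C.le_factor _ hq
  small q hq := by rw [norm_focusCoord_neg_fst, neg_neg]; exact C.small _ hq
  fst_eq_zero q hq h := neg_eq_zero.1 (C.fst_eq_zero _ hq (neg_eq_zero.1 h))
  eq_of_fst q hq h := by
    have := C.eq_of_fst _ hq (neg_eq_zero.2 h)
    exact ⟨neg_eq_zero.2 this.1, this.2⟩
  dom_subset q hq := by
    have := C.dom_subset hq
    rwa [mem_ball_zero_iff, Prod.norm_mk, norm_neg, ← Prod.norm_def, ← mem_ball_zero_iff] at this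
  tendsto_norm := by
    have h : Tendsto (fun q : ℝ × ℝ => (-q.1, q.2)) (𝓝 0) (𝓝 0) := by
      refine Continuous.tendsto' (by fun_prop) _ _ ?_
      simp
    refine (C.tendsto_norm.comp h).congr fun q => ?_
    rw [norm_focusCoord_neg_fst]
    rfl
end

/-- The four coefficients of the transformed system in powers of `η`, for the coordinates
`x = φ ξ`, `1 / y = α ξ / η + β ξ`. -/
structure IsChartExpansion (a b c d e : ℝ) (φ φ' α α' β β' p₀ p₁ p₂ p₃ : ℝ → ℝ) (ξ : ℝ) : Prop where
  coeff_zero : φ' ξ * α ξ ^ 2 * φ ξ ^ 3 = ξ ^ 3 + ξ ^ 4 * p₀ ξ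
  coeff_one : φ' ξ * α ξ * (3 * β ξ * φ ξ ^ 3 + a * φ ξ + b * φ ξ ^ 2) = a * ξ + ξ ^ 2 * p₁ ξ
  coeff_two : φ' ξ * (3 * β ξ ^ 2 * φ ξ ^ 3 + 2 * β ξ * (a * φ ξ + b * φ ξ ^ 2) + c + d * φ ξ)
    - α' ξ / α ξ = ξ * p₂ ξ
  coeff_three : (φ' ξ * (β ξ ^ 3 * φ ξ ^ 3 + β ξ ^ 2 * (a * φ ξ + b * φ ξ ^ 2)
    + β ξ * (c + d * φ ξ) + e) - β' ξ) / α ξ = ξ * p₃ ξ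

theorem chart_snd_deriv {a b c d e x y f' l l' k k' : ℝ} (hf : f' ≠ 0) (hl : l ≠ 0)
    (h : 1 - k * y ≠ 0) :
    ((l' * (f'⁻¹ * -y) * y + l * (a * x * y + c * y ^ 2 + 1 * x ^ 3 + b * x ^ 2 * y + d * x * y ^ 2
        + e * y ^ 3)) * (1 - k * y) - l * y * (-(k' * (f'⁻¹ * -y) * y + k * (a * x * y + c * y ^ 2
        + 1 * x ^ 3 + b * x ^ 2 * y + d * x * y ^ 2 + e * y ^ 3)))) / (1 - k * y) ^ 2 =
    (1 - k * y) / (f' * l) * (f' * l ^ 2 * x ^ 3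
      + f' * l * (3 * k * x ^ 3 + a * x + b * x ^ 2) * (l * y / (1 - k * y))
      + (f' * (3 * k ^ 2 * x ^ 3 + 2 * k * (a * x + b * x ^ 2) + c + d * x) - l' / l)
        * (l * y / (1 - k * y)) ^ 2
      + (f' * (k ^ 3 * x ^ 3 + k ^ 2 * (a * x + b * x ^ 2) + k * (c + d * x) + e) - k') / l
        * (l * y / (1 - k * y)) ^ 3) := by
  have h' : 1 - y * k ≠ 0 := by rwa [mul_comm]
  field_simp
  ring

theorem exists_small_perturbation {ω : ℝ} (hω : 0 < ω) (a B : ℝ) (hB : 0 ≤ B) :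
    ∃ ε > 0, ∀ ξ η P₀ P₁ P₂ P₃ : ℝ, |ξ| ≤ ε → |η| ≤ ε → |P₀| ≤ B → |P₁| ≤ B → |P₂| ≤ B → |P₃| ≤ B →
      16 * |ξ ^ 3 * P₀ + ξ * P₁ * η + P₂ * η ^ 2 + P₃ * η ^ 3| ≤ ω * ‖focusCoord a ω ξ η‖ := by
  obtain ⟨C, hC⟩ : ∃ C, C = (1 + |a| / ω) / 4 := ⟨_, rfl⟩
  have hC0 : 0 < C := by rw [hC]; positivity
  refine ⟨min 1 (ω / (16 * B * (1 / ω + 3 * C) + 1)), by positivity, ?_⟩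
  intro ξ η P₀ P₁ P₂ P₃ hξ hη h0 h1 h2 h3
  obtain ⟨ε, hε⟩ : ∃ ε, ε = min 1 (ω / (16 * B * (1 / ω + 3 * C) + 1)) := ⟨_, rfl⟩
  rw [← hε] at hξ hη
  have hε0 : 0 < ε := by rw [hε]; positivity
  have hε1 : ε ≤ 1 := hε ▸ min_le_left _ _
  have hε2 : ε * (16 * B * (1 / ω + 3 * C) + 1) ≤ ω :=
    (le_div_iff₀ (by positivity)).1 (hε ▸ min_le_right _ _)
  obtain ⟨b1, b2⟩ := focusCoord_bounds (a := a) hω (le_refl ‖focusCoord a ω ξ η‖)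
  obtain ⟨Z, hZ⟩ : ∃ Z, Z = ‖focusCoord a ω ξ η‖ := ⟨_, rfl⟩
  rw [← hZ] at b1 b2 ⊢
  have hZ0 : 0 ≤ Z := hZ ▸ norm_nonneg _
  have b2' : |η| ≤ C * Z := by
    refine b2.trans (le_of_eq ?_)
    rw [hC]; field_simp
  have b1' : ξ ^ 2 ≤ 1 / ω * Z := by refine b1.trans (le_of_eq ?_); field_simp
  have t0 : |ξ ^ 3 * P₀| ≤ B * ε * (1 / ω * Z) := by
    rw [show ξ ^ 3 * P₀ = P₀ * ξ * ξ ^ 2 by ring, abs_mul, abs_mul, abs_of_nonneg (sq_nonneg ξ)]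
    gcongr
  have t1 : |ξ * P₁ * η| ≤ B * ε * (C * Z) := by
    rw [mul_comm ξ, abs_mul, abs_mul]
    gcongr
  have t2 : |P₂ * η ^ 2| ≤ B * ε * (C * Z) := by
    rw [sq, ← mul_assoc, abs_mul, abs_mul]
    gcongr
  have t3 : |P₃ * η ^ 3| ≤ B * ε * (C * Z) := by
    rw [show P₃ * η ^ 3 = P₃ * η * η * η by ring, abs_mul, abs_mul, abs_mul]
    have : B * |η| * |η| * |η| ≤ B * ε * 1 * (C * Z) := by
      have := hη.trans hε1
      gcongr
    refine le_trans (by gcongr) (this.trans (by linarith))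
  have hsum : |ξ ^ 3 * P₀ + ξ * P₁ * η + P₂ * η ^ 2 + P₃ * η ^ 3| ≤ B * ε * (1 / ω + 3 * C) * Z := by
    refine (abs_add_le _ _).trans ?_
    have := abs_add_le (ξ ^ 3 * P₀ + ξ * P₁ * η) (P₂ * η ^ 2)
    have := abs_add_le (ξ ^ 3 * P₀) (ξ * P₁ * η)
    linarith
  have : ε * (16 * B * (1 / ω + 3 * C)) * Z ≤ ω * Z :=
    mul_le_mul_of_nonneg_right (by linarith) hZ0
  linarith

theorem exists_focusChart {a b c d e ω : ℝ} {φ φ' α α' β β' p₀ p₁ p₂ p₃ : ℝ → ℝ} (hω : 0 < ω)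
    (hφc : ContDiff ℝ 1 φ) (hφ : ∀ x, HasDerivAt φ (φ' x) x) (hφ' : ContinuousAt φ' 0)
    (hα : ∀ x, HasDerivAt α (α' x) x) (hβ : ∀ x, HasDerivAt β (β' x) x)
    (hφ0 : φ 0 = 0) (hφ'0 : φ' 0 = 1) (hα0 : α 0 = 1) (hβ0 : β 0 = 0)
    (hp₀ : ContinuousAt p₀ 0) (hp₁ : ContinuousAt p₁ 0) (hp₂ : ContinuousAt p₂ 0)
    (hp₃ : ContinuousAt p₃ 0)
    (hexp : ∀ᶠ ξ in 𝓝 0, IsChartExpansion a b c d e φ φ' α α' β β' p₀ p₁ p₂ p₃ ξ) :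
    Nonempty (FocusChart (cubicField a c 1 b d e) a ω (1 / 8)
      (fun ξ η => ξ ^ 3 * p₀ ξ + ξ * p₁ ξ * η + p₂ ξ * η ^ 2 + p₃ ξ * η ^ 3)) := by
  have h1 : HasDerivAt φ 1 0 := hφ'0 ▸ hφ 0
  obtain ⟨E, hE, hE0⟩ : ∃ E : OpenPartialHomeomorph ℝ ℝ, (E : ℝ → ℝ) = φ ∧ (0 : ℝ) ∈ E.source := by
    have hs : HasStrictDerivAt φ 1 0 := hφc.contDiffAt.hasStrictDerivAt' h1 one_ne_zero
    have hs' := hs.hasStrictFDerivAt_equiv one_ne_zero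
    exact ⟨hs'.toOpenPartialHomeomorph φ, rfl, hs'.mem_toOpenPartialHomeomorph_source⟩
  have hE0' : (0 : ℝ) ∈ E.target := by
    have := E.map_source hE0
    rwa [hE, hφ0] at this
  have hψ0 : E.symm 0 = 0 := by
    have := E.left_inv hE0
    rwa [hE, hφ0] at this
  have hψc : ContinuousAt E.symm 0 := E.continuousAt_symm hE0'
  obtain ⟨B, hB⟩ : ∃ B, B = (|p₀ 0| + |p₁ 0| + |p₂ 0| + |p₃ 0|) + 1 := ⟨_, rfl⟩
  have hB0 : 0 ≤ B := by rw [hB]; positivity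
  have hbd : ∀ p : ℝ → ℝ, ContinuousAt p 0 → |p 0| < B → ∀ᶠ ξ in 𝓝 0, |p ξ| ≤ B := fun p hp h =>
    (hp.abs.eventually (gt_mem_nhds h)).mono fun _ h => le_of_lt h
  obtain ⟨ε, hε, hsmall⟩ := exists_small_perturbation hω a B hB0
  have near : ∀ᶠ ξ in 𝓝 (0 : ℝ), IsChartExpansion a b c d e φ φ' α α' β β' p₀ p₁ p₂ p₃ ξ ∧
      (|p₀ ξ| ≤ B ∧ |p₁ ξ| ≤ B ∧ |p₂ ξ| ≤ B ∧ |p₃ ξ| ≤ B) ∧ (1 / 2 < φ' ξ ∧ φ' ξ < 2) ∧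
      (1 / 2 < α ξ ∧ α ξ < 2) ∧ |β ξ| < 1 ∧ |φ ξ| ≤ 2 * |ξ| := by
    have k0 := abs_nonneg (p₀ 0)
    have k1 := abs_nonneg (p₁ 0)
    have k2 := abs_nonneg (p₂ 0)
    have k3 := abs_nonneg (p₃ 0)
    have hαc := (hα 0).continuousAt
    have hβc := (hβ 0).continuousAt
    have hlin : ∀ᶠ ξ in 𝓝 (0 : ℝ), |φ ξ| ≤ 2 * |ξ| := by
      have := (hasDerivAt_iff_isLittleO.1 h1).def one_pos
      filter_upwards [this] with ξ hξ
      simp only [hφ0, sub_zero, smul_eq_mul, mul_one, Real.norm_eq_abs, one_mul] at hξ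
      have := abs_add_le (φ ξ - ξ) ξ
      rw [sub_add_cancel] at this
      linarith
    filter_upwards [hexp, hbd p₀ hp₀ (by linarith), hbd p₁ hp₁ (by linarith), hbd p₂ hp₂ (by linarith),
      hbd p₃ hp₃ (by linarith), hφ'.eventually (lt_mem_nhds (by rw [hφ'0]; norm_num : 1 / 2 < φ' 0)),
      hφ'.eventually (gt_mem_nhds (by rw [hφ'0]; norm_num : φ' 0 < 2)),
      hαc.eventually (lt_mem_nhds (by rw [hα0]; norm_num : 1 / 2 < α 0)),
      hαc.eventually (gt_mem_nhds (by rw [hα0]; norm_num : α 0 < 2)),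
      hβc.abs.eventually (gt_mem_nhds (by rw [hβ0]; norm_num : |β 0| < 1)), hlin]
      with ξ a1 a2 a3 a4 a5 a6 a7 a8 a9 a10 a11
    exact ⟨a1, ⟨a2, a3, a4, a5⟩, ⟨a6, a7⟩, ⟨a8, a9⟩, a10, a11⟩
  have hfst : Tendsto (fun q : ℝ × ℝ => q.1) (𝓝 0) (𝓝 0) := continuous_fst.tendsto' _ _ rfl
  have hψ : Tendsto (fun q : ℝ × ℝ => E.symm q.1) (𝓝 0) (𝓝 0) := by
    have := hψc.tendsto.comp hfst
    rwa [hψ0] at this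
  have hsnd0 : Tendsto (fun q : ℝ × ℝ => q.2) (𝓝 0) (𝓝 0) := continuous_snd.tendsto' _ _ rfl
  have hηt : Tendsto (fun q : ℝ × ℝ => α (E.symm q.1) * q.2 / (1 - β (E.symm q.1) * q.2)) (𝓝 0) (𝓝 0) := by
    have t1 := ((hα 0).continuousAt.tendsto.comp hψ).mul hsnd0
    have t2 := (((hβ 0).continuousAt.tendsto.comp hψ).mul hsnd0).const_sub 1
    have := t1.div t2 (by simp)
    rw [mul_zero, zero_div] at this
    exact this
  have hall : ∀ᶠ q in 𝓝 (0 : ℝ × ℝ), q.1 ∈ E.target ∧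
      (IsChartExpansion a b c d e φ φ' α α' β β' p₀ p₁ p₂ p₃ (E.symm q.1) ∧
      (|p₀ (E.symm q.1)| ≤ B ∧ |p₁ (E.symm q.1)| ≤ B ∧ |p₂ (E.symm q.1)| ≤ B ∧ |p₃ (E.symm q.1)| ≤ B) ∧
      (1 / 2 < φ' (E.symm q.1) ∧ φ' (E.symm q.1) < 2) ∧ (1 / 2 < α (E.symm q.1) ∧ α (E.symm q.1) < 2) ∧
      |β (E.symm q.1)| < 1 ∧ |φ (E.symm q.1)| ≤ 2 * |E.symm q.1|) ∧ |q.2| < 1 / 4 ∧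
      |E.symm q.1| ≤ ε ∧ |α (E.symm q.1) * q.2 / (1 - β (E.symm q.1) * q.2)| ≤ ε := by
    have ab : ∀ r > 0, ∀ᶠ x in 𝓝 (0 : ℝ), |x| < r := fun r hr => by
      have : Tendsto (fun x : ℝ => |x|) (𝓝 0) (𝓝 0) := by simpa using (continuous_abs.tendsto (0 : ℝ))
      exact this.eventually (gt_mem_nhds hr)
    filter_upwards [hfst.eventually (E.open_target.mem_nhds hE0'), hψ.eventually near,
      hsnd0.eventually (ab (1 / 4) (by norm_num)), hψ.eventually (ab ε hε), hηt.eventually (ab ε hε)]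
      with q a1 a2 a3 a4 a5
    exact ⟨a1, a2, a3, a4.le, a5.le⟩
  obtain ⟨δ₀, hδ₀, hball₀⟩ := Metric.eventually_nhds_iff_ball.1 hall
  obtain ⟨δ, hδ, hδ1, hδ2⟩ : ∃ δ > 0, δ ≤ 1 ∧ δ ≤ δ₀ :=
    ⟨min δ₀ 1, lt_min hδ₀ one_pos, min_le_right _ _, min_le_left _ _⟩
  have hball := fun (q : ℝ × ℝ) (hq : q ∈ Metric.ball 0 δ) =>
    hball₀ q (Metric.ball_subset_ball hδ2 hq)
  have hφψ : ∀ x ∈ E.target, φ (E.symm x) = x := fun x hx => by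
    have := E.right_inv hx
    rwa [hE] at this
  have hden : ∀ q ∈ Metric.ball (0 : ℝ × ℝ) δ, 3 / 4 ≤ 1 - β (E.symm q.1) * q.2 ∧
      1 - β (E.symm q.1) * q.2 ≤ 5 / 4 := by
    intro q hq
    obtain ⟨-, ⟨-, -, -, -, h5, -⟩, h6, -⟩ := hball q hq
    have : |β (E.symm q.1) * q.2| ≤ 1 * (1 / 4) := by
      rw [abs_mul]
      exact mul_le_mul h5.le h6.le (abs_nonneg _) zero_le_one
    have := abs_le.1 this
    constructor <;> linarith [this.1, this.2]
  have dfst : ∀ (γ : ℝ → ℝ × ℝ) (t : ℝ), γ t ∈ Metric.ball (0 : ℝ × ℝ) δ →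
      HasDerivAt γ (cubicField a c 1 b d e (γ t)) t →
      HasDerivAt (fun t => E.symm (γ t).1) ((φ' (E.symm (γ t).1))⁻¹ * -(γ t).2) t := by
    intro γ t ht hγ
    obtain ⟨h1, ⟨-, -, h3, -⟩, -⟩ := hball _ ht
    have d1 : HasDerivAt (fun t => (γ t).1) (-(γ t).2) t :=
      (ContinuousLinearMap.fst ℝ ℝ ℝ).hasFDerivAt.comp_hasDerivAt t hγ
    have d2 : HasDerivAt E.symm (φ' (E.symm (γ t).1))⁻¹ (γ t).1 :=
      E.hasDerivAt_symm h1 (by linarith [h3.1]) (by rw [hE]; exact hφ _)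
    exact d2.comp t d1
  obtain ⟨C, hC⟩ : ∃ C, C = (1 + |a| / ω) / 4 := ⟨_, rfl⟩
  have hC0 : 0 < C := by rw [hC]; positivity
  refine ⟨{
    dom := Metric.ball 0 δ
    core := Metric.closedBall 0 (δ / 2)
    radius := min (ω * (δ / 4) ^ 2) (δ / (8 * C))
    fst := fun q => E.symm q.1
    snd := fun q => α (E.symm q.1) * q.2 / (1 - β (E.symm q.1) * q.2)
    factor := fun q => (1 - β (E.symm q.1) * q.2) / (φ' (E.symm q.1) * α (E.symm q.1))
    isOpen_dom := Metric.isOpen_ball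
    zero_mem := Metric.mem_ball_self hδ
    radius_pos := by positivity
    isClosed_core := Metric.isClosed_closedBall
    core_subset := Metric.closedBall_subset_ball (by linarith)
    mem_core := ?_
    deriv_fst := ?_
    deriv_snd := ?_
    le_factor := ?_
    small := ?_
    fst_eq_zero := ?_
    eq_of_fst := ?_
    dom_subset := Metric.ball_subset_ball hδ1
    tendsto_norm := ?_ }⟩
  · intro q hq hle
    obtain ⟨h1, ⟨-, -, -, h4, -, h6⟩, -⟩ := hball q hq
    have hd := hden q hq
    obtain ⟨b1, b2⟩ := focusCoord_bounds hω (le_refl ‖focusCoord a ω (E.symm q.1)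
      (α (E.symm q.1) * q.2 / (1 - β (E.symm q.1) * q.2))‖)
    obtain ⟨Z, hZ⟩ : ∃ Z, Z = ‖focusCoord a ω (E.symm q.1)
      (α (E.symm q.1) * q.2 / (1 - β (E.symm q.1) * q.2))‖ := ⟨_, rfl⟩
    rw [← hZ] at hle b1 b2
    rw [hφψ _ h1] at h6
    have c1 : |E.symm q.1| ≤ δ / 4 := by
      refine abs_le_of_sq_le_sq (b1.trans ?_) (by positivity)
      rw [div_le_iff₀ hω]
      linarith [hle.trans (min_le_left _ _)]
    have c2 : |α (E.symm q.1) * q.2 / (1 - β (E.symm q.1) * q.2)| ≤ δ / 8 := by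
      refine b2.trans ?_
      have : Z ≤ δ / (8 * C) := hle.trans (min_le_right _ _)
      rw [le_div_iff₀ (by positivity)] at this
      have e : (Z + |a| * (Z / ω)) / 4 = C * Z := by rw [hC]; field_simp
      rw [e]; linarith
    rw [abs_div, abs_mul, abs_of_pos (by linarith [h4.1] : 0 < α (E.symm q.1)),
      abs_of_pos (by linarith [hd.1] : 0 < 1 - β (E.symm q.1) * q.2),
      div_le_iff₀ (by linarith [hd.1])] at c2
    have c3 : δ / 8 * (1 - β (E.symm q.1) * q.2) ≤ δ / 8 * (5 / 4) :=
      mul_le_mul_of_nonneg_left hd.2 (by positivity)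
    have c4 : 1 / 2 * |q.2| ≤ α (E.symm q.1) * |q.2| :=
      mul_le_mul_of_nonneg_right h4.1.le (abs_nonneg _)
    rw [mem_closedBall_zero_iff, Prod.norm_def, Real.norm_eq_abs, Real.norm_eq_abs]
    exact max_le (by linarith) (by linarith)
  · intro γ t ht hγ
    obtain ⟨-, ⟨-, -, h3, h4, -⟩, -⟩ := hball _ ht
    have hd := hden _ ht
    refine (dfst γ t ht hγ).congr_deriv ?_
    have : φ' (E.symm (γ t).1) ≠ 0 := by linarith [h3.1]
    have : α (E.symm (γ t).1) ≠ 0 := by linarith [h4.1]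
    have : 1 - (γ t).2 * β (E.symm (γ t).1) ≠ 0 := by rw [mul_comm]; linarith [hd.1]
    field_simp
  · intro γ t ht hγ
    obtain ⟨h1, ⟨h2, -, h3, h4, -⟩, -⟩ := hball _ ht
    have hd := hden _ ht
    have dξ := dfst γ t ht hγ
    have dy : HasDerivAt (fun t => (γ t).2) (cubicField a c 1 b d e (γ t)).2 t :=
      (ContinuousLinearMap.snd ℝ ℝ ℝ).hasFDerivAt.comp_hasDerivAt t hγ
    have dα : HasDerivAt (fun t => α (E.symm (γ t).1)) _ t := (hα _).comp t dξ
    have dβ : HasDerivAt (fun t => β (E.symm (γ t).1)) _ t := (hβ _).comp t dξ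
    have n1 : φ' (E.symm (γ t).1) ≠ 0 := by linarith [h3.1]
    have n2 : α (E.symm (γ t).1) ≠ 0 := by linarith [h4.1]
    have n3 : 1 - β (E.symm (γ t).1) * (γ t).2 ≠ 0 := by linarith [hd.1]
    refine ((dα.mul dy).div ((dβ.mul dy).const_sub 1) n3).congr_deriv ?_
    refine (chart_snd_deriv n1 n2 n3).trans ?_
    have hx := hφψ _ h1
    have g0 := h2.coeff_zero
    have g1 := h2.coeff_one
    have g2 := h2.coeff_two
    have g3 := h2.coeff_three
    rw [hx] at g0 g1 g2 g3
    rw [g0, g1, g2, g3]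
    ring
  · intro q hq
    obtain ⟨-, ⟨-, -, h3, h4, -⟩, -⟩ := hball q hq
    have hd := hden q hq
    have : φ' (E.symm q.1) * α (E.symm q.1) ≤ 2 * 2 :=
      mul_le_mul h3.2.le h4.2.le (by linarith [h4.1]) (by norm_num)
    rw [le_div_iff₀ (mul_pos (by linarith [h3.1]) (by linarith [h4.1]))]
    linarith [hd.1]
  · intro q hq
    obtain ⟨-, ⟨-, ⟨k0, k1, k2, k3⟩, -⟩, -, h7, h8⟩ := hball q hq
    exact hsmall _ _ _ _ _ _ h7 h8 k0 k1 k2 k3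
  · intro q hq h
    obtain ⟨h1, -⟩ := hball q hq
    rw [← hφψ _ h1, h, hφ0]
  · intro q hq h
    rw [h, hψ0, hα0, hβ0]
    simp
  · refine squeeze_zero (fun q => norm_nonneg _) (fun q => norm_focusCoord_le a hω _ _) ?_
    simpa using ((hψ.pow 2).const_mul (ω + |a|)).add (hηt.abs.const_mul 4)

theorem exists_abs_comp_mul_le {f : ℝ → ℝ} {n : ℕ} (hf : f =O[𝓝 0] fun x => x ^ n) {R : ℝ}
    (hR : 0 < R) : ∃ r₀ > 0, ∃ D ≥ 0, ∀ k, 0 ≤ k → k ≤ R → ∀ r, 0 < r → r < r₀ →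
      |f (r * k)| ≤ D * r ^ n := by
  obtain ⟨D, hD, h⟩ := hf.exists_nonneg
  obtain ⟨δ, hδ, hball⟩ := Metric.eventually_nhds_iff.1 h.bound
  refine ⟨δ / R, by positivity, D * R ^ n, by positivity, fun k hk hkR r hr hrδ => ?_⟩
  have h1 : r * k < δ := lt_of_le_of_lt (mul_le_mul_of_nonneg_left hkR hr.le) ((lt_div_iff₀ hR).1 hrδ)
  have h0 : 0 ≤ r * k := mul_nonneg hr.le hk
  have := hball (show dist (r * k) 0 < δ by rwa [Real.dist_eq, sub_zero, abs_of_nonneg h0])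
  rw [Real.norm_eq_abs, Real.norm_eq_abs, abs_of_nonneg (pow_nonneg h0 n), mul_pow] at this
  refine this.trans ?_
  have hk' : k ^ n ≤ R ^ n := pow_le_pow_left₀ hk hkR n
  calc D * (r ^ n * k ^ n) ≤ D * (r ^ n * R ^ n) := by gcongr
    _ = _ := by ring

theorem abs_pow_sub_pow_le_of_le_one {r₁ r₂ : ℝ} (h₁ : 0 < r₁) (h₁' : r₁ ≤ 1) (h₂ : 0 < r₂) (h₂' : r₂ ≤ 1)
    (j : ℕ) : |r₂ ^ j - r₁ ^ j| ≤ j * |r₂ - r₁| := by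
  induction j with
  | zero => simp
  | succ j ih =>
    have e : r₂ ^ (j + 1) - r₁ ^ (j + 1) = r₂ * (r₂ ^ j - r₁ ^ j) + r₁ ^ j * (r₂ - r₁) := by ring
    rw [e]
    refine (abs_add_le _ _).trans ?_
    rw [abs_mul, abs_mul, abs_of_pos h₂, abs_of_pos (pow_pos h₁ j)]
    have a1 : r₂ * |r₂ ^ j - r₁ ^ j| ≤ 1 * |r₂ ^ j - r₁ ^ j| := by gcongr
    have a2 : r₁ ^ j * |r₂ - r₁| ≤ 1 * |r₂ - r₁| := by
      gcongr
      exact pow_le_one₀ h₁.le h₁'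
    push_cast
    linarith

theorem exists_abs_pow_mul_comp_sub_le {q : ℝ → ℝ} (hq : ContDiffAt ℝ 1 q 0) {R : ℝ} (hR : 0 < R)
    (j : ℕ) : ∃ r₀ > 0, ∃ D ≥ 0, ∀ k, 0 ≤ k → k ≤ R → ∀ r₁ r₂, 0 < r₁ → r₁ < r₀ → 0 < r₂ → r₂ < r₀ →
      |r₂ ^ j * q (r₂ * k) - r₁ ^ j * q (r₁ * k)| ≤ D * |r₂ - r₁| := by
  obtain ⟨L, s, hs, hL⟩ := hq.exists_lipschitzOnWith
  have hb : ∀ᶠ x in 𝓝 (0 : ℝ), |q x| ≤ |q 0| + 1 :=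
    (hq.continuousAt.abs.eventually (gt_mem_nhds (lt_add_one _))).mono fun _ h => le_of_lt h
  obtain ⟨δ, hδ, hball⟩ := Metric.eventually_nhds_iff.1 (hb.and hs)
  refine ⟨min 1 (δ / R), by positivity, j * (|q 0| + 1) + L * R, by positivity, ?_⟩
  intro k hk hkR r₁ r₂ h₁ h₁' h₂ h₂'
  have hin : ∀ r, 0 < r → r < min 1 (δ / R) → |q (r * k)| ≤ |q 0| + 1 ∧ r * k ∈ s := by
    intro r hr hr'
    have h1 : r * k < δ := lt_of_le_of_lt (mul_le_mul_of_nonneg_left hkR hr.le)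
      ((lt_div_iff₀ hR).1 (hr'.trans_le (min_le_right _ _)))
    exact hball (show dist (r * k) 0 < δ by
      rwa [Real.dist_eq, sub_zero, abs_of_nonneg (mul_nonneg hr.le hk)])
  have o₁ : r₁ ≤ 1 := (h₁'.trans_le (min_le_left _ _)).le
  have o₂ : r₂ ≤ 1 := (h₂'.trans_le (min_le_left _ _)).le
  have e : r₂ ^ j * q (r₂ * k) - r₁ ^ j * q (r₁ * k) =
    (r₂ ^ j - r₁ ^ j) * q (r₂ * k) + r₁ ^ j * (q (r₂ * k) - q (r₁ * k)) := by ring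
  rw [e]
  refine (abs_add_le _ _).trans ?_
  rw [abs_mul, abs_mul, abs_of_pos (pow_pos h₁ j), add_mul]
  refine add_le_add ?_ ?_
  · have := mul_le_mul (abs_pow_sub_pow_le_of_le_one h₁ o₁ h₂ o₂ j) (hin r₂ h₂ h₂').1 (abs_nonneg _)
      (by positivity)
    linarith
  · have a1 := hL.dist_le_mul _ (hin r₂ h₂ h₂').2 _ (hin r₁ h₁ h₁').2
    rw [Real.dist_eq, Real.dist_eq, ← sub_mul, abs_mul, abs_of_nonneg hk] at a1
    have a2 : r₁ ^ j ≤ 1 := pow_le_one₀ h₁.le o₁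
    calc r₁ ^ j * |q (r₂ * k) - q (r₁ * k)| ≤ 1 * (L * (|r₂ - r₁| * k)) := by gcongr
      _ ≤ 1 * (L * (|r₂ - r₁| * R)) := by gcongr
      _ = _ := by ring

theorem hasTurnExpansion_of_isBigO {p₀ p₁ p₂ p₃ q₀ q₁ q₂ q₃ : ℝ → ℝ} {K : ℕ} {W : ℝ} (hK : 1 ≤ K)
    (hq₀ : ContDiffAt ℝ 1 q₀ 0) (hq₁ : ContDiffAt ℝ 1 q₁ 0) (hq₂ : ContDiffAt ℝ 1 q₂ 0)
    (hq₃ : ContDiffAt ℝ 1 q₃ 0)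
    (h₀ : (fun x => q₀ x - p₀ x) =O[𝓝 0] fun x => x ^ K)
    (h₁ : (fun x => x * (q₁ x - p₁ x) - W * x ^ K) =O[𝓝 0] fun x => x ^ (K + 1))
    (h₂ : (fun x => q₂ x - p₂ x) =O[𝓝 0] fun x => x ^ (K - 1))
    (h₃ : (fun x => q₃ x - p₃ x) =O[𝓝 0] fun x => x ^ (K - 3)) :
    HasTurnExpansion (fun ξ η => ξ ^ 3 * p₀ ξ + ξ * p₁ ξ * η + p₂ ξ * η ^ 2 + p₃ ξ * η ^ 3)
      (fun ξ η => ξ ^ 3 * q₀ ξ + ξ * q₁ ξ * η + q₂ ξ * η ^ 2 + q₃ ξ * η ^ 3) K W := by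
  intro R'
  obtain ⟨R, hR⟩ : ∃ R, R = max R' 1 := ⟨_, rfl⟩
  have hR0 : 0 < R := by rw [hR]; positivity
  have hRR : R' ≤ R := hR ▸ le_max_left _ _
  obtain ⟨r0, pr0, D0, pD0, H0⟩ := exists_abs_comp_mul_le h₀ hR0
  obtain ⟨r1, pr1, D1, pD1, H1⟩ := exists_abs_comp_mul_le h₁ hR0
  obtain ⟨r2, pr2, D2, pD2, H2⟩ := exists_abs_comp_mul_le h₂ hR0
  obtain ⟨r3, pr3, D3, pD3, H3⟩ := exists_abs_comp_mul_le h₃ hR0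
  obtain ⟨s0, ps0, E0, pE0, L0⟩ := exists_abs_pow_mul_comp_sub_le hq₀ hR0 1
  obtain ⟨s1, ps1, E1, pE1, L1⟩ := exists_abs_pow_mul_comp_sub_le hq₁ hR0 1
  obtain ⟨s2, ps2, E2, pE2, L2⟩ := exists_abs_pow_mul_comp_sub_le hq₂ hR0 2
  obtain ⟨s3, ps3, E3, pE3, L3⟩ := exists_abs_pow_mul_comp_sub_le hq₃ hR0 4
  obtain ⟨ρ, hρ0, m1, m2, m3, m4, m5, m6, m7, m8, m9⟩ : ∃ ρ > 0, ρ ≤ 1 ∧ ρ ≤ r0 ∧ ρ ≤ r1 ∧ ρ ≤ r2 ∧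
      ρ ≤ r3 ∧ ρ ≤ s0 ∧ ρ ≤ s1 ∧ ρ ≤ s2 ∧ ρ ≤ s3 := by
    refine ⟨min 1 (min (min r0 (min r1 (min r2 r3))) (min s0 (min s1 (min s2 s3)))), by positivity, ?_⟩
    simp
  refine ⟨ρ, hρ0, (R ^ 3 * D0 + R * D1 + R ^ 2 * D2 + R ^ 3 * D3) +
    (R ^ 3 * E0 + R * R * E1 + R ^ 2 * E2 + R ^ 3 * E3), by positivity, ?_⟩
  intro k l hk hkR' hlR'
  have hkR : k ≤ R := hkR'.trans hRR
  have hlR : |l| ≤ R := hlR'.trans hRR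
  have hl2 : |l| ^ 2 ≤ R ^ 2 := pow_le_pow_left₀ (abs_nonneg l) hlR 2
  have hl3 : |l| ^ 3 ≤ R ^ 3 := pow_le_pow_left₀ (abs_nonneg l) hlR 3
  have hk3 : k ^ 3 ≤ R ^ 3 := pow_le_pow_left₀ hk hkR 3
  constructor
  · intro r hr hrρ
    have hr1 : r ≤ 1 := (hrρ.trans_le m1).le
    have e : (r * k) ^ 3 * q₀ (r * k) + r * k * q₁ (r * k) * (r ^ 2 * l) + q₂ (r * k) * (r ^ 2 * l) ^ 2
        + q₃ (r * k) * (r ^ 2 * l) ^ 3 - ((r * k) ^ 3 * p₀ (r * k) + r * k * p₁ (r * k) * (r ^ 2 * l)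
        + p₂ (r * k) * (r ^ 2 * l) ^ 2 + p₃ (r * k) * (r ^ 2 * l) ^ 3) - W * r ^ (K + 2) * (k ^ K * l)
        = r ^ 3 * k ^ 3 * (q₀ (r * k) - p₀ (r * k))
          + r ^ 2 * l * (r * k * (q₁ (r * k) - p₁ (r * k)) - W * (r * k) ^ K)
          + r ^ 4 * l ^ 2 * (q₂ (r * k) - p₂ (r * k)) + r ^ 6 * l ^ 3 * (q₃ (r * k) - p₃ (r * k)) := by
      ring
    simp only
    rw [e]
    have g0 := H0 k hk hkR r hr (hrρ.trans_le m2)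
    have g1 := H1 k hk hkR r hr (hrρ.trans_le m3)
    have g2 := H2 k hk hkR r hr (hrρ.trans_le m4)
    have g3 := H3 k hk hkR r hr (hrρ.trans_le m5)
    have t0 : |r ^ 3 * k ^ 3 * (q₀ (r * k) - p₀ (r * k))| ≤ R ^ 3 * D0 * r ^ (K + 3) := by
      rw [abs_mul, abs_of_nonneg (by positivity)]
      calc r ^ 3 * k ^ 3 * |q₀ (r * k) - p₀ (r * k)| ≤ r ^ 3 * R ^ 3 * (D0 * r ^ K) := by gcongr
        _ = _ := by ring
    have t1 : |r ^ 2 * l * (r * k * (q₁ (r * k) - p₁ (r * k)) - W * (r * k) ^ K)| ≤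
        R * D1 * r ^ (K + 3) := by
      rw [abs_mul, abs_mul, abs_of_pos (pow_pos hr 2)]
      calc r ^ 2 * |l| * |r * k * (q₁ (r * k) - p₁ (r * k)) - W * (r * k) ^ K|
          ≤ r ^ 2 * R * (D1 * r ^ (K + 1)) := by gcongr
        _ = _ := by ring
    have t2 : |r ^ 4 * l ^ 2 * (q₂ (r * k) - p₂ (r * k))| ≤ R ^ 2 * D2 * r ^ (K + 3) := by
      rw [abs_mul, abs_mul, abs_of_pos (pow_pos hr 4), abs_pow]
      calc r ^ 4 * |l| ^ 2 * |q₂ (r * k) - p₂ (r * k)| ≤ r ^ 4 * R ^ 2 * (D2 * r ^ (K - 1)) := by gcongr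
        _ = R ^ 2 * D2 * r ^ (4 + (K - 1)) := by ring
        _ = _ := by rw [show 4 + (K - 1) = K + 3 by omega]
    have t3 : |r ^ 6 * l ^ 3 * (q₃ (r * k) - p₃ (r * k))| ≤ R ^ 3 * D3 * r ^ (K + 3) := by
      rw [abs_mul, abs_mul, abs_of_pos (pow_pos hr 6), abs_pow]
      have : r ^ (6 + (K - 3)) ≤ r ^ (K + 3) := pow_le_pow_of_le_one hr.le hr1 (by omega)
      calc r ^ 6 * |l| ^ 3 * |q₃ (r * k) - p₃ (r * k)| ≤ r ^ 6 * R ^ 3 * (D3 * r ^ (K - 3)) := by gcongr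
        _ = R ^ 3 * D3 * r ^ (6 + (K - 3)) := by ring
        _ ≤ _ := by gcongr
    refine (abs_add_le _ _).trans ?_
    have u1 := abs_add_le (r ^ 3 * k ^ 3 * (q₀ (r * k) - p₀ (r * k)))
      (r ^ 2 * l * (r * k * (q₁ (r * k) - p₁ (r * k)) - W * (r * k) ^ K))
    have u2 := abs_add_le (r ^ 3 * k ^ 3 * (q₀ (r * k) - p₀ (r * k)) +
      r ^ 2 * l * (r * k * (q₁ (r * k) - p₁ (r * k)) - W * (r * k) ^ K))
      (r ^ 4 * l ^ 2 * (q₂ (r * k) - p₂ (r * k)))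
    have u3 : 0 ≤ (R ^ 3 * E0 + R * R * E1 + R ^ 2 * E2 + R ^ 3 * E3) * r ^ (K + 3) := by positivity
    linarith
  · intro r₁ r₂ h1 h1' h2 h2'
    have e : ∀ r : ℝ, 0 < r → ((r * k) ^ 3 * q₀ (r * k) + r * k * q₁ (r * k) * (r ^ 2 * l)
        + q₂ (r * k) * (r ^ 2 * l) ^ 2 + q₃ (r * k) * (r ^ 2 * l) ^ 3) / r ^ 2
        = k ^ 3 * (r ^ 1 * q₀ (r * k)) + k * l * (r ^ 1 * q₁ (r * k)) + l ^ 2 * (r ^ 2 * q₂ (r * k))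
          + l ^ 3 * (r ^ 4 * q₃ (r * k)) := by
      intro r hr; field_simp
    simp only
    rw [e r₁ h1, e r₂ h2]
    have g0 := L0 k hk hkR r₁ r₂ h1 (h1'.trans_le m6) h2 (h2'.trans_le m6)
    have g1 := L1 k hk hkR r₁ r₂ h1 (h1'.trans_le m7) h2 (h2'.trans_le m7)
    have g2 := L2 k hk hkR r₁ r₂ h1 (h1'.trans_le m8) h2 (h2'.trans_le m8)
    have g3 := L3 k hk hkR r₁ r₂ h1 (h1'.trans_le m9) h2 (h2'.trans_le m9)
    obtain ⟨d0, hd0⟩ : ∃ d, d = r₂ ^ 1 * q₀ (r₂ * k) - r₁ ^ 1 * q₀ (r₁ * k) := ⟨_, rfl⟩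
    obtain ⟨d1, hd1⟩ : ∃ d, d = r₂ ^ 1 * q₁ (r₂ * k) - r₁ ^ 1 * q₁ (r₁ * k) := ⟨_, rfl⟩
    obtain ⟨d2, hd2⟩ : ∃ d, d = r₂ ^ 2 * q₂ (r₂ * k) - r₁ ^ 2 * q₂ (r₁ * k) := ⟨_, rfl⟩
    obtain ⟨d3, hd3⟩ : ∃ d, d = r₂ ^ 4 * q₃ (r₂ * k) - r₁ ^ 4 * q₃ (r₁ * k) := ⟨_, rfl⟩
    rw [← hd0] at g0
    rw [← hd1] at g1
    rw [← hd2] at g2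
    rw [← hd3] at g3
    rw [show k ^ 3 * (r₂ ^ 1 * q₀ (r₂ * k)) + k * l * (r₂ ^ 1 * q₁ (r₂ * k))
        + l ^ 2 * (r₂ ^ 2 * q₂ (r₂ * k)) + l ^ 3 * (r₂ ^ 4 * q₃ (r₂ * k))
        - (k ^ 3 * (r₁ ^ 1 * q₀ (r₁ * k)) + k * l * (r₁ ^ 1 * q₁ (r₁ * k))
        + l ^ 2 * (r₁ ^ 2 * q₂ (r₁ * k)) + l ^ 3 * (r₁ ^ 4 * q₃ (r₁ * k)))
        = k ^ 3 * d0 + k * l * d1 + l ^ 2 * d2 + l ^ 3 * d3 by rw [hd0, hd1, hd2, hd3]; ring]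
    have t0 : |k ^ 3 * d0| ≤ R ^ 3 * E0 * |r₂ - r₁| := by
      rw [abs_mul, abs_of_nonneg (pow_nonneg hk 3), mul_assoc]
      gcongr
    have t1 : |k * l * d1| ≤ R * R * E1 * |r₂ - r₁| := by
      rw [abs_mul, abs_mul, abs_of_nonneg hk, mul_assoc (R * R)]
      gcongr
    have t2 : |l ^ 2 * d2| ≤ R ^ 2 * E2 * |r₂ - r₁| := by
      rw [abs_mul, abs_pow, mul_assoc]
      gcongr
    have t3 : |l ^ 3 * d3| ≤ R ^ 3 * E3 * |r₂ - r₁| := by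
      rw [abs_mul, abs_pow, mul_assoc]
      gcongr
    refine (abs_add_le _ _).trans ?_
    have u1 := abs_add_le (k ^ 3 * d0) (k * l * d1)
    have u2 := abs_add_le (k ^ 3 * d0 + k * l * d1) (l ^ 2 * d2)
    have u3 : 0 ≤ (R ^ 3 * D0 + R * D1 + R ^ 2 * D2 + R ^ 3 * D3) * |r₂ - r₁| := by positivity
    linarith

/-! ### Truncated power series -/

/-- The polynomial function with a given list of coefficients. -/
def jetEval : List ℝ → ℝ → ℝ
  | [], _ => 0
  | a :: l, x => a + x * jetEval l x

/-- The coefficients of the product of two truncated power series. -/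
def jetMul : List ℝ → List ℝ → List ℝ
  | [], _ => []
  | _ :: _, [] => []
  | a :: l, b :: l' => a * b :: List.zipWith (· + ·) (l'.map (a * ·)) (jetMul l (b :: l'))

/-- Multiplies the coefficients by `k, k + 1, …`. -/
def jetScale : ℕ → List ℝ → List ℝ
  | _, [] => []
  | k, a :: l => k * a :: jetScale (k + 1) l

/-- The coefficients after the substitution `x ↦ -x`. -/
def jetNeg : List ℝ → List ℝ
  | [] => []
  | a :: l => a :: (jetNeg l).map (fun c => -c)

/-- `f` has the expansion with coefficients `l` at `0`, up to order `x ^ l.length`. -/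
def HasJet (l : List ℝ) (f : ℝ → ℝ) : Prop :=
  (fun x => f x - jetEval l x) =O[𝓝 0] fun x => x ^ l.length

theorem analytic_jetEval (l : List ℝ) (x : ℝ) : AnalyticAt ℝ (jetEval l) x := by
  induction l with
  | nil => exact analyticAt_const
  | cons a l ih => exact analyticAt_const.add (analyticAt_id.mul ih)

theorem continuous_jetEval (l : List ℝ) : Continuous (jetEval l) :=
  continuous_iff_continuousAt.2 fun x => (analytic_jetEval l x).continuousAt

theorem hasDerivAt_pow_mul_jetEval (l : List ℝ) (k : ℕ) (x : ℝ) :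
    HasDerivAt (fun x => x ^ (k + 1) * jetEval l x) (x ^ k * jetEval (jetScale (k + 1) l) x) x := by
  induction l generalizing k with
  | nil => simpa [jetEval, jetScale] using hasDerivAt_const x (0 : ℝ)
  | cons a l ih =>
    have h := ((hasDerivAt_pow (k + 1) x).mul_const a).add (ih (k + 1))
    have e : (fun x => x ^ (k + 1) * jetEval (a :: l) x) =
        (fun x : ℝ => x ^ (k + 1) * a) + fun x => x ^ (k + 1 + 1) * jetEval l x := by
      funext x; simp only [jetEval, Pi.add_apply]; ring
    rw [e]
    refine h.congr_deriv ?_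
    simp only [jetEval, jetScale, Nat.add_sub_cancel]
    ring

theorem hasDerivAt_mul_jetEval (l : List ℝ) (x : ℝ) :
    HasDerivAt (fun x => x * jetEval l x) (jetEval (jetScale 1 l) x) x := by
  simpa using hasDerivAt_pow_mul_jetEval l 0 x

theorem jetEval_zipWith (l l' : List ℝ) : ∃ r : ℝ → ℝ, Continuous r ∧ ∀ x,
    jetEval l x + jetEval l' x = jetEval (List.zipWith (· + ·) l l') x
      + x ^ min l.length l'.length * r x := by
  induction l generalizing l' with
  | nil => exact ⟨jetEval l', continuous_jetEval l', fun x => by simp [jetEval]⟩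
  | cons a l ih =>
    cases l' with
    | nil => exact ⟨jetEval (a :: l), continuous_jetEval _, fun x => by simp [jetEval]⟩
    | cons b l' =>
      obtain ⟨r, hr, h⟩ := ih l'
      refine ⟨r, hr, fun x => ?_⟩
      simp only [jetEval, List.zipWith_cons_cons, List.length_cons, Nat.succ_min_succ, pow_succ]
      linear_combination x * h x

theorem jetEval_map_mul (c : ℝ) (l : List ℝ) (x : ℝ) :
    jetEval (l.map (c * ·)) x = c * jetEval l x := by
  induction l with
  | nil => simp [jetEval]
  | cons a l ih => simp only [List.map_cons, jetEval, ih]; ring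

theorem jetEval_map_neg (l : List ℝ) (x : ℝ) : jetEval (l.map (fun c => -c)) x = -jetEval l x := by
  induction l with
  | nil => simp [jetEval]
  | cons a l ih => simp only [List.map_cons, jetEval, ih]; ring

theorem jetEval_jetNeg (l : List ℝ) (x : ℝ) : jetEval (jetNeg l) x = jetEval l (-x) := by
  induction l with
  | nil => simp [jetEval, jetNeg]
  | cons a l ih => simp only [jetNeg, jetEval, jetEval_map_neg, ih]; ring

theorem length_jetNeg (l : List ℝ) : (jetNeg l).length = l.length := by
  induction l with
  | nil => rfl
  | cons a l ih => simp [jetNeg, ih]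

theorem length_jetMul (l l' : List ℝ) : (jetMul l l').length = min l.length l'.length := by
  induction l generalizing l' with
  | nil => simp [jetMul]
  | cons a l ih =>
    cases l' with
    | nil => simp [jetMul]
    | cons b l' => simp [jetMul, ih]; omega

theorem jetEval_jetMul (l l' : List ℝ) : ∃ r : ℝ → ℝ, Continuous r ∧ ∀ x,
    jetEval l x * jetEval l' x = jetEval (jetMul l l') x + x ^ min l.length l'.length * r x := by
  induction l generalizing l' with
  | nil => exact ⟨fun _ => 0, continuous_const, fun x => by simp [jetEval, jetMul]⟩
  | cons a l ih =>
    cases l' with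
    | nil => exact ⟨fun _ => 0, continuous_const, fun x => by simp [jetEval, jetMul]⟩
    | cons b l' =>
      obtain ⟨r, hr, h⟩ := ih (b :: l')
      obtain ⟨s, hs, h'⟩ := jetEval_zipWith (l'.map (a * ·)) (jetMul l (b :: l'))
      have e : min (l'.map (a * ·)).length (jetMul l (b :: l')).length = min l.length l'.length := by
        rw [length_jetMul, List.length_map, List.length_cons]; omega
      rw [e] at h'
      obtain ⟨k, hk⟩ : ∃ k, min l.length (b :: l').length = min l.length l'.length + k :=
        ⟨_, (Nat.add_sub_cancel' (by rw [List.length_cons]; omega)).symm⟩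
      rw [hk] at h
      refine ⟨fun x => s x + x ^ k * r x, by fun_prop, fun x => ?_⟩
      have h1 := h x
      have h2 := h' x
      rw [jetEval_map_mul] at h2
      simp only [jetEval, jetMul, List.length_cons, Nat.succ_min_succ, pow_succ, pow_add] at h1 h2 ⊢
      linear_combination x * h1 + x * h2

theorem hasJet_jetEval (l : List ℝ) : HasJet l (jetEval l) := by
  simp only [HasJet, sub_self]
  exact Asymptotics.isBigO_zero _ _

theorem isBigO_pow_of_le {m n : ℕ} (h : m ≤ n) :
    (fun x : ℝ => x ^ n) =O[𝓝 0] fun x => x ^ m := by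
  obtain ⟨k, rfl⟩ := Nat.exists_eq_add_of_le h
  simp only [pow_add]
  have h1 : (fun x : ℝ => x ^ k) =O[𝓝 0] fun _ => (1 : ℝ) :=
    (continuous_pow k).continuousAt.tendsto.isBigO_one ℝ
  simpa using (Asymptotics.isBigO_refl (fun x : ℝ => x ^ m) (𝓝 0)).mul h1

theorem isBigO_pow_mul {r : ℝ → ℝ} (hr : ContinuousAt r 0) (n : ℕ) :
    (fun x => x ^ n * r x) =O[𝓝 0] fun x => x ^ n := by
  simpa using (Asymptotics.isBigO_refl (fun x : ℝ => x ^ n) (𝓝 0)).mul (hr.tendsto.isBigO_one ℝ)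

section

variable {l l' : List ℝ} {f g : ℝ → ℝ}

theorem HasJet.isBigO_one (h : HasJet l f) : f =O[𝓝 0] fun _ => (1 : ℝ) := by
  have h1 : (fun x : ℝ => x ^ l.length) =O[𝓝 0] fun _ => (1 : ℝ) :=
    (continuous_pow _).continuousAt.tendsto.isBigO_one ℝ
  have h2 : jetEval l =O[𝓝 0] fun _ => (1 : ℝ) :=
    (continuous_jetEval l).continuousAt.tendsto.isBigO_one ℝ
  simpa using (h.trans h1).add h2

theorem HasJet.add (hf : HasJet l f) (hg : HasJet l' g) :
    HasJet (List.zipWith (· + ·) l l') (fun x => f x + g x) := by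
  obtain ⟨r, hr, h⟩ := jetEval_zipWith l l'
  rw [HasJet, List.length_zipWith]
  have h1 := (hf.trans (isBigO_pow_of_le (min_le_left l.length l'.length))).add
    (hg.trans (isBigO_pow_of_le (min_le_right l.length l'.length)))
  refine (h1.add (isBigO_pow_mul hr.continuousAt _)).congr_left fun x => ?_
  linear_combination -h x

theorem HasJet.mul (hf : HasJet l f) (hg : HasJet l' g) :
    HasJet (jetMul l l') (fun x => f x * g x) := by
  obtain ⟨r, hr, h⟩ := jetEval_jetMul l l'
  rw [HasJet, length_jetMul]
  have h1 := (hf.trans (isBigO_pow_of_le (min_le_left l.length l'.length))).mul hg.isBigO_one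
  have h2 := ((hasJet_jetEval l).isBigO_one).mul
    (hg.trans (isBigO_pow_of_le (min_le_right l.length l'.length)))
  simp only [mul_one, one_mul] at h1 h2
  refine ((h1.add h2).add (isBigO_pow_mul hr.continuousAt _)).congr_left fun x => ?_
  linear_combination -h x

theorem HasJet.const_mul (c : ℝ) (hf : HasJet l f) : HasJet (l.map (c * ·)) (fun x => c * f x) := by
  rw [HasJet, List.length_map]
  refine (Asymptotics.IsBigO.const_mul_left hf c).congr_left fun x => ?_
  rw [jetEval_map_mul]; ring

theorem HasJet.comp_neg (hf : HasJet l f) : HasJet (jetNeg l) (fun x => f (-x)) := by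
  have ht : Tendsto (fun x : ℝ => -x) (𝓝 0) (𝓝 0) := by simpa using (continuous_neg.tendsto (0 : ℝ))
  have := hf.comp_tendsto ht
  rw [HasJet, length_jetNeg]
  refine Asymptotics.IsBigO.trans (g := (fun x : ℝ => x ^ l.length) ∘ fun x => -x)
    (this.congr_left fun x => ?_) ?_
  · simp only [Function.comp_apply, jetEval_jetNeg]
  · refine Asymptotics.IsBigO.of_bound 1 (Filter.Eventually.of_forall fun x => ?_)
    simp

theorem HasJet.congr (hf : HasJet l f) (h : l = l') : HasJet l' f := h ▸ hf

theorem HasJet.congr_fun (hf : HasJet l f) (h : ∀ x, f x = g x) : HasJet l g := by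
  rwa [← funext h]

theorem jetEval_replicate_zero (n : ℕ) (x : ℝ) : jetEval (List.replicate n 0) x = 0 := by
  induction n with
  | zero => rfl
  | succ n ih => simp [List.replicate_succ, jetEval, ih]

theorem HasJet.inv {n : ℕ} (hf : ContinuousAt f 0) (h0 : f 0 ≠ 0)
    (h : HasJet (1 :: List.replicate n 0) (fun x => f x * jetEval l x)) (hl : l.length = n + 1) :
    HasJet l (fun x => (f x)⁻¹) := by
  rw [HasJet, hl]
  rw [HasJet, List.length_cons, List.length_replicate] at h
  have h1 := h.mul ((hf.inv₀ h0).tendsto.isBigO_one ℝ)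
  simp only [mul_one, jetEval, jetEval_replicate_zero, mul_zero, add_zero] at h1
  refine (h1.neg_left).congr' ?_ (Filter.EventuallyEq.refl _ _)
  filter_upwards [hf.eventually_ne h0] with x hx
  rw [Pi.inv_apply]
  field_simp
  ring

theorem HasJet.isBigO {n : ℕ} (h : HasJet (List.replicate n 0) f) : f =O[𝓝 0] fun x => x ^ n := by
  rw [HasJet, List.length_replicate] at h
  simpa [jetEval_replicate_zero] using h

/-- Division by `x`. -/
theorem isBigO_of_mul_isBigO {n : ℕ} (hg : ContinuousAt g 0)
    (h : (fun x => x * g x) =O[𝓝 0] fun x => x ^ (n + 1)) : g =O[𝓝 0] fun x => x ^ n := by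
  obtain ⟨C, hC⟩ := h.bound
  refine Asymptotics.IsBigO.of_bound C ?_
  have h1 : ∀ x : ℝ, x ≠ 0 → ‖x * g x‖ ≤ C * ‖x ^ (n + 1)‖ → ‖g x‖ ≤ C * ‖x ^ n‖ := by
    intro x hx h
    have hx' : 0 < ‖x‖ := norm_pos_iff.2 hx
    rw [norm_mul, pow_succ, norm_mul] at h
    refine le_of_mul_le_mul_left ?_ hx'
    linarith
  have h2 : ∀ᶠ x in 𝓝[≠] (0 : ℝ), ‖g x‖ ≤ C * ‖x ^ n‖ := by
    filter_upwards [hC.filter_mono nhdsWithin_le_nhds, self_mem_nhdsWithin] with x hx hx0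
    exact h1 x hx0 hx
  have h3 : ‖g 0‖ ≤ C * ‖(0 : ℝ) ^ n‖ := by
    have t1 : Tendsto (fun x => ‖g x‖) (𝓝[≠] 0) (𝓝 ‖g 0‖) := hg.norm.tendsto.mono_left nhdsWithin_le_nhds
    have t2 : Tendsto (fun x : ℝ => C * ‖x ^ n‖) (𝓝[≠] 0) (𝓝 (C * ‖(0 : ℝ) ^ n‖)) := by
      have : ContinuousAt (fun x : ℝ => C * ‖x ^ n‖) 0 := by fun_prop
      exact this.tendsto.mono_left nhdsWithin_le_nhds
    exact le_of_tendsto_of_tendsto t1 t2 h2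
  filter_upwards [hC] with x hx
  rcases eq_or_ne x 0 with rfl | hx0
  · exact h3
  · exact h1 x hx0 hx

theorem AnalyticAt.exists_eq_add_mul (hf : AnalyticAt ℝ f 0) :
    ∃ p : ℝ → ℝ, AnalyticAt ℝ p 0 ∧ ∀ x, f x = f 0 + x * p x := by
  obtain ⟨s, hs⟩ := hf
  refine ⟨dslope f 0, ⟨_, hs.has_fpower_series_dslope_fslope⟩, fun x => ?_⟩
  have := sub_smul_dslope f 0 x
  rw [sub_zero, smul_eq_mul] at this
  linarith

end

/-- The coordinates `x = ξ f ξ`, `1 / y = α ξ / η + β ξ` for analytic functions `f, α, β`, together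
with the derivatives `φ'` of `ξ f ξ`, `α'` and `β'`. -/
structure ChartData (c e : ℝ) (f φ' α α' β β' : ℝ → ℝ) : Prop where
  analytic_fst : ∀ x, AnalyticAt ℝ f x
  analytic_deriv : AnalyticAt ℝ φ' 0
  analytic_scale : AnalyticAt ℝ α 0
  analytic_scale_deriv : AnalyticAt ℝ α' 0
  analytic_shift : AnalyticAt ℝ β 0
  analytic_shift_deriv : AnalyticAt ℝ β' 0
  hasDerivAt_fst : ∀ x, HasDerivAt (fun x => x * f x) (φ' x) x
  hasDerivAt_scale : ∀ x, HasDerivAt α (α' x) x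
  hasDerivAt_shift : ∀ x, HasDerivAt β (β' x) x
  fst_zero : f 0 = 1
  deriv_zero : φ' 0 = 1
  scale_zero : α 0 = 1
  shift_zero : β 0 = 0
  scale_deriv_zero : α' 0 = c
  shift_deriv_zero : β' 0 = e

theorem ChartData.of_jetEval {l₁ l₂ : List ℝ} {l₃ l₄ : List ℝ} {c e : ℝ} (h₁ : l₁ = 1 :: l₂) :
    ChartData c e (jetEval l₁) (jetEval (jetScale 1 l₁)) (jetEval (1 :: c :: l₃))
      (jetEval (jetScale 1 (c :: l₃))) (jetEval (0 :: e :: l₄)) (jetEval (jetScale 1 (e :: l₄))) where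
  analytic_fst := analytic_jetEval _
  analytic_deriv := analytic_jetEval _ _
  analytic_scale := analytic_jetEval _ _
  analytic_scale_deriv := analytic_jetEval _ _
  analytic_shift := analytic_jetEval _ _
  analytic_shift_deriv := analytic_jetEval _ _
  hasDerivAt_fst := hasDerivAt_mul_jetEval _
  hasDerivAt_scale x := (hasDerivAt_mul_jetEval (c :: l₃) x).const_add 1
  hasDerivAt_shift x := (hasDerivAt_mul_jetEval (e :: l₄) x).const_add 0
  fst_zero := by simp [h₁, jetEval]
  deriv_zero := by simp [h₁, jetEval, jetScale]
  scale_zero := by simp [jetEval]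
  shift_zero := by simp [jetEval]
  scale_deriv_zero := by simp [jetEval, jetScale]
  shift_deriv_zero := by simp [jetEval, jetScale]

/-- The coefficients of the transformed system, divided by a power of `ξ`, are `G₃, G₂, G₁, G₀`. -/
structure IsChartCoeff (a b c d e : ℝ) (f φ' α α' β β' G₃ G₂ G₁ G₀ : ℝ → ℝ) : Prop where
  three : ∀ x, G₃ x = φ' x * α x ^ 2 * f x ^ 3
  two : ∀ x, G₂ x = φ' x * α x * (3 * β x * x ^ 2 * f x ^ 3 + a * f x + b * x * f x ^ 2)
  one : ∀ x, G₁ x = φ' x * (3 * β x ^ 2 * x ^ 3 * f x ^ 3 + 2 * β x * (a * x * f x + b * x ^ 2 * f x ^ 2)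
    + c + d * x * f x) - α' x * (α x)⁻¹
  zero : ∀ x, G₀ x = (φ' x * (β x ^ 3 * x ^ 3 * f x ^ 3 + β x ^ 2 * (a * x * f x + b * x ^ 2 * f x ^ 2)
    + β x * (c + d * x * f x) + e) - β' x) * (α x)⁻¹

section

variable {a b c d e : ℝ} {f φ' α α' β β' G₃ G₂ G₁ G₀ : ℝ → ℝ}

theorem ChartData.exists_expansion (h : ChartData c e f φ' α α' β β')
    (hG : IsChartCoeff a b c d e f φ' α α' β β' G₃ G₂ G₁ G₀) :
    ∃ p₀ p₁ p₂ p₃ : ℝ → ℝ, AnalyticAt ℝ p₀ 0 ∧ AnalyticAt ℝ p₁ 0 ∧ AnalyticAt ℝ p₂ 0 ∧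
      AnalyticAt ℝ p₃ 0 ∧ (∀ x, G₃ x = 1 + x * p₀ x) ∧ (∀ x, G₂ x = a + x * p₁ x) ∧
      (∀ x, G₁ x = x * p₂ x) ∧ (∀ x, G₀ x = x * p₃ x) ∧
      ∀ x, IsChartExpansion a b c d e (fun x => x * f x) φ' α α' β β' p₀ p₁ p₂ p₃ x := by
  have hf := h.analytic_fst 0
  have hF := h.analytic_deriv
  have hα := h.analytic_scale
  have hα' := h.analytic_scale_deriv
  have hβ := h.analytic_shift
  have hβ' := h.analytic_shift_deriv
  have hα0 : α 0 ≠ 0 := by rw [h.scale_zero]; exact one_ne_zero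
  have hi := hα.inv hα0
  have hx : AnalyticAt ℝ (fun x : ℝ => x) 0 := analyticAt_id
  have hc : ∀ r : ℝ, AnalyticAt ℝ (fun _ : ℝ => r) 0 := fun r => analyticAt_const
  have A3 : AnalyticAt ℝ G₃ 0 := by
    rw [funext hG.three]
    exact (hF.mul (hα.pow 2)).mul (hf.pow 3)
  have A2 : AnalyticAt ℝ G₂ 0 := by
    rw [funext hG.two]
    exact (hF.mul hα).mul ((((((hc 3).mul hβ).mul (hx.pow 2)).mul (hf.pow 3)).add ((hc a).mul hf)).add
      (((hc b).mul hx).mul (hf.pow 2)))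
  have A1 : AnalyticAt ℝ G₁ 0 := by
    rw [funext hG.one]
    exact (hF.mul ((((((((hc 3).mul (hβ.pow 2)).mul (hx.pow 3)).mul (hf.pow 3))).add
      (((hc 2).mul hβ).mul ((((hc a).mul hx).mul hf).add (((hc b).mul (hx.pow 2)).mul (hf.pow 2))))).add
      (hc c)).add (((hc d).mul hx).mul hf))).sub (hα'.mul hi)
  have A0 : AnalyticAt ℝ G₀ 0 := by
    rw [funext hG.zero]
    exact ((hF.mul ((((((hβ.pow 3).mul (hx.pow 3)).mul (hf.pow 3)).add
      ((hβ.pow 2).mul ((((hc a).mul hx).mul hf).add (((hc b).mul (hx.pow 2)).mul (hf.pow 2))))).add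
      (hβ.mul ((hc c).add (((hc d).mul hx).mul hf)))).add (hc e))).sub hβ').mul hi
  obtain ⟨p₀, a0, e0⟩ := A3.exists_eq_add_mul
  obtain ⟨p₁, a1, e1⟩ := A2.exists_eq_add_mul
  obtain ⟨p₂, a2, e2⟩ := A1.exists_eq_add_mul
  obtain ⟨p₃, a3, e3⟩ := A0.exists_eq_add_mul
  have z3 : G₃ 0 = 1 := by rw [hG.three, h.deriv_zero, h.scale_zero, h.fst_zero]; norm_num
  have z2 : G₂ 0 = a := by
    rw [hG.two, h.deriv_zero, h.scale_zero, h.fst_zero, h.shift_zero]; ring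
  have z1 : G₁ 0 = 0 := by
    rw [hG.one, h.deriv_zero, h.scale_zero, h.shift_zero, h.scale_deriv_zero]; ring
  have z0 : G₀ 0 = 0 := by
    rw [hG.zero, h.deriv_zero, h.scale_zero, h.shift_zero, h.shift_deriv_zero]; ring
  rw [z3] at e0
  rw [z2] at e1
  simp only [z1, zero_add] at e2
  simp only [z0, zero_add] at e3
  refine ⟨p₀, p₁, p₂, p₃, a0, a1, a2, a3, e0, e1, e2, e3, fun x => ⟨?_, ?_, ?_, ?_⟩⟩
  · have := e0 x
    rw [hG.three] at this
    linear_combination x ^ 3 * this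
  · have := e1 x
    rw [hG.two] at this
    linear_combination x * this
  · have := e2 x
    rw [hG.one] at this
    rw [← this, div_eq_mul_inv]; ring
  · have := e3 x
    rw [hG.zero] at this
    rw [← this, div_eq_mul_inv]; ring

theorem ChartData.exists_focusChart {ω : ℝ} (hω : 0 < ω) (h : ChartData c e f φ' α α' β β')
    {p₀ p₁ p₂ p₃ : ℝ → ℝ} (a0 : AnalyticAt ℝ p₀ 0) (a1 : AnalyticAt ℝ p₁ 0)
    (a2 : AnalyticAt ℝ p₂ 0) (a3 : AnalyticAt ℝ p₃ 0)
    (hexp : ∀ x, IsChartExpansion a b c d e (fun x => x * f x) φ' α α' β β' p₀ p₁ p₂ p₃ x) :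
    Nonempty (FocusChart (cubicField a c 1 b d e) a ω (1 / 8)
      (fun ξ η => ξ ^ 3 * p₀ ξ + ξ * p₁ ξ * η + p₂ ξ * η ^ 2 + p₃ ξ * η ^ 3)) := by
  have hφ : ContDiff ℝ 1 (fun x => x * f x) := contDiff_iff_contDiffAt.2 fun x =>
    (analyticAt_id.mul (h.analytic_fst x)).contDiffAt
  exact _root_.exists_focusChart hω hφ h.hasDerivAt_fst h.analytic_deriv.continuousAt h.hasDerivAt_scale
    h.hasDerivAt_shift (zero_mul _) h.deriv_zero h.scale_zero h.shift_zero a0.continuousAt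
    a1.continuousAt a2.continuousAt a3.continuousAt (Filter.Eventually.of_forall hexp)

/-- If the first obstruction to the symmetry `ξ ↦ -ξ` of the transformed system has order `K`, then
the origin is not a center. -/
theorem ChartData.not_isCenter (ha : a ^ 2 < 8) (h : ChartData c e f φ' α α' β β')
    (hG : IsChartCoeff a b c d e f φ' α α' β β' G₃ G₂ G₁ G₀) {K : ℕ} {W : ℝ} (hK : 1 ≤ K) (hW : W ≠ 0)
    (h₃ : (fun x => G₃ x - G₃ (-x)) =O[𝓝 0] fun x => x ^ (K + 1))
    (h₂ : (fun x => G₂ x - G₂ (-x) - W * x ^ K) =O[𝓝 0] fun x => x ^ (K + 1))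
    (h₁ : (fun x => G₁ x + G₁ (-x)) =O[𝓝 0] fun x => x ^ K)
    (h₀ : (fun x => G₀ x + G₀ (-x)) =O[𝓝 0] fun x => x ^ (K - 3 + 1)) :
    ¬ IsCenter (cubicField a c 1 b d e) (0, 0) := by
  obtain ⟨ω, hω, hω2⟩ : ∃ ω : ℝ, 0 < ω ∧ ω ^ 2 = 8 - a ^ 2 :=
    ⟨Real.sqrt (8 - a ^ 2), Real.sqrt_pos.2 (by linarith), Real.sq_sqrt (by linarith)⟩
  obtain ⟨p₀, p₁, p₂, p₃, a0, a1, a2, a3, e0, e1, e2, e3, hexp⟩ := h.exists_expansion hG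
  obtain ⟨C⟩ := h.exists_focusChart hω a0 a1 a2 a3 hexp
  have neg : ∀ {p : ℝ → ℝ}, AnalyticAt ℝ p 0 → AnalyticAt ℝ (fun x => p (-x)) 0 := fun {p} hp =>
    AnalyticAt.fun_comp (f := fun x => -x) (by simpa using hp) analyticAt_id.neg
  have b0 := neg a0
  have b1 := neg a1
  have b2 := neg a2
  have b3 := neg a3
  have o0 : (fun x => p₀ x + p₀ (-x)) =O[𝓝 0] fun x => x ^ K := by
    refine isBigO_of_mul_isBigO (a0.add b0).continuousAt (h₃.congr_left fun x => ?_)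
    rw [e0, e0]; ring
  have o1 : (fun x => x * (p₁ x + p₁ (-x)) - W * x ^ K) =O[𝓝 0] fun x => x ^ (K + 1) := by
    refine h₂.congr_left fun x => ?_
    rw [e1, e1]; ring
  have o2 : (fun x => p₂ x - p₂ (-x)) =O[𝓝 0] fun x => x ^ (K - 1) := by
    refine isBigO_of_mul_isBigO (a2.sub b2).continuousAt ?_
    rw [Nat.sub_add_cancel hK]
    refine h₁.congr_left fun x => ?_
    rw [e2, e2]; ring
  have o3 : (fun x => p₃ x - p₃ (-x)) =O[𝓝 0] fun x => x ^ (K - 3) := by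
    refine isBigO_of_mul_isBigO (a3.sub b3).continuousAt (h₀.congr_left fun x => ?_)
    rw [e3, e3]; ring
  have eN : (fun ξ η => (-ξ) ^ 3 * p₀ (-ξ) + (-ξ) * p₁ (-ξ) * η + p₂ (-ξ) * η ^ 2 + p₃ (-ξ) * η ^ 3) =
      fun ξ η => ξ ^ 3 * (-p₀ (-ξ)) + ξ * (-p₁ (-ξ)) * η + p₂ (-ξ) * η ^ 2 + p₃ (-ξ) * η ^ 3 := by
    funext ξ η; ring
  rcases lt_or_gt_of_ne hW with hneg | hpos
  · have hT := hasTurnExpansion_of_isBigO (p₀ := p₀) (p₁ := p₁) (p₂ := p₂) (p₃ := p₃) (q₀ := fun x => -p₀ (-x)) (q₁ := fun x => -p₁ (-x))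
      (q₂ := fun x => p₂ (-x)) (q₃ := fun x => p₃ (-x)) (W := -W) hK b0.neg.contDiffAt
      b1.neg.contDiffAt b2.contDiffAt b3.contDiffAt
      (o0.neg_left.congr_left fun x => by ring) (o1.neg_left.congr_left fun x => by ring)
      (o2.neg_left.congr_left fun x => by ring) (o3.neg_left.congr_left fun x => by ring)
    rw [← eN] at hT
    exact C.not_isCenter hω hω2 (by norm_num) (by linarith) hT
  · intro hcen
    have hT := hasTurnExpansion_of_isBigO (p₀ := fun x => -p₀ (-x)) (p₁ := fun x => -p₁ (-x))
      (p₂ := fun x => p₂ (-x)) (p₃ := fun x => p₃ (-x)) (q₀ := p₀) (q₁ := p₁) (q₂ := p₂) (q₃ := p₃) (W := W) hK a0.contDiffAt a1.contDiffAt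
      a2.contDiffAt a3.contDiffAt
      (o0.congr_left fun x => by ring) (o1.congr_left fun x => by ring)
      o2 o3
    rw [← eN] at hT
    have hY : ∀ q, cubicField a (-c) 1 (-b) d (-e) q =
        ((cubicField a c 1 b d e (-q.1, q.2)).1, -(cubicField a c 1 b d e (-q.1, q.2)).2) := by
      intro q
      simp only [cubicField]
      ext
      · rfl
      · simp only; ring
    refine (C.mirror hY).not_isCenter (K := K) (W := W) hω hω2 (by norm_num) hpos ?_ hcen.cubicField_mirror
    simp only [neg_neg]
    exact hT
end

/-- The odd part, doubled. -/
def jetOdd : List ℝ → List ℝ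
  | [] => []
  | [_] => [0]
  | _ :: b :: l => 0 :: 2 * b :: jetOdd l

/-- The even part, doubled. -/
def jetEven : List ℝ → List ℝ
  | [] => []
  | [a] => [2 * a]
  | a :: _ :: l => 2 * a :: 0 :: jetEven l

theorem jetEval_jetOdd : ∀ (l : List ℝ) (x : ℝ), jetEval (jetOdd l) x = jetEval l x - jetEval l (-x)
  | [], x => by simp [jetOdd, jetEval]
  | [_], x => by simp [jetOdd, jetEval]
  | _ :: b :: l, x => by
    simp only [jetOdd, jetEval]
    rw [jetEval_jetOdd l x]; ring

theorem jetEval_jetEven : ∀ (l : List ℝ) (x : ℝ),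
    jetEval (jetEven l) x = jetEval l x + jetEval l (-x)
  | [], x => by simp [jetEven, jetEval]
  | [a], x => by simp [jetEven, jetEval]; ring
  | a :: b :: l, x => by
    simp only [jetEven, jetEval]
    rw [jetEval_jetEven l x]; ring

theorem length_jetOdd : ∀ l : List ℝ, (jetOdd l).length = l.length
  | [] => rfl
  | [_] => rfl
  | _ :: _ :: l => by simp [jetOdd, length_jetOdd l]

theorem length_jetEven : ∀ l : List ℝ, (jetEven l).length = l.length
  | [] => rfl
  | [_] => rfl
  | _ :: _ :: l => by simp [jetEven, length_jetEven l]

section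

variable {l : List ℝ} {f : ℝ → ℝ}

theorem HasJet.odd (h : HasJet l f) : HasJet (jetOdd l) (fun x => f x - f (-x)) := by
  have h2 := h.comp_neg
  rw [HasJet, length_jetNeg] at h2
  rw [HasJet, length_jetOdd]
  refine (Asymptotics.IsBigO.sub h h2).congr_left fun x => ?_
  rw [jetEval_jetOdd, jetEval_jetNeg]; ring

theorem HasJet.even (h : HasJet l f) : HasJet (jetEven l) (fun x => f x + f (-x)) := by
  have h2 := h.comp_neg
  rw [HasJet, length_jetNeg] at h2
  rw [HasJet, length_jetEven]
  refine (Asymptotics.IsBigO.add h h2).congr_left fun x => ?_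
  rw [jetEval_jetEven, jetEval_jetNeg]; ring

theorem jetEval_append (l l' : List ℝ) (x : ℝ) :
    jetEval (l ++ l') x = jetEval l x + x ^ l.length * jetEval l' x := by
  induction l with
  | nil => simp [jetEval]
  | cons a l ih => simp only [List.cons_append, jetEval, ih, List.length_cons]; ring

theorem HasJet.take (h : HasJet l f) (k : ℕ) : HasJet (l.take k) f := by
  rw [HasJet, List.length_take]
  have h1 := Asymptotics.IsBigO.trans h (isBigO_pow_of_le (min_le_right k l.length))
  have h2 := isBigO_pow_mul (continuous_jetEval (l.drop k)).continuousAt (min k l.length)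
  refine (h1.add h2).congr_left fun x => ?_
  have := jetEval_append (l.take k) (l.drop k) x
  rw [List.take_append_drop, List.length_take] at this
  rw [this]; ring

theorem HasJet.shift (h : HasJet l f) : HasJet (0 :: l) (fun x => x * f x) := by
  have := (Asymptotics.isBigO_refl (fun x : ℝ => x) (𝓝 0)).mul h
  refine (this.congr_left fun x => ?_).congr_right fun x => ?_
  · simp only [jetEval]; ring
  · rw [List.length_cons, pow_succ]; ring

theorem HasJet.sub_mul_pow {n : ℕ} {c : ℝ} (h : HasJet (List.replicate n 0 ++ [c]) f) :
    (fun x => f x - c * x ^ n) =O[𝓝 0] fun x => x ^ (n + 1) := by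
  rw [HasJet, List.length_append, List.length_replicate] at h
  refine h.congr_left fun x => ?_
  rw [jetEval_append, jetEval_replicate_zero, List.length_replicate]
  simp only [jetEval]; ring

end

set_option linter.unusedSimpArgs false

theorem IsChartCoeff.hasJet_two {a b c d e : ℝ} {f φ' α α' β β' G₃ G₂ G₁ G₀ : ℝ → ℝ}
    (hG : IsChartCoeff a b c d e
      f φ' α α' β β' G₃ G₂ G₁ G₀)
    (hf : HasJet [1, -2 / 5 * c] f)
    (hF : HasJet [1, -4 / 5 * c] φ')
    (hα : HasJet [1, c] α)
    (hα' : HasJet [c] α')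
    (hβ : HasJet [0, e] β)
    (hβ' : HasJet [e] β')
    (hc : ContinuousAt α 0) (h0 : α 0 ≠ 0) :
    HasJet [0, 0] (fun x => G₃ x - G₃ (-x)) ∧
    HasJet [0, 2 * (-1 / 5 * a * c + b)] (fun x => G₂ x - G₂ (-x)) ∧
    HasJet [0] (fun x => G₁ x + G₁ (-x)) ∧
    HasJet [0] (fun x => G₀ x + G₀ (-x)) := by
  have hf2 : HasJet [1, -4 / 5 * c]
      (fun x => f x * f x) := (hf.mul hf).congr (by
    simp only [jetMul, jetOdd, jetEven, List.map_cons,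
      List.map_nil, List.zipWith_cons_cons, List.zipWith_nil_left, List.zipWith_nil_right,
      List.take_succ_cons, List.take_zero, List.cons.injEq, and_true, true_and]
    all_goals (and_intros <;> ring))
  have hf3 : HasJet [1, -6 / 5 * c]
      (fun x => f x * f x * f x) := (hf2.mul hf).congr (by
    simp only [jetMul, jetOdd, jetEven, List.map_cons,
      List.map_nil, List.zipWith_cons_cons, List.zipWith_nil_left, List.zipWith_nil_right,
      List.take_succ_cons, List.take_zero, List.cons.injEq, and_true, true_and]
    all_goals (and_intros <;> ring))
  have hD : HasJet [1, 1 / 5 * c]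
      (fun x => φ' x * α x) := (hF.mul hα).congr (by
    simp only [jetMul, jetOdd, jetEven, List.map_cons,
      List.map_nil, List.zipWith_cons_cons, List.zipWith_nil_left, List.zipWith_nil_right,
      List.take_succ_cons, List.take_zero, List.cons.injEq, and_true, true_and]
    all_goals (and_intros <;> ring))
  have hDα : HasJet [1, 6 / 5 * c]
      (fun x => φ' x * α x * α x) := (hD.mul hα).congr (by
    simp only [jetMul, jetOdd, jetEven, List.map_cons,
      List.map_nil, List.zipWith_cons_cons, List.zipWith_nil_left, List.zipWith_nil_right,
      List.take_succ_cons, List.take_zero, List.cons.injEq, and_true, true_and]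
    all_goals (and_intros <;> ring))
  have hR : HasJet [0, 0]
      (fun x => x * (x * (β x * (f x * f x * f x)))) := (((hβ.mul hf3).shift.shift).take 2).congr (by
    simp only [jetMul, jetOdd, jetEven, List.map_cons,
      List.map_nil, List.zipWith_cons_cons, List.zipWith_nil_left, List.zipWith_nil_right,
      List.take_succ_cons, List.take_zero, List.cons.injEq, and_true, true_and])
  have hM : HasJet [a, -2 / 5 * a * c + b]
      (fun x => a * f x + x * (b * (f x * f x))) := ((hf.const_mul a).add (hf2.const_mul b).shift).congr (by
    simp only [jetMul, jetOdd, jetEven, List.map_cons,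
      List.map_nil, List.zipWith_cons_cons, List.zipWith_nil_left, List.zipWith_nil_right,
      List.take_succ_cons, List.take_zero, List.cons.injEq, and_true, true_and]
    all_goals (and_intros <;> ring))
  have hc1 : HasJet [c, 0] (fun _ => c) :=
    (hasJet_jetEval [c, 0]).congr_fun fun x => by simp [jetEval]
  have he1 : HasJet [e, 0] (fun _ => e) :=
    (hasJet_jetEval [e, 0]).congr_fun fun x => by simp [jetEval]
  have hP : HasJet [c, d]
      (fun x => c + x * (d * f x)) := (hc1.add (hf.const_mul d).shift).congr (by
    simp only [jetMul, jetOdd, jetEven, List.map_cons,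
      List.map_nil, List.zipWith_cons_cons, List.zipWith_nil_left, List.zipWith_nil_right,
      List.take_succ_cons, List.take_zero, List.cons.injEq, and_true, true_and]
    all_goals (and_intros <;> ring))
  have hB : HasJet [0, 0]
      (fun x => x * β x) := (hβ.shift.take 2).congr (by
    simp only [jetMul, jetOdd, jetEven, List.map_cons,
      List.map_nil, List.zipWith_cons_cons, List.zipWith_nil_left, List.zipWith_nil_right,
      List.take_succ_cons, List.take_zero, List.cons.injEq, and_true, true_and])
  have hU₁ : HasJet [c, d]
      (fun x => x * β x * (3 * (x * (x * (β x * (f x * f x * f x)))) + 2 * (a * f x + x * (b * (f x * f x)))) + (c + x * (d * f x))) := ((hB.mul ((hR.const_mul 3).add (hM.const_mul 2))).add hP).congr (by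
    simp only [jetMul, jetOdd, jetEven, List.map_cons,
      List.map_nil, List.zipWith_cons_cons, List.zipWith_nil_left, List.zipWith_nil_right,
      List.take_succ_cons, List.take_zero, List.cons.injEq, and_true, true_and]
    all_goals (and_intros <;> ring))
  have hi : HasJet [1, -c]
      (fun x => (α x)⁻¹) :=
    HasJet.inv (n := 1) hc h0 ((hα.mul (hasJet_jetEval _)).congr (by
    simp only [List.replicate]
    simp only [jetMul, jetOdd, jetEven, List.map_cons,
      List.map_nil, List.zipWith_cons_cons, List.zipWith_nil_left, List.zipWith_nil_right,
      List.take_succ_cons, List.take_zero, List.cons.injEq, and_true, true_and]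
    all_goals (and_intros <;> ring))) rfl
  have hT : HasJet [c]
      (fun x => α' x * (α x)⁻¹) := (hα'.mul hi).congr (by
    simp only [jetMul, jetOdd, jetEven, List.map_cons,
      List.map_nil, List.zipWith_cons_cons, List.zipWith_nil_left, List.zipWith_nil_right,
      List.take_succ_cons, List.take_zero, List.cons.injEq, and_true, true_and]
    all_goals (and_intros <;> ring))
  have hU₀ : HasJet [e, c * e]
      (fun x => β x * (x * β x * (x * (x * (β x * (f x * f x * f x))) + (a * f x + x * (b * (f x * f x)))) + (c + x * (d * f x))) + e) := ((hβ.mul ((hB.mul (hR.add hM)).add hP)).add he1).congr (by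
    simp only [jetMul, jetOdd, jetEven, List.map_cons,
      List.map_nil, List.zipWith_cons_cons, List.zipWith_nil_left, List.zipWith_nil_right,
      List.take_succ_cons, List.take_zero, List.cons.injEq, and_true, true_and]
    all_goals (and_intros <;> ring))
  have hH₀ : HasJet [0]
      (fun x => φ' x * (β x * (x * β x * (x * (x * (β x * (f x * f x * f x))) + (a * f x + x * (b * (f x * f x)))) + (c + x * (d * f x))) + e) + -1 * β' x) := ((hF.mul hU₀).add (hβ'.const_mul (-1))).congr (by
    simp only [jetMul, jetOdd, jetEven, List.map_cons,
      List.map_nil, List.zipWith_cons_cons, List.zipWith_nil_left, List.zipWith_nil_right,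
      List.take_succ_cons, List.take_zero, List.cons.injEq, and_true, true_and]
    all_goals (and_intros <;> ring))
  refine ⟨?_, ?_, ?_, ?_⟩
  · refine HasJet.congr ((hDα.mul hf3).congr_fun (g := G₃) fun x => ?_).odd (by
    simp only [jetMul, jetOdd, jetEven, List.map_cons,
      List.map_nil, List.zipWith_cons_cons, List.zipWith_nil_left, List.zipWith_nil_right,
      List.take_succ_cons, List.take_zero, List.cons.injEq, and_true, true_and]
    all_goals (and_intros <;> ring))
    rw [hG.three]; ring
  · refine HasJet.congr ((hD.mul ((hR.const_mul 3).add hM)).congr_fun (g := G₂) fun x => ?_).odd (by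
    simp only [jetMul, jetOdd, jetEven, List.map_cons,
      List.map_nil, List.zipWith_cons_cons, List.zipWith_nil_left, List.zipWith_nil_right,
      List.take_succ_cons, List.take_zero, List.cons.injEq, and_true, true_and]
    all_goals (and_intros <;> ring))
    rw [hG.two]; ring
  · refine HasJet.congr (((hF.mul hU₁).add (hT.const_mul (-1))).congr_fun (g := G₁) fun x => ?_).even
      (by
    simp only [jetMul, jetOdd, jetEven, List.map_cons,
      List.map_nil, List.zipWith_cons_cons, List.zipWith_nil_left, List.zipWith_nil_right,
      List.take_succ_cons, List.take_zero, List.cons.injEq, and_true, true_and]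
    all_goals (and_intros <;> ring))
    rw [hG.one]; ring
  · refine HasJet.congr (((hH₀.mul hi).take 1).congr_fun (g := G₀) fun x => ?_).even (by
    simp only [jetMul, jetOdd, jetEven, List.map_cons,
      List.map_nil, List.zipWith_cons_cons, List.zipWith_nil_left, List.zipWith_nil_right,
      List.take_succ_cons, List.take_zero, List.cons.injEq, and_true, true_and]
    all_goals (and_intros <;> ring))
    rw [hG.zero]; ring

theorem IsChartCoeff.hasJet_four {a c d e : ℝ} {f φ' α α' β β' G₃ G₂ G₁ G₀ : ℝ → ℝ}
    (hG : IsChartCoeff a (1 / 5 * a * c) c d e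
      f φ' α α' β β' G₃ G₂ G₁ G₀)
    (hf : HasJet [1, -2 / 5 * c, 0, -4 / 21 * a * e + 88 / 2625 * c ^ 3 + 4 / 35 * c * d] f)
    (hF : HasJet [1, -4 / 5 * c, 0, -16 / 21 * a * e + 352 / 2625 * c ^ 3 + 16 / 35 * c * d] φ')
    (hα : HasJet [1, c, 0, 2 / 3 * a * e - 1 / 3 * c ^ 3 - 2 / 5 * c * d] α)
    (hα' : HasJet [c, 0, 2 * a * e - c ^ 3 - 6 / 5 * c * d] α')
    (hβ : HasJet [0, e, 0, 0] β)
    (hβ' : HasJet [e, 0, 0] β')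
    (hc : ContinuousAt α 0) (h0 : α 0 ≠ 0) :
    HasJet [0, 0, 0, 0] (fun x => G₃ x - G₃ (-x)) ∧
    HasJet [0, 0, 0, 2 * (-2 / 7 * a ^ 2 * e - 1 / 175 * a * c ^ 3 + 6 / 35 * a * c * d + 3 * e)] (fun x => G₂ x - G₂ (-x)) ∧
    HasJet [0, 0, 0] (fun x => G₁ x + G₁ (-x)) ∧
    HasJet [0] (fun x => G₀ x + G₀ (-x)) := by
  have hf2 : HasJet [1, -4 / 5 * c, 4 / 25 * c ^ 2, -8 / 21 * a * e + 176 / 2625 * c ^ 3 + 8 / 35 * c * d]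
      (fun x => f x * f x) := (hf.mul hf).congr (by
    simp only [jetMul, jetOdd, jetEven, List.map_cons,
      List.map_nil, List.zipWith_cons_cons, List.zipWith_nil_left, List.zipWith_nil_right,
      List.take_succ_cons, List.take_zero, List.cons.injEq, and_true, true_and]
    all_goals (and_intros <;> ring))
  have hf3 : HasJet [1, -6 / 5 * c, 12 / 25 * c ^ 2, -4 / 7 * a * e + 32 / 875 * c ^ 3 + 12 / 35 * c * d]
      (fun x => f x * f x * f x) := (hf2.mul hf).congr (by
    simp only [jetMul, jetOdd, jetEven, List.map_cons,
      List.map_nil, List.zipWith_cons_cons, List.zipWith_nil_left, List.zipWith_nil_right,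
      List.take_succ_cons, List.take_zero, List.cons.injEq, and_true, true_and]
    all_goals (and_intros <;> ring))
  have hD : HasJet [1, 1 / 5 * c, -4 / 5 * c ^ 2, -2 / 21 * a * e - 523 / 2625 * c ^ 3 + 2 / 35 * c * d]
      (fun x => φ' x * α x) := (hF.mul hα).congr (by
    simp only [jetMul, jetOdd, jetEven, List.map_cons,
      List.map_nil, List.zipWith_cons_cons, List.zipWith_nil_left, List.zipWith_nil_right,
      List.take_succ_cons, List.take_zero, List.cons.injEq, and_true, true_and]
    all_goals (and_intros <;> ring))
  have hDα : HasJet [1, 6 / 5 * c, -3 / 5 * c ^ 2, 4 / 7 * a * e - 1166 / 875 * c ^ 3 - 12 / 35 * c * d]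
      (fun x => φ' x * α x * α x) := (hD.mul hα).congr (by
    simp only [jetMul, jetOdd, jetEven, List.map_cons,
      List.map_nil, List.zipWith_cons_cons, List.zipWith_nil_left, List.zipWith_nil_right,
      List.take_succ_cons, List.take_zero, List.cons.injEq, and_true, true_and]
    all_goals (and_intros <;> ring))
  have hR : HasJet [0, 0, 0, e]
      (fun x => x * (x * (β x * (f x * f x * f x)))) := (((hβ.mul hf3).shift.shift).take 4).congr (by
    simp only [jetMul, jetOdd, jetEven, List.map_cons,
      List.map_nil, List.zipWith_cons_cons, List.zipWith_nil_left, List.zipWith_nil_right,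
      List.take_succ_cons, List.take_zero, List.cons.injEq, and_true, true_and]
    all_goals (and_intros <;> ring))
  have hM : HasJet [a, -1 / 5 * a * c, -4 / 25 * a * c ^ 2, -4 / 21 * a ^ 2 * e + 172 / 2625 * a * c ^ 3 + 4 / 35
    * a * c * d]
      (fun x => a * f x + x * ((1 / 5 * a * c) * (f x * f x))) := ((hf.const_mul a).add (hf2.const_mul (1 / 5 * a * c)).shift).congr (by
    simp only [jetMul, jetOdd, jetEven, List.map_cons,
      List.map_nil, List.zipWith_cons_cons, List.zipWith_nil_left, List.zipWith_nil_right,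
      List.take_succ_cons, List.take_zero, List.cons.injEq, and_true, true_and]
    all_goals (and_intros <;> ring))
  have hc1 : HasJet [c, 0, 0, 0] (fun _ => c) :=
    (hasJet_jetEval [c, 0, 0, 0]).congr_fun fun x => by simp [jetEval]
  have he1 : HasJet [e, 0, 0, 0] (fun _ => e) :=
    (hasJet_jetEval [e, 0, 0, 0]).congr_fun fun x => by simp [jetEval]
  have hP : HasJet [c, d, -2 / 5 * c * d, 0]
      (fun x => c + x * (d * f x)) := (hc1.add (hf.const_mul d).shift).congr (by
    simp only [jetMul, jetOdd, jetEven, List.map_cons,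
      List.map_nil, List.zipWith_cons_cons, List.zipWith_nil_left, List.zipWith_nil_right,
      List.take_succ_cons, List.take_zero, List.cons.injEq, and_true, true_and]
    all_goals (and_intros <;> ring))
  have hB : HasJet [0, 0, e, 0]
      (fun x => x * β x) := (hβ.shift.take 4).congr (by
    simp only [jetMul, jetOdd, jetEven, List.map_cons,
      List.map_nil, List.zipWith_cons_cons, List.zipWith_nil_left, List.zipWith_nil_right,
      List.take_succ_cons, List.take_zero, List.cons.injEq, and_true, true_and])
  have hU₁ : HasJet [c, d, 2 * a * e - 2 / 5 * c * d, -2 / 5 * a * c * e]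
      (fun x => x * β x * (3 * (x * (x * (β x * (f x * f x * f x)))) + 2 * (a * f x + x * ((1 / 5 * a * c) * (f x * f x)))) + (c + x * (d * f x))) := ((hB.mul ((hR.const_mul 3).add (hM.const_mul 2))).add hP).congr (by
    simp only [jetMul, jetOdd, jetEven, List.map_cons,
      List.map_nil, List.zipWith_cons_cons, List.zipWith_nil_left, List.zipWith_nil_right,
      List.take_succ_cons, List.take_zero, List.cons.injEq, and_true, true_and]
    all_goals (and_intros <;> ring))
  have hi : HasJet [1, -c, c ^ 2, -2 / 3 * a * e - 2 / 3 * c ^ 3 + 2 / 5 * c * d]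
      (fun x => (α x)⁻¹) :=
    HasJet.inv (n := 3) hc h0 ((hα.mul (hasJet_jetEval _)).congr (by
    simp only [List.replicate]
    simp only [jetMul, jetOdd, jetEven, List.map_cons,
      List.map_nil, List.zipWith_cons_cons, List.zipWith_nil_left, List.zipWith_nil_right,
      List.take_succ_cons, List.take_zero, List.cons.injEq, and_true, true_and]
    all_goals (and_intros <;> ring))) rfl
  have hT : HasJet [c, -c ^ 2, 2 * a * e - 6 / 5 * c * d]
      (fun x => α' x * (α x)⁻¹) := (hα'.mul hi).congr (by
    simp only [jetMul, jetOdd, jetEven, List.map_cons,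
      List.map_nil, List.zipWith_cons_cons, List.zipWith_nil_left, List.zipWith_nil_right,
      List.take_succ_cons, List.take_zero, List.cons.injEq, and_true, true_and]
    all_goals (and_intros <;> ring))
  have hU₀ : HasJet [e, c * e, d * e, a * e ^ 2 - 2 / 5 * c * d * e]
      (fun x => β x * (x * β x * (x * (x * (β x * (f x * f x * f x))) + (a * f x + x * ((1 / 5 * a * c) * (f x * f x)))) + (c + x * (d * f x))) + e) := ((hβ.mul ((hB.mul (hR.add hM)).add hP)).add he1).congr (by
    simp only [jetMul, jetOdd, jetEven, List.map_cons,
      List.map_nil, List.zipWith_cons_cons, List.zipWith_nil_left, List.zipWith_nil_right,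
      List.take_succ_cons, List.take_zero, List.cons.injEq, and_true, true_and]
    all_goals (and_intros <;> ring))
  have hH₀ : HasJet [0, 1 / 5 * c * e, -4 / 5 * c ^ 2 * e + d * e]
      (fun x => φ' x * (β x * (x * β x * (x * (x * (β x * (f x * f x * f x))) + (a * f x + x * ((1 / 5 * a * c) * (f x * f x)))) + (c + x * (d * f x))) + e) + -1 * β' x) := ((hF.mul hU₀).add (hβ'.const_mul (-1))).congr (by
    simp only [jetMul, jetOdd, jetEven, List.map_cons,
      List.map_nil, List.zipWith_cons_cons, List.zipWith_nil_left, List.zipWith_nil_right,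
      List.take_succ_cons, List.take_zero, List.cons.injEq, and_true, true_and]
    all_goals (and_intros <;> ring))
  refine ⟨?_, ?_, ?_, ?_⟩
  · refine HasJet.congr ((hDα.mul hf3).congr_fun (g := G₃) fun x => ?_).odd (by
    simp only [jetMul, jetOdd, jetEven, List.map_cons,
      List.map_nil, List.zipWith_cons_cons, List.zipWith_nil_left, List.zipWith_nil_right,
      List.take_succ_cons, List.take_zero, List.cons.injEq, and_true, true_and]
    all_goals (and_intros <;> ring))
    rw [hG.three]; ring
  · refine HasJet.congr ((hD.mul ((hR.const_mul 3).add hM)).congr_fun (g := G₂) fun x => ?_).odd (by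
    simp only [jetMul, jetOdd, jetEven, List.map_cons,
      List.map_nil, List.zipWith_cons_cons, List.zipWith_nil_left, List.zipWith_nil_right,
      List.take_succ_cons, List.take_zero, List.cons.injEq, and_true, true_and]
    all_goals (and_intros <;> ring))
    rw [hG.two]; ring
  · refine HasJet.congr (((hF.mul hU₁).add (hT.const_mul (-1))).congr_fun (g := G₁) fun x => ?_).even
      (by
    simp only [jetMul, jetOdd, jetEven, List.map_cons,
      List.map_nil, List.zipWith_cons_cons, List.zipWith_nil_left, List.zipWith_nil_right,
      List.take_succ_cons, List.take_zero, List.cons.injEq, and_true, true_and]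
    all_goals (and_intros <;> ring))
    rw [hG.one]; ring
  · refine HasJet.congr (((hH₀.mul hi).take 1).congr_fun (g := G₀) fun x => ?_).even (by
    simp only [jetMul, jetOdd, jetEven, List.map_cons,
      List.map_nil, List.zipWith_cons_cons, List.zipWith_nil_left, List.zipWith_nil_right,
      List.take_succ_cons, List.take_zero, List.cons.injEq, and_true, true_and]
    all_goals (and_intros <;> ring))
    rw [hG.zero]; ring


set_option linter.unusedSimpArgs false

set_option maxHeartbeats 4000000 in
theorem IsChartCoeff.hasJet_eight {a E : ℝ} {f φ' α α' β β' G₃ G₂ G₁ G₀ : ℝ → ℝ}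
    (hG : IsChartCoeff a (1 / 5 * a) (1) (5 / 3 * a ^ 2 * E - 35 / 2 * E + 1 / 30) (a * E)
      f φ' α α' β β' G₃ G₂ G₁ G₀)
    (hf : HasJet [1, -2 / 5, 0, -2 * E + 14 / 375, 0, -4 / 81 * a ^ 4 * E ^ 2 + 34 / 27 * a ^ 2 * E ^ 2 + 2 /
    135 * a ^ 2 * E - 70 / 9 * E ^ 2 + 188 / 225 * E - 1246 / 253125, 0, 100 / 18711 * a ^ 6 *
    E ^ 3 - 100 / 297 * a ^ 4 * E ^ 3 + 68 / 2673 * a ^ 4 * E ^ 2 + 175 / 33 * a ^ 2 * E ^ 3 -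
    7822 / 14175 * a ^ 2 * E ^ 2 - 92623 / 11694375 * a ^ 2 * E - 2450 / 99 * E ^ 3 + 16114 /
    1485 * E ^ 2 - 126454 / 556875 * E + 1027706 / 1461796875] f)
    (hF : HasJet [1, -4 / 5, 0, -8 * E + 56 / 375, 0, -8 / 27 * a ^ 4 * E ^ 2 + 68 / 9 * a ^ 2 * E ^ 2 + 4 / 45
    * a ^ 2 * E - 140 / 3 * E ^ 2 + 376 / 75 * E - 2492 / 84375, 0, 800 / 18711 * a ^ 6 * E ^ 3
    - 800 / 297 * a ^ 4 * E ^ 3 + 544 / 2673 * a ^ 4 * E ^ 2 + 1400 / 33 * a ^ 2 * E ^ 3 -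
    62576 / 14175 * a ^ 2 * E ^ 2 - 740984 / 11694375 * a ^ 2 * E - 19600 / 99 * E ^ 3 + 128912
    / 1485 * E ^ 2 - 1011632 / 556875 * E + 8221648 / 1461796875] φ')
    (hα : HasJet [1, 1, 0, 7 * E - 26 / 75, 0, 2 / 9 * a ^ 4 * E ^ 2 - 17 / 3 * a ^ 2 * E ^ 2 - 1 / 15 * a ^ 2 *
    E + 35 * E ^ 2 - 193 / 25 * E + 832 / 5625, 0, -50 / 1701 * a ^ 6 * E ^ 3 + 50 / 27 * a ^ 4
    * E ^ 3 - 1552 / 6075 * a ^ 4 * E ^ 2 - 175 / 6 * a ^ 2 * E ^ 3 + 16958 / 2835 * a ^ 2 * E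
    ^ 2 + 166333 / 2126250 * a ^ 2 * E + 1225 / 9 * E ^ 3 - 13349 / 135 * E ^ 2 + 287921 /
    50625 * E - 1712786 / 26578125] α)
    (hα' : HasJet [1, 0, 21 * E - 26 / 25, 0, 10 / 9 * a ^ 4 * E ^ 2 - 85 / 3 * a ^ 2 * E ^ 2 - 1 / 3 * a ^ 2 * E
    + 175 * E ^ 2 - 193 / 5 * E + 832 / 1125, 0, -50 / 243 * a ^ 6 * E ^ 3 + 350 / 27 * a ^ 4 *
    E ^ 3 - 10864 / 6075 * a ^ 4 * E ^ 2 - 1225 / 6 * a ^ 2 * E ^ 3 + 16958 / 405 * a ^ 2 * E ^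
    2 + 166333 / 303750 * a ^ 2 * E + 8575 / 9 * E ^ 3 - 93443 / 135 * E ^ 2 + 2015447 / 50625
    * E - 1712786 / 3796875] α')
    (hβ : HasJet [0, a * E, 0, 5 / 9 * a ^ 3 * E ^ 2 - 35 / 6 * a * E ^ 2 - 29 / 90 * a * E, 0, 5 / 27 * a ^ 5 *
    E ^ 3 - 35 / 9 * a ^ 3 * E ^ 3 - 133 / 675 * a ^ 3 * E ^ 2 + 245 / 12 * a * E ^ 3 - 217 /
    90 * a * E ^ 2 + 1861 / 13500 * a * E, 0, 0] β)
    (hβ' : HasJet [a * E, 0, 5 / 3 * a ^ 3 * E ^ 2 - 35 / 2 * a * E ^ 2 - 29 / 30 * a * E, 0, 25 / 27 * a ^ 5 * E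
    ^ 3 - 175 / 9 * a ^ 3 * E ^ 3 - 133 / 135 * a ^ 3 * E ^ 2 + 1225 / 12 * a * E ^ 3 - 217 /
    18 * a * E ^ 2 + 1861 / 2700 * a * E, 0, 0] β')
    (hc : ContinuousAt α 0) (h0 : α 0 ≠ 0) :
    HasJet [0, 0, 0, 0, 0, 0, 0, 0] (fun x => G₃ x - G₃ (-x)) ∧
    HasJet [0, 0, 0, 0, 0, 2 * (-10 / 81 * a ^ 5 * E ^ 2 + 130 / 27 * a ^ 3 * E ^ 2 + 1 / 27 * a ^ 3 * E -
      665 / 18 * a * E ^ 2 + 11 / 90 * a * E + 314 / 253125 * a), 0, 2 * (50 / 2673 * a ^ 7 * E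
      ^ 3 - 185 / 297 * a ^ 5 * E ^ 3 + 1652 / 13365 * a ^ 5 * E ^ 2 + 455 / 66 * a ^ 3 * E ^ 3
      - 8783 / 2025 * a ^ 3 * E ^ 2 - 127273 / 3341250 * a ^ 3 * E - 10045 / 396 * a * E ^ 3 +
      114613 / 2970 * a * E ^ 2 - 102701 / 2227500 * a * E - 230792 / 208828125 * a)] (fun x => G₂ x - G₂ (-x)) ∧
    HasJet [0, 0, 0, 0, 0, 0, 0] (fun x => G₁ x + G₁ (-x)) ∧
    HasJet [0, 0, 0, 0, 0] (fun x => G₀ x + G₀ (-x)) := by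
  have hf2 : HasJet [1, -4 / 5, 4 / 25, -4 * E + 28 / 375, 8 / 5 * E - 56 / 1875, -8 / 81 * a ^ 4 * E ^ 2 + 68 / 27
    * a ^ 2 * E ^ 2 + 4 / 135 * a ^ 2 * E - 140 / 9 * E ^ 2 + 376 / 225 * E - 2492 / 253125, 16
    / 405 * a ^ 4 * E ^ 2 - 136 / 135 * a ^ 2 * E ^ 2 - 8 / 675 * a ^ 2 * E + 92 / 9 * E ^ 2 -
    184 / 225 * E + 6748 / 1265625, 200 / 18711 * a ^ 6 * E ^ 3 - 200 / 297 * a ^ 4 * E ^ 3 +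
    136 / 2673 * a ^ 4 * E ^ 2 + 350 / 33 * a ^ 2 * E ^ 3 - 15644 / 14175 * a ^ 2 * E ^ 2 -
    185246 / 11694375 * a ^ 2 * E - 4900 / 99 * E ^ 3 + 32228 / 1485 * E ^ 2 - 252908 / 556875
    * E + 2055412 / 1461796875]
      (fun x => f x * f x) := (hf.mul hf).congr (by
    simp only [jetMul, jetOdd, jetEven, List.map_cons,
      List.map_nil, List.zipWith_cons_cons, List.zipWith_nil_left, List.zipWith_nil_right,
      List.take_succ_cons, List.take_zero, List.cons.injEq, and_true, true_and]
    all_goals (and_intros <;> ring))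
  have hf3 : HasJet [1, -6 / 5, 12 / 25, -6 * E + 6 / 125, 24 / 5 * E - 56 / 625, -4 / 27 * a ^ 4 * E ^ 2 + 34 / 9
    * a ^ 2 * E ^ 2 + 2 / 45 * a ^ 2 * E - 70 / 3 * E ^ 2 + 116 / 75 * E + 266 / 84375, 16 /
    135 * a ^ 4 * E ^ 2 - 136 / 45 * a ^ 2 * E ^ 2 - 8 / 225 * a ^ 2 * E + 92 / 3 * E ^ 2 - 184
    / 75 * E + 6748 / 421875, 100 / 6237 * a ^ 6 * E ^ 3 - 100 / 99 * a ^ 4 * E ^ 3 + 1172 /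
    22275 * a ^ 4 * E ^ 2 + 175 / 11 * a ^ 2 * E ^ 3 - 4966 / 4725 * a ^ 2 * E ^ 2 - 64903 /
    3898125 * a ^ 2 * E - 2450 / 33 * E ^ 3 + 2378 / 99 * E ^ 2 - 18742 / 185625 * E - 938566 /
    487265625]
      (fun x => f x * f x * f x) := (hf2.mul hf).congr (by
    simp only [jetMul, jetOdd, jetEven, List.map_cons,
      List.map_nil, List.zipWith_cons_cons, List.zipWith_nil_left, List.zipWith_nil_right,
      List.take_succ_cons, List.take_zero, List.cons.injEq, and_true, true_and]
    all_goals (and_intros <;> ring))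
  have hD : HasJet [1, 1 / 5, -4 / 5, -E - 74 / 375, -68 / 5 * E + 32 / 75, -2 / 27 * a ^ 4 * E ^ 2 + 17 / 9 * a ^
    2 * E ^ 2 + 1 / 45 * a ^ 2 * E - 35 / 3 * E ^ 2 - 203 / 75 * E + 9988 / 84375, -64 / 135 *
    a ^ 4 * E ^ 2 + 544 / 45 * a ^ 2 * E ^ 2 + 32 / 225 * a ^ 2 * E - 392 / 3 * E ^ 2 + 1876 /
    125 * E - 16844 / 84375, 250 / 18711 * a ^ 6 * E ^ 3 - 250 / 297 * a ^ 4 * E ^ 3 - 3472 /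
    66825 * a ^ 4 * E ^ 2 + 875 / 66 * a ^ 2 * E ^ 3 + 22214 / 14175 * a ^ 2 * E ^ 2 + 69539 /
    4677750 * a ^ 2 * E - 6125 / 99 * E ^ 3 - 17927 / 1485 * E ^ 2 + 2155499 / 556875 * E -
    85981582 / 1461796875]
      (fun x => φ' x * α x) := (hF.mul hα).congr (by
    simp only [jetMul, jetOdd, jetEven, List.map_cons,
      List.map_nil, List.zipWith_cons_cons, List.zipWith_nil_left, List.zipWith_nil_right,
      List.take_succ_cons, List.take_zero, List.cons.injEq, and_true, true_and]
    all_goals (and_intros <;> ring))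
  have hDα : HasJet [1, 6 / 5, -3 / 5, 6 * E - 168 / 125, -66 / 5 * E + 4 / 25, 4 / 27 * a ^ 4 * E ^ 2 - 34 / 9 * a
    ^ 2 * E ^ 2 - 2 / 45 * a ^ 2 * E + 70 / 3 * E ^ 2 - 2222 / 75 * E + 81868 / 84375, -68 /
    135 * a ^ 4 * E ^ 2 + 578 / 45 * a ^ 2 * E ^ 2 + 34 / 225 * a ^ 2 * E - 427 / 3 * E ^ 2 +
    3646 / 375 * E + 1412 / 84375, -100 / 6237 * a ^ 6 * E ^ 3 + 100 / 99 * a ^ 4 * E ^ 3 -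
    21368 / 22275 * a ^ 4 * E ^ 2 - 175 / 11 * a ^ 2 * E ^ 3 + 114208 / 4725 * a ^ 2 * E ^ 2 +
    1125193 / 3898125 * a ^ 2 * E + 2450 / 33 * E ^ 3 - 180586 / 495 * E ^ 2 + 285442 / 7425 *
    E - 287065304 / 487265625]
      (fun x => φ' x * α x * α x) := (hD.mul hα).congr (by
    simp only [jetMul, jetOdd, jetEven, List.map_cons,
      List.map_nil, List.zipWith_cons_cons, List.zipWith_nil_left, List.zipWith_nil_right,
      List.take_succ_cons, List.take_zero, List.cons.injEq, and_true, true_and]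
    all_goals (and_intros <;> ring))
  have hR : HasJet [0, 0, 0, a * E, -6 / 5 * a * E, 5 / 9 * a ^ 3 * E ^ 2 - 35 / 6 * a * E ^ 2 + 71 / 450 * a * E,
    -2 / 3 * a ^ 3 * E ^ 2 + a * E ^ 2 + 163 / 375 * a * E, 5 / 27 * a ^ 5 * E ^ 3 - 35 / 9 * a
    ^ 3 * E ^ 3 + 47 / 675 * a ^ 3 * E ^ 2 + 245 / 12 * a * E ^ 3 - 37 / 90 * a * E ^ 2 - 7183
    / 67500 * a * E]
      (fun x => x * (x * (β x * (f x * f x * f x)))) := (((hβ.mul hf3).shift.shift).take 8).congr (by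
    simp only [jetMul, jetOdd, jetEven, List.map_cons,
      List.map_nil, List.zipWith_cons_cons, List.zipWith_nil_left, List.zipWith_nil_right,
      List.take_succ_cons, List.take_zero, List.cons.injEq, and_true, true_and]
    all_goals (and_intros <;> ring))
  have hM : HasJet [a, -1 / 5 * a, -4 / 25 * a, -2 * a * E + 26 / 375 * a, -4 / 5 * a * E + 28 / 1875 * a, -4 / 81
    * a ^ 5 * E ^ 2 + 34 / 27 * a ^ 3 * E ^ 2 + 2 / 135 * a ^ 3 * E - 70 / 9 * a * E ^ 2 + 52 /
    45 * a * E - 2758 / 253125 * a, -8 / 405 * a ^ 5 * E ^ 2 + 68 / 135 * a ^ 3 * E ^ 2 + 4 /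
    675 * a ^ 3 * E - 28 / 9 * a * E ^ 2 + 376 / 1125 * a * E - 2492 / 1265625 * a, 100 / 18711
    * a ^ 7 * E ^ 3 - 100 / 297 * a ^ 5 * E ^ 3 + 2228 / 66825 * a ^ 5 * E ^ 2 + 175 / 33 * a ^
    3 * E ^ 3 - 10678 / 14175 * a ^ 3 * E ^ 2 - 120343 / 11694375 * a ^ 3 * E - 2450 / 99 * a *
    E ^ 3 + 3830 / 297 * a * E ^ 2 - 217534 / 556875 * a * E + 2586494 / 1461796875 * a]
      (fun x => a * f x + x * ((1 / 5 * a) * (f x * f x))) := ((hf.const_mul a).add (hf2.const_mul (1 / 5 * a)).shift).congr (by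
    simp only [jetMul, jetOdd, jetEven, List.map_cons,
      List.map_nil, List.zipWith_cons_cons, List.zipWith_nil_left, List.zipWith_nil_right,
      List.take_succ_cons, List.take_zero, List.cons.injEq, and_true, true_and]
    all_goals (and_intros <;> ring))
  have hc1 : HasJet [1, 0, 0, 0, 0, 0, 0, 0] (fun _ => 1) :=
    (hasJet_jetEval [1, 0, 0, 0, 0, 0, 0, 0]).congr_fun fun x => by simp [jetEval]
  have he1 : HasJet [a * E, 0, 0, 0, 0, 0, 0, 0] (fun _ => a * E) :=
    (hasJet_jetEval [a * E, 0, 0, 0, 0, 0, 0, 0]).congr_fun fun x => by simp [jetEval]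
  have hP : HasJet [1, 5 / 3 * a ^ 2 * E - 35 / 2 * E + 1 / 30, -2 / 3 * a ^ 2 * E + 7 * E - 1 / 75, 0, -10 / 3 *
    a ^ 2 * E ^ 2 + 14 / 225 * a ^ 2 * E + 35 * E ^ 2 - 18 / 25 * E + 7 / 5625, 0, -20 / 243 *
    a ^ 6 * E ^ 3 + 80 / 27 * a ^ 4 * E ^ 3 + 28 / 1215 * a ^ 4 * E ^ 2 - 35 * a ^ 2 * E ^ 3 +
    476 / 405 * a ^ 2 * E ^ 2 - 1171 / 151875 * a ^ 2 * E + 1225 / 9 * E ^ 3 - 2009 / 135 * E ^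
    2 + 5771 / 50625 * E - 623 / 3796875, 0]
      (fun x => 1 + x * ((5 / 3 * a ^ 2 * E - 35 / 2 * E + 1 / 30) * f x)) := (hc1.add (hf.const_mul (5 / 3 * a ^ 2 * E - 35 / 2 * E + 1 / 30)).shift).congr (by
    simp only [jetMul, jetOdd, jetEven, List.map_cons,
      List.map_nil, List.zipWith_cons_cons, List.zipWith_nil_left, List.zipWith_nil_right,
      List.take_succ_cons, List.take_zero, List.cons.injEq, and_true, true_and]
    all_goals (and_intros <;> ring))
  have hB : HasJet [0, 0, a * E, 0, 5 / 9 * a ^ 3 * E ^ 2 - 35 / 6 * a * E ^ 2 - 29 / 90 * a * E, 0, 5 / 27 * a ^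
    5 * E ^ 3 - 35 / 9 * a ^ 3 * E ^ 3 - 133 / 675 * a ^ 3 * E ^ 2 + 245 / 12 * a * E ^ 3 - 217
    / 90 * a * E ^ 2 + 1861 / 13500 * a * E, 0]
      (fun x => x * β x) := (hβ.shift.take 8).congr (by
    simp only [jetMul, jetOdd, jetEven, List.map_cons,
      List.map_nil, List.zipWith_cons_cons, List.zipWith_nil_left, List.zipWith_nil_right,
      List.take_succ_cons, List.take_zero, List.cons.injEq, and_true, true_and])
  have hU₁ : HasJet [1, 5 / 3 * a ^ 2 * E - 35 / 2 * E + 1 / 30, 4 / 3 * a ^ 2 * E + 7 * E - 1 / 75, -2 / 5 * a ^ 2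
    * E, 10 / 9 * a ^ 4 * E ^ 2 - 15 * a ^ 2 * E ^ 2 - 203 / 225 * a ^ 2 * E + 35 * E ^ 2 - 18
    / 25 * E + 7 / 5625, -2 / 9 * a ^ 4 * E ^ 2 + 4 / 3 * a ^ 2 * E ^ 2 + 301 / 1125 * a ^ 2 *
    E, 70 / 243 * a ^ 6 * E ^ 3 - 130 / 27 * a ^ 4 * E ^ 3 - 3334 / 6075 * a ^ 4 * E ^ 2 + 35 /
    6 * a ^ 2 * E ^ 3 - 2827 / 405 * a ^ 2 * E ^ 2 + 24359 / 60750 * a ^ 2 * E + 1225 / 9 * E ^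
    3 - 2009 / 135 * E ^ 2 + 5771 / 50625 * E - 623 / 3796875, -14 / 81 * a ^ 6 * E ^ 3 + 140 /
    27 * a ^ 4 * E ^ 3 + 626 / 3375 * a ^ 4 * E ^ 2 - 637 / 18 * a ^ 2 * E ^ 3 + 734 / 225 * a
    ^ 2 * E ^ 2 - 61567 / 506250 * a ^ 2 * E]
      (fun x => x * β x * (3 * (x * (x * (β x * (f x * f x * f x)))) + 2 * (a * f x + x * ((1 / 5 * a) * (f x * f x)))) + (1 + x * ((5 / 3 * a ^ 2 * E - 35 / 2 * E + 1 / 30) * f x))) := ((hB.mul ((hR.const_mul 3).add (hM.const_mul 2))).add hP).congr (by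
    simp only [jetMul, jetOdd, jetEven, List.map_cons,
      List.map_nil, List.zipWith_cons_cons, List.zipWith_nil_left, List.zipWith_nil_right,
      List.take_succ_cons, List.take_zero, List.cons.injEq, and_true, true_and]
    all_goals (and_intros <;> ring))
  have hi : HasJet [1, -1, 1, -7 * E - 49 / 75, 14 * E + 23 / 75, -2 / 9 * a ^ 4 * E ^ 2 + 17 / 3 * a ^ 2 * E ^ 2
    + 1 / 15 * a ^ 2 * E - 35 * E ^ 2 - 332 / 25 * E - 607 / 5625, 4 / 9 * a ^ 4 * E ^ 2 - 34 /
    3 * a ^ 2 * E ^ 2 - 2 / 15 * a ^ 2 * E + 119 * E ^ 2 + 578 / 75 * E + 11 / 375, 50 / 1701 *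
    a ^ 6 * E ^ 3 - 50 / 27 * a ^ 4 * E ^ 3 - 2498 / 6075 * a ^ 4 * E ^ 2 + 175 / 6 * a ^ 2 * E
    ^ 3 + 31237 / 2835 * a ^ 2 * E ^ 2 + 258917 / 2126250 * a ^ 2 * E - 1225 / 9 * E ^ 3 -
    20671 / 135 * E ^ 2 - 150221 / 50625 * E - 172489 / 26578125]
      (fun x => (α x)⁻¹) :=
    HasJet.inv (n := 7) hc h0 ((hα.mul (hasJet_jetEval _)).congr (by
    simp only [List.replicate]
    simp only [jetMul, jetOdd, jetEven, List.map_cons,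
      List.map_nil, List.zipWith_cons_cons, List.zipWith_nil_left, List.zipWith_nil_right,
      List.take_succ_cons, List.take_zero, List.cons.injEq, and_true, true_and]
    all_goals (and_intros <;> ring))) rfl
  have hT : HasJet [1, -1, 21 * E - 1 / 25, -28 * E + 29 / 75, 10 / 9 * a ^ 4 * E ^ 2 - 85 / 3 * a ^ 2 * E ^ 2 - 1
    / 3 * a ^ 2 * E + 175 * E ^ 2 - 18 / 5 * E + 7 / 1125, -4 / 3 * a ^ 4 * E ^ 2 + 34 * a ^ 2
    * E ^ 2 + 2 / 5 * a ^ 2 * E - 357 * E ^ 2 + 472 / 25 * E - 21 / 125, -50 / 243 * a ^ 6 * E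
    ^ 3 + 350 / 27 * a ^ 4 * E ^ 3 - 1414 / 6075 * a ^ 4 * E ^ 2 - 1225 / 6 * a ^ 2 * E ^ 3 +
    893 / 405 * a ^ 2 * E ^ 2 + 24583 / 303750 * a ^ 2 * E + 8575 / 9 * E ^ 3 - 14063 / 135 * E
    ^ 2 + 40397 / 50625 * E - 4361 / 3796875]
      (fun x => α' x * (α x)⁻¹) := (hα'.mul hi).congr (by
    simp only [jetMul, jetOdd, jetEven, List.map_cons,
      List.map_nil, List.zipWith_cons_cons, List.zipWith_nil_left, List.zipWith_nil_right,
      List.take_succ_cons, List.take_zero, List.cons.injEq, and_true, true_and]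
    all_goals (and_intros <;> ring))
  have hU₀ : HasJet [a * E, a * E, 5 / 3 * a ^ 3 * E ^ 2 - 35 / 2 * a * E ^ 2 + 1 / 30 * a * E, 8 / 9 * a ^ 3 * E ^
    2 + 7 / 6 * a * E ^ 2 - 151 / 450 * a * E, 25 / 27 * a ^ 5 * E ^ 3 - 175 / 9 * a ^ 3 * E ^
    3 - 97 / 135 * a ^ 3 * E ^ 2 + 1225 / 12 * a * E ^ 3 + 49 / 9 * a * E ^ 2 - 29 / 2700 * a *
    E, 25 / 27 * a ^ 5 * E ^ 3 - 100 / 9 * a ^ 3 * E ^ 3 - 494 / 675 * a ^ 3 * E ^ 2 + 175 / 12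
    * a * E ^ 3 - 2389 / 450 * a * E ^ 2 + 9679 / 67500 * a * E, 25 / 81 * a ^ 7 * E ^ 4 - 175
    / 18 * a ^ 5 * E ^ 4 - 49 / 90 * a ^ 5 * E ^ 3 + 1225 / 12 * a ^ 3 * E ^ 4 + 19 / 30 * a ^
    3 * E ^ 3 + 5689 / 13500 * a ^ 3 * E ^ 2 - 8575 / 24 * a * E ^ 4 + 343 / 8 * a * E ^ 3 -
    4487 / 1800 * a * E ^ 2 + 1861 / 405000 * a * E, 115 / 243 * a ^ 7 * E ^ 4 - 250 / 27 * a ^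
    5 * E ^ 4 - 4516 / 6075 * a ^ 5 * E ^ 3 + 455 / 12 * a ^ 3 * E ^ 4 + 2309 / 4050 * a ^ 3 *
    E ^ 3 + 231599 / 607500 * a ^ 3 * E ^ 2 + 2695 / 36 * a * E ^ 4 - 21119 / 540 * a * E ^ 3 +
    270509 / 202500 * a * E ^ 2 - 36497 / 15187500 * a * E]
      (fun x => β x * (x * β x * (x * (x * (β x * (f x * f x * f x))) + (a * f x + x * ((1 / 5 * a) * (f x * f x)))) + (1 + x * ((5 / 3 * a ^ 2 * E - 35 / 2 * E + 1 / 30) * f x))) + a * E) := ((hβ.mul ((hB.mul (hR.add hM)).add hP)).add he1).congr (by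
    simp only [jetMul, jetOdd, jetEven, List.map_cons,
      List.map_nil, List.zipWith_cons_cons, List.zipWith_nil_left, List.zipWith_nil_right,
      List.take_succ_cons, List.take_zero, List.cons.injEq, and_true, true_and]
    all_goals (and_intros <;> ring))
  have hH₀ : HasJet [0, 1 / 5 * a * E, 1 / 5 * a * E, -4 / 9 * a ^ 3 * E ^ 2 + 43 / 6 * a * E ^ 2 - 479 / 2250 * a
    * E, -4 / 9 * a ^ 3 * E ^ 2 + 257 / 30 * a * E ^ 2 - 127 / 450 * a * E, -1 / 9 * a ^ 5 * E
    ^ 3 - 4 / 3 * a ^ 3 * E ^ 3 + 122 / 675 * a ^ 3 * E ^ 2 + 105 / 4 * a * E ^ 3 - 3389 / 450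
    * a * E ^ 2 + 43007 / 337500 * a * E, 25 / 81 * a ^ 7 * E ^ 4 - 175 / 18 * a ^ 5 * E ^ 4 -
    427 / 270 * a ^ 5 * E ^ 3 + 1225 / 12 * a ^ 3 * E ^ 4 + 299 / 30 * a ^ 3 * E ^ 3 + 3317 /
    2700 * a ^ 3 * E ^ 2 - 8575 / 24 * a * E ^ 4 - 595 / 24 * a * E ^ 3 + 28879 / 3000 * a * E
    ^ 2 - 384271 / 2025000 * a * E]
      (fun x => φ' x * (β x * (x * β x * (x * (x * (β x * (f x * f x * f x))) + (a * f x + x * ((1 / 5 * a) * (f x * f x)))) + (1 + x * ((5 / 3 * a ^ 2 * E - 35 / 2 * E + 1 / 30) * f x))) + a * E) + -1 * β' x) := ((hF.mul hU₀).add (hβ'.const_mul (-1))).congr (by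
    simp only [jetMul, jetOdd, jetEven, List.map_cons,
      List.map_nil, List.zipWith_cons_cons, List.zipWith_nil_left, List.zipWith_nil_right,
      List.take_succ_cons, List.take_zero, List.cons.injEq, and_true, true_and]
    all_goals (and_intros <;> ring))
  refine ⟨?_, ?_, ?_, ?_⟩
  · refine HasJet.congr ((hDα.mul hf3).congr_fun (g := G₃) fun x => ?_).odd (by
    simp only [jetMul, jetOdd, jetEven, List.map_cons,
      List.map_nil, List.zipWith_cons_cons, List.zipWith_nil_left, List.zipWith_nil_right,
      List.take_succ_cons, List.take_zero, List.cons.injEq, and_true, true_and]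
    all_goals (and_intros <;> ring))
    rw [hG.three]; ring
  · refine HasJet.congr ((hD.mul ((hR.const_mul 3).add hM)).congr_fun (g := G₂) fun x => ?_).odd (by
    simp only [jetMul, jetOdd, jetEven, List.map_cons,
      List.map_nil, List.zipWith_cons_cons, List.zipWith_nil_left, List.zipWith_nil_right,
      List.take_succ_cons, List.take_zero, List.cons.injEq, and_true, true_and]
    all_goals (and_intros <;> ring))
    rw [hG.two]; ring
  · refine HasJet.congr (((hF.mul hU₁).add (hT.const_mul (-1))).congr_fun (g := G₁) fun x => ?_).even
      (by
    simp only [jetMul, jetOdd, jetEven, List.map_cons,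
      List.map_nil, List.zipWith_cons_cons, List.zipWith_nil_left, List.zipWith_nil_right,
      List.take_succ_cons, List.take_zero, List.cons.injEq, and_true, true_and]
    all_goals (and_intros <;> ring))
    rw [hG.one]; ring
  · refine HasJet.congr (((hH₀.mul hi).take 5).congr_fun (g := G₀) fun x => ?_).even (by
    simp only [jetMul, jetOdd, jetEven, List.map_cons,
      List.map_nil, List.zipWith_cons_cons, List.zipWith_nil_left, List.zipWith_nil_right,
      List.take_succ_cons, List.take_zero, List.cons.injEq, and_true, true_and]
    all_goals (and_intros <;> ring))
    rw [hG.zero]; ring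


theorem ChartData.exists_isChartCoeff {c e : ℝ} {f φ' α α' β β' : ℝ → ℝ}
    (_ : ChartData c e f φ' α α' β β') (a b d : ℝ) :
    ∃ G₃ G₂ G₁ G₀ : ℝ → ℝ, IsChartCoeff a b c d e f φ' α α' β β' G₃ G₂ G₁ G₀ :=
  ⟨_, _, _, _, fun _ => rfl, fun _ => rfl, fun _ => rfl, fun _ => rfl⟩

theorem cubicField_order_one {a b c d e : ℝ} (ha : a ^ 2 < 8)
    (h : IsCenter (cubicField a c 1 b d e)
      (0, 0)) :
    -1 / 5 * a * c + b = 0 := by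
  by_contra hV
  have D := ChartData.of_jetEval (c := c) (e := e)
    (l₂ := [-2 / 5 * c])
    (l₃ := [])
    (l₄ := []) rfl
  obtain ⟨G₃, G₂, G₁, G₀, hG⟩ := D.exists_isChartCoeff a b d
  obtain ⟨j₃, j₂, j₁, j₀⟩ := hG.hasJet_two (hasJet_jetEval _)
    ((hasJet_jetEval _).congr (by simp only [jetScale, List.cons.injEq, and_true]; push_cast; and_intros <;> first | trivial | ring)) (hasJet_jetEval _)
    ((hasJet_jetEval _).congr (by simp only [jetScale, List.cons.injEq]; push_cast; and_intros <;> first | trivial | ring)) (hasJet_jetEval _)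
    ((hasJet_jetEval _).congr (by simp only [jetScale, List.cons.injEq]; push_cast; and_intros <;> first | trivial | ring))
    D.analytic_scale.continuousAt (by rw [D.scale_zero]; exact one_ne_zero)
  exact D.not_isCenter ha hG (K := 1) (by norm_num) (mul_ne_zero two_ne_zero hV) (j₃.isBigO (n := 2))
    (j₂.sub_mul_pow (n := 1)) (j₁.isBigO (n := 1)) (j₀.isBigO (n := 1)) h

theorem cubicField_order_three {a c d e : ℝ} (ha : a ^ 2 < 8)
    (h : IsCenter (cubicField a c 1 (1 / 5 * a * c) d e)
      (0, 0)) :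
    -2 / 7 * a ^ 2 * e - 1 / 175 * a * c ^ 3 + 6 / 35 * a * c * d + 3 * e = 0 := by
  by_contra hV
  have D := ChartData.of_jetEval (c := c) (e := e)
    (l₂ := [-2 / 5 * c, 0, -4 / 21 * a * e + 88 / 2625 * c ^ 3 + 4 / 35 * c * d])
    (l₃ := [0, 2 / 3 * a * e - 1 / 3 * c ^ 3 - 2 / 5 * c * d])
    (l₄ := [0, 0]) rfl
  obtain ⟨G₃, G₂, G₁, G₀, hG⟩ := D.exists_isChartCoeff a (1 / 5 * a * c) d
  obtain ⟨j₃, j₂, j₁, j₀⟩ := hG.hasJet_four (hasJet_jetEval _)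
    ((hasJet_jetEval _).congr (by simp only [jetScale, List.cons.injEq, and_true]; push_cast; and_intros <;> first | trivial | ring)) (hasJet_jetEval _)
    ((hasJet_jetEval _).congr (by simp only [jetScale, List.cons.injEq]; push_cast; and_intros <;> first | trivial | ring)) (hasJet_jetEval _)
    ((hasJet_jetEval _).congr (by simp only [jetScale, List.cons.injEq]; push_cast; and_intros <;> first | trivial | ring))
    D.analytic_scale.continuousAt (by rw [D.scale_zero]; exact one_ne_zero)
  exact D.not_isCenter ha hG (K := 3) (by norm_num) (mul_ne_zero two_ne_zero hV) (j₃.isBigO (n := 4))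
    (j₂.sub_mul_pow (n := 3)) (j₁.isBigO (n := 3)) (j₀.isBigO (n := 1)) h

theorem cubicField_order_five {a E : ℝ} (ha : a ^ 2 < 8)
    (h : IsCenter (cubicField a 1 1 (1 / 5 * a) (5 / 3 * a ^ 2 * E - 35 / 2 * E + 1 / 30) (a * E))
      (0, 0)) :
    -10 / 81 * a ^ 5 * E ^ 2 + 130 / 27 * a ^ 3 * E ^ 2 + 1 / 27 * a ^ 3 * E - 665 / 18 * a * E ^ 2
      + 11 / 90 * a * E + 314 / 253125 * a = 0 := by
  by_contra hV
  have D := ChartData.of_jetEval (c := 1) (e := a * E)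
    (l₂ := [-2 / 5, 0, -2 * E + 14 / 375, 0, -4 / 81 * a ^ 4 * E ^ 2 + 34 / 27 * a ^ 2 * E ^ 2 + 2 / 135 *
      a ^ 2 * E - 70 / 9 * E ^ 2 + 188 / 225 * E - 1246 / 253125, 0, 100 / 18711 * a ^ 6 * E ^
      3 - 100 / 297 * a ^ 4 * E ^ 3 + 68 / 2673 * a ^ 4 * E ^ 2 + 175 / 33 * a ^ 2 * E ^ 3 -
      7822 / 14175 * a ^ 2 * E ^ 2 - 92623 / 11694375 * a ^ 2 * E - 2450 / 99 * E ^ 3 + 16114 /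
      1485 * E ^ 2 - 126454 / 556875 * E + 1027706 / 1461796875])
    (l₃ := [0, 7 * E - 26 / 75, 0, 2 / 9 * a ^ 4 * E ^ 2 - 17 / 3 * a ^ 2 * E ^ 2 - 1 / 15 * a ^ 2 * E +
      35 * E ^ 2 - 193 / 25 * E + 832 / 5625, 0, -50 / 1701 * a ^ 6 * E ^ 3 + 50 / 27 * a ^ 4 *
      E ^ 3 - 1552 / 6075 * a ^ 4 * E ^ 2 - 175 / 6 * a ^ 2 * E ^ 3 + 16958 / 2835 * a ^ 2 * E
      ^ 2 + 166333 / 2126250 * a ^ 2 * E + 1225 / 9 * E ^ 3 - 13349 / 135 * E ^ 2 + 287921 /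
      50625 * E - 1712786 / 26578125])
    (l₄ := [0, 5 / 9 * a ^ 3 * E ^ 2 - 35 / 6 * a * E ^ 2 - 29 / 90 * a * E, 0, 5 / 27 * a ^ 5 * E ^ 3 -
      35 / 9 * a ^ 3 * E ^ 3 - 133 / 675 * a ^ 3 * E ^ 2 + 245 / 12 * a * E ^ 3 - 217 / 90 * a
      * E ^ 2 + 1861 / 13500 * a * E, 0, 0]) rfl
  obtain ⟨G₃, G₂, G₁, G₀, hG⟩ := D.exists_isChartCoeff a (1 / 5 * a) (5 / 3 * a ^ 2 * E - 35 / 2 * E + 1 / 30)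
  obtain ⟨j₃, j₂, j₁, j₀⟩ := hG.hasJet_eight (hasJet_jetEval _)
    ((hasJet_jetEval _).congr (by simp only [jetScale, List.cons.injEq, and_true]; push_cast; and_intros <;> first | trivial | ring)) (hasJet_jetEval _)
    ((hasJet_jetEval _).congr (by simp only [jetScale, List.cons.injEq]; push_cast; and_intros <;> first | trivial | ring)) (hasJet_jetEval _)
    ((hasJet_jetEval _).congr (by simp only [jetScale, List.cons.injEq]; push_cast; and_intros <;> first | trivial | ring))
    D.analytic_scale.continuousAt (by rw [D.scale_zero]; exact one_ne_zero)
  exact D.not_isCenter ha hG (K := 5) (by norm_num) (mul_ne_zero two_ne_zero hV)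
    ((j₃.take 6).isBigO (n := 6)) ((j₂.take 6).sub_mul_pow (n := 5)) ((j₁.take 5).isBigO (n := 5))
    ((j₀.take 3).isBigO (n := 3)) h

theorem cubicField_order_seven {a E : ℝ} (ha : a ^ 2 < 8)
    (h : IsCenter (cubicField a 1 1 (1 / 5 * a) (5 / 3 * a ^ 2 * E - 35 / 2 * E + 1 / 30) (a * E))
      (0, 0))
    (hz : -10 / 81 * a ^ 5 * E ^ 2 + 130 / 27 * a ^ 3 * E ^ 2 + 1 / 27 * a ^ 3 * E - 665 / 18 * a * E ^ 2
      + 11 / 90 * a * E + 314 / 253125 * a = 0) :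
    50 / 2673 * a ^ 7 * E ^ 3 - 185 / 297 * a ^ 5 * E ^ 3 + 1652 / 13365 * a ^ 5 * E ^ 2 + 455 / 66
      * a ^ 3 * E ^ 3 - 8783 / 2025 * a ^ 3 * E ^ 2 - 127273 / 3341250 * a ^ 3 * E - 10045 /
      396 * a * E ^ 3 + 114613 / 2970 * a * E ^ 2 - 102701 / 2227500 * a * E - 230792 /
      208828125 * a = 0 := by
  by_contra hV
  have D := ChartData.of_jetEval (c := 1) (e := a * E)
    (l₂ := [-2 / 5, 0, -2 * E + 14 / 375, 0, -4 / 81 * a ^ 4 * E ^ 2 + 34 / 27 * a ^ 2 * E ^ 2 + 2 / 135 *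
      a ^ 2 * E - 70 / 9 * E ^ 2 + 188 / 225 * E - 1246 / 253125, 0, 100 / 18711 * a ^ 6 * E ^
      3 - 100 / 297 * a ^ 4 * E ^ 3 + 68 / 2673 * a ^ 4 * E ^ 2 + 175 / 33 * a ^ 2 * E ^ 3 -
      7822 / 14175 * a ^ 2 * E ^ 2 - 92623 / 11694375 * a ^ 2 * E - 2450 / 99 * E ^ 3 + 16114 /
      1485 * E ^ 2 - 126454 / 556875 * E + 1027706 / 1461796875])
    (l₃ := [0, 7 * E - 26 / 75, 0, 2 / 9 * a ^ 4 * E ^ 2 - 17 / 3 * a ^ 2 * E ^ 2 - 1 / 15 * a ^ 2 * E +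
      35 * E ^ 2 - 193 / 25 * E + 832 / 5625, 0, -50 / 1701 * a ^ 6 * E ^ 3 + 50 / 27 * a ^ 4 *
      E ^ 3 - 1552 / 6075 * a ^ 4 * E ^ 2 - 175 / 6 * a ^ 2 * E ^ 3 + 16958 / 2835 * a ^ 2 * E
      ^ 2 + 166333 / 2126250 * a ^ 2 * E + 1225 / 9 * E ^ 3 - 13349 / 135 * E ^ 2 + 287921 /
      50625 * E - 1712786 / 26578125])
    (l₄ := [0, 5 / 9 * a ^ 3 * E ^ 2 - 35 / 6 * a * E ^ 2 - 29 / 90 * a * E, 0, 5 / 27 * a ^ 5 * E ^ 3 -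
      35 / 9 * a ^ 3 * E ^ 3 - 133 / 675 * a ^ 3 * E ^ 2 + 245 / 12 * a * E ^ 3 - 217 / 90 * a
      * E ^ 2 + 1861 / 13500 * a * E, 0, 0]) rfl
  obtain ⟨G₃, G₂, G₁, G₀, hG⟩ := D.exists_isChartCoeff a (1 / 5 * a) (5 / 3 * a ^ 2 * E - 35 / 2 * E + 1 / 30)
  obtain ⟨j₃, j₂, j₁, j₀⟩ := hG.hasJet_eight (hasJet_jetEval _)
    ((hasJet_jetEval _).congr (by simp only [jetScale, List.cons.injEq, and_true]; push_cast; and_intros <;> first | trivial | ring)) (hasJet_jetEval _)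
    ((hasJet_jetEval _).congr (by simp only [jetScale, List.cons.injEq]; push_cast; and_intros <;> first | trivial | ring)) (hasJet_jetEval _)
    ((hasJet_jetEval _).congr (by simp only [jetScale, List.cons.injEq]; push_cast; and_intros <;> first | trivial | ring))
    D.analytic_scale.continuousAt (by rw [D.scale_zero]; exact one_ne_zero)
  rw [hz, mul_zero] at j₂
  exact D.not_isCenter ha hG (K := 7) (by norm_num) (mul_ne_zero two_ne_zero hV)
    (j₃.isBigO (n := 8)) (j₂.sub_mul_pow (n := 7)) (j₁.isBigO (n := 7)) (j₀.isBigO (n := 5)) h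

/-- The last two obstructions have no common zero. -/
theorem obstructions_ne_zero {A E : ℝ} (hA : 0 ≤ A) (hA8 : A < 8)
    (h₅ : -10 / 81 * A ^ 2 * E ^ 2 + 130 / 27 * A * E ^ 2 + 1 / 27 * A * E - 665 / 18 * E ^ 2 + 11 / 90 *
      E + 314 / 253125 = 0) :
    50 / 2673 * A ^ 3 * E ^ 3 - 185 / 297 * A ^ 2 * E ^ 3 + 1652 / 13365 * A ^ 2 * E ^ 2 + 455 / 66
      * A * E ^ 3 - 8783 / 2025 * A * E ^ 2 - 127273 / 3341250 * A * E - 10045 / 396 * E ^ 3 +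
      114613 / 2970 * E ^ 2 - 102701 / 2227500 * E - 230792 / 208828125 ≠ 0 := by
  intro h₇
  have h8 : 0 < 8 - A := by linarith
  have hpos : 0 < 13712519108016583911 / 32768 * A ^ 0 * (8 - A) ^ 6 + 22124991185964148401 / 16384 * A ^ 1 * (8
      - A) ^ 5 + 61943930478203242977 / 32768 * A ^ 2 * (8 - A) ^ 4 + 11913458526194815215 /
      8192 * A ^ 3 * (8 - A) ^ 3 + 19457657441261583417 / 32768 * A ^ 4 * (8 - A) ^ 2 +
      1748159056310503329 / 16384 * A ^ 5 * (8 - A) ^ 1 + 204912909948478815 / 32768 * A ^ 6 *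
      (8 - A) ^ 0 := by
    positivity
  refine hpos.ne' ?_
  linear_combination 506250 * ((8000000000 * A ^ 8 + 1974810000000 * A ^ 7 - 184417893000000 * A ^ 6 + 6324856555500000 * A ^
      5 - 118114961298750000 * A ^ 4 + 1368405748884375000 * A ^ 3 - 10158739625967187500 * A ^
      2 + 45065435121139781250 * A - 90653683763304703125) * E ^ 2 + (51070800000 * A ^ 7 +
      13084331400000 * A ^ 6 - 1252313124660000 * A ^ 5 + 42455614498470000 * A ^ 4 -
      740638467512505000 * A ^ 3 + 7571612365328857500 * A ^ 2 - 46665458581270983750 * A +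
      138125552310938863125) * E + (-28597985600 * A ^ 6 - 3668426736480 * A ^ 5 +
      194814824916384 * A ^ 4 - 2702196777003264 * A ^ 3 + 17467988994822708 * A ^ 2 -
      16201707129086778 * A - 489065114082230154)) * h₅
    + 835312500 * ((32000000 * A ^ 7 + 7716840000 * A ^ 6 - 790988760000 * A ^ 5 + 27291892410000 * A ^ 4 -
      469082147220000 * A ^ 3 + 4718907722227500 * A ^ 2 - 28460158496437500 * A +
      80019511800361875) * E + (-16772800 * A ^ 6 - 2162705760 * A ^ 5 + 108517877280 * A ^ 4 -
      1298758842720 * A ^ 3 + 5602632926940 * A ^ 2 + 30168355271310 * A - 451524581124750)) * h₇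


theorem IsCenter.cubicField_dilate {a c A b d e : ℝ} {r : ℝ} (hr : r ≠ 0)
    (h : IsCenter (cubicField a c A b d e) (0, 0)) :
    IsCenter (cubicField a (c / r) A (b / r) (d / r ^ 2) (e / r ^ 3)) (0, 0) := by
  refine h.conj (scaleEquiv r (r ^ 2) hr (pow_ne_zero 2 hr)) (τ := r) hr fun q => ?_
  simp only [scaleEquiv_apply, cubicField, Prod.smul_mk, smul_eq_mul]
  ext
  · ring
  · field_simp

theorem IsCenter.eq_zero_of_normalized {a c b d e : ℝ} (ha : a ^ 2 < 8)
    (h : IsCenter (cubicField a c 1 b d e) (0, 0)) : a * c = 0 ∧ b = 0 ∧ e = 0 := by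
  have h1 := cubicField_order_one ha h
  have hb : b = 1 / 5 * a * c := by linarith
  subst hb
  have h3 := cubicField_order_three ha h
  by_cases hac : a * c = 0
  · refine ⟨hac, by rw [mul_assoc, hac, mul_zero], ?_⟩
    have : e * (3 - 2 / 7 * a ^ 2) = 0 := by
      linear_combination h3 + (1 / 175 * c ^ 2 - 6 / 35 * d) * hac
    rcases mul_eq_zero.1 this with h | h
    · exact h
    · nlinarith
  · exfalso
    have ha0 : a ≠ 0 := left_ne_zero_of_mul hac
    have hc0 : c ≠ 0 := right_ne_zero_of_mul hac
    have hn := h.cubicField_dilate hc0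
    obtain ⟨E, hE⟩ : ∃ E, E = e / c ^ 3 / a := ⟨_, rfl⟩
    have e1 : c / c = 1 := div_self hc0
    have e2 : 1 / 5 * a * c / c = 1 / 5 * a := by field_simp
    have e3 : e / c ^ 3 = a * E := by rw [hE]; field_simp
    have e4 : d / c ^ 2 = 5 / 3 * a ^ 2 * E - 35 / 2 * E + 1 / 30 := by
      have he : e = a * E * c ^ 3 := by rw [← e3]; field_simp
      rw [he] at h3
      rw [div_eq_iff (pow_ne_zero 2 hc0)]
      have : a * c * (d - (5 / 3 * a ^ 2 * E - 35 / 2 * E + 1 / 30) * c ^ 2) = 0 := by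
        linear_combination 35 / 6 * h3
      linarith [(mul_eq_zero.1 this).resolve_left hac]
    rw [e1, e2, e3, e4] at hn
    have h5 := cubicField_order_five ha hn
    have h7 := cubicField_order_seven ha hn h5
    refine obstructions_ne_zero (A := a ^ 2) (E := E) (sq_nonneg a) ha ?_ ?_
    · refine (mul_eq_zero.1 (?_ : a * _ = 0)).resolve_left ha0
      linear_combination h5
    · refine (mul_eq_zero.1 (?_ : a * _ = 0)).resolve_left ha0
      linear_combination h7

theorem IsCenter.eq_zero {a c A b d e : ℝ} (h : IsCenter (cubicField a c A b d e) (0, 0)) :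
    a * c = 0 ∧ b = 0 ∧ e = 0 := by
  obtain ⟨hA, ha⟩ := (h.isMonodromic (cubicField_contDiff a c A b d e)).pos_and_discrim_neg
  have hs : 0 < Real.sqrt A := Real.sqrt_pos.2 hA
  have hs2 : Real.sqrt A ^ 2 = A := Real.sq_sqrt hA.le
  have hn := h.cubicField_scale hs.ne'
  rw [hs2, div_self hA.ne'] at hn
  obtain ⟨h1, h2, h3⟩ := hn.eq_zero_of_normalized (by rw [div_pow, hs2, div_lt_iff₀ hA]; linarith)
  refine ⟨?_, ?_, ?_⟩
  · rw [div_mul_eq_mul_div, div_eq_zero_iff] at h1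
    exact h1.resolve_right hs.ne'
  · exact (div_eq_zero_iff.1 h2).resolve_right hs.ne'
  · exact (mul_eq_zero.1 h3).resolve_right hs.ne'

/-! ### Reversible systems -/

/-- An integral curve of a reversible field that meets the fixed set of the reversor is symmetric. -/
theorem reflect_integralCurve {Y : ℝ × ℝ → ℝ × ℝ} {K : NNReal} (hY : LipschitzWith K Y)
    (S : (ℝ × ℝ) →L[ℝ] (ℝ × ℝ)) (hS : ∀ q, Y (S q) = -S (Y q)) {γ : ℝ → ℝ × ℝ}
    (hγ : ∀ t, HasDerivAt γ (Y (γ t)) t) {s : ℝ} (hs : S (γ s) = γ s) (t : ℝ) :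
    γ (2 * s - t) = S (γ t) := by
  have h1 : ∀ t, HasDerivAt (fun t => S (γ (2 * s - t))) (Y (S (γ (2 * s - t)))) t := fun t =>
    (S.hasFDerivAt.comp_hasDerivAt t ((hγ (2 * s - t)).comp_const_sub (2 * s) t)).congr_deriv (by
      rw [hS, map_neg])
  have h2 := hY.eq_of_integralCurves h1 hγ (t₀ := s) (by
    rw [show 2 * s - s = s by ring, hs])
  have h3 := congrFun h2 (2 * s - t)
  rw [← h3, sub_sub_cancel]

/-- An integral curve of a reversible field that meets the fixed set of the reversor twice is
periodic, and it stays in every invariant set that contains the arc between the two points. -/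
theorem periodic_of_reversible {Y : ℝ × ℝ → ℝ × ℝ} {K : NNReal} (hY : LipschitzWith K Y)
    (S : (ℝ × ℝ) →L[ℝ] (ℝ × ℝ)) (hS : ∀ q, Y (S q) = -S (Y q)) {γ : ℝ → ℝ × ℝ}
    (hγ : ∀ t, HasDerivAt γ (Y (γ t)) t) {s₁ s₂ : ℝ} (hlt : s₁ < s₂) (h₁ : S (γ s₁) = γ s₁)
    (h₂ : S (γ s₂) = γ s₂) {D : Set (ℝ × ℝ)} (hSD : ∀ q ∈ D, S q ∈ D)
    (hD : ∀ t ∈ Set.Icc s₁ s₂, γ t ∈ D) :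
    Function.Periodic γ (2 * (s₂ - s₁)) ∧ ∀ t, γ t ∈ D := by
  have r₁ := reflect_integralCurve hY S hS hγ h₁
  have r₂ := reflect_integralCurve hY S hS hγ h₂
  have hper : Function.Periodic γ (2 * (s₂ - s₁)) := fun t => by
    rw [show t + 2 * (s₂ - s₁) = 2 * s₂ - (2 * s₁ - t) by ring, r₂, ← r₁, sub_sub_cancel]
  refine ⟨hper, fun t => ?_⟩
  obtain ⟨u, hu, hut⟩ := hper.exists_mem_Ico (by linarith : 0 < 2 * (s₂ - s₁)) t (2 * s₁ - s₂)
  rw [hut]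
  rcases le_total u s₁ with h | h
  · rw [show u = 2 * s₁ - (2 * s₁ - u) by ring, r₁]
    exact hSD _ (hD _ ⟨by linarith, by linarith [hu.1]⟩)
  · exact hD _ ⟨h, by linarith [hu.2]⟩

section

variable {X : ℝ × ℝ → ℝ × ℝ} {a ω m₀ : ℝ} {N : ℝ → ℝ → ℝ}

/-- A chart only depends on the field near the origin. -/
noncomputable def FocusChart.congr {Y : ℝ × ℝ → ℝ × ℝ} (C : FocusChart X a ω m₀ N)
    (h : ∀ q ∈ C.dom, Y q = X q) : FocusChart Y a ω m₀ N where
  __ := C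
  deriv_fst γ t ht hγ := C.deriv_fst γ t ht (h _ ht ▸ hγ)
  deriv_snd γ t ht hγ := C.deriv_snd γ t ht (h _ ht ▸ hγ)

/-- From every point near the origin the flow reaches the second coordinate axis. -/
theorem FocusChart.exists_half_turn (C : FocusChart X a ω m₀ N) (hω : 0 < ω)
    (hω2 : ω ^ 2 = 8 - a ^ 2) (hm : 0 < m₀) {γ : ℝ → ℝ × ℝ}
    (hγ : ∀ t, HasDerivAt γ (X (γ t)) t) (hne : ∀ t, γ t ≠ 0) {s : ℝ} (h0 : γ s ∈ C.dom)
    (hρ : turnConst a ω * ‖focusCoord a ω (C.fst (γ s)) (C.snd (γ s))‖ ≤ C.radius) :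
    ∃ T > s, (∀ t ∈ Set.Icc s T, γ t ∈ C.dom ∧ ‖focusCoord a ω (C.fst (γ t)) (C.snd (γ t))‖ ≤
        turnConst a ω * ‖focusCoord a ω (C.fst (γ s)) (C.snd (γ s))‖) ∧ (γ T).1 = 0 ∧
      ((γ s).1 = 0 → (γ s).2 * (γ T).2 < 0) := by
  have hγ' : ∀ t, HasDerivAt (fun t => γ (t + s)) (X (γ (t + s))) t := fun t =>
    (hγ (t + s)).comp_add_const t s
  have hne' : ∀ t, γ (t + s) ≠ 0 := fun t => hne _
  have hs0 : γ (0 + s) = γ s := by rw [zero_add]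
  have transfer : ∀ T > 0, (∀ t ∈ Set.Icc 0 T, γ (t + s) ∈ C.dom ∧
      ‖focusCoord a ω (C.fst (γ (t + s))) (C.snd (γ (t + s)))‖ ≤
        turnConst a ω * ‖focusCoord a ω (C.fst (γ (0 + s))) (C.snd (γ (0 + s)))‖) →
      C.fst (γ (T + s)) = 0 → (C.fst (γ s) = 0 → C.snd (γ s) * C.snd (γ (T + s)) < 0) →
      ∃ T > s, (∀ t ∈ Set.Icc s T, γ t ∈ C.dom ∧ ‖focusCoord a ω (C.fst (γ t)) (C.snd (γ t))‖ ≤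
        turnConst a ω * ‖focusCoord a ω (C.fst (γ s)) (C.snd (γ s))‖) ∧ (γ T).1 = 0 ∧
      ((γ s).1 = 0 → (γ s).2 * (γ T).2 < 0) := by
    intro T hT h1 h2 h3
    have hTd := (h1 T ⟨hT.le, le_rfl⟩).1
    have hx := C.fst_eq_zero _ hTd h2
    refine ⟨T + s, by linarith, fun t ht => ?_, hx, fun h => ?_⟩
    · have := h1 (t - s) ⟨by linarith [ht.1], by linarith [ht.2]⟩
      rwa [sub_add_cancel, hs0] at this
    · obtain ⟨e1, e2⟩ := C.eq_of_fst _ h0 h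
      have := h3 e1
      rwa [e2, (C.eq_of_fst _ hTd hx).2] at this
  rcases lt_trichotomy (C.fst (γ s)) 0 with h | h | h
  · obtain ⟨T, hT, h1, -, h2, -⟩ := C.exists_left_half_turn hω hω2 hm hγ' hne' (by rwa [hs0])
      (by rw [hs0]; exact Or.inl h) (by rwa [hs0])
    exact transfer T hT h1 h2 fun h' => absurd h' h.ne
  · have hx := C.fst_eq_zero _ h0 h
    rcases lt_trichotomy (C.snd (γ s)) 0 with h' | h' | h'
    · obtain ⟨T, hT, h1, -, h2, h3⟩ := C.exists_right_half_turn hω hω2 hm hγ' hne' (by rwa [hs0])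
        (by rw [hs0]; exact Or.inr ⟨h, h'⟩) (by rwa [hs0])
      exact transfer T hT h1 h2 fun _ => mul_neg_of_neg_of_pos h' h3
    · exact absurd (Prod.ext hx ((C.eq_of_fst _ h0 hx).2 ▸ h')) (hne s)
    · obtain ⟨T, hT, h1, -, h2, h3⟩ := C.exists_left_half_turn hω hω2 hm hγ' hne' (by rwa [hs0])
        (by rw [hs0]; exact Or.inr ⟨h, h'⟩) (by rwa [hs0])
      exact transfer T hT h1 h2 fun _ => mul_neg_of_pos_of_neg h' h3
  · obtain ⟨T, hT, h1, -, h2, -⟩ := C.exists_right_half_turn hω hω2 hm hγ' hne' (by rwa [hs0])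
      (by rw [hs0]; exact Or.inl h) (by rwa [hs0])
    exact transfer T hT h1 h2 fun h' => absurd h' h.ne'

/-- An integral curve that starts near the origin meets the second coordinate axis three times, on
alternating sides of the origin. -/
theorem FocusChart.exists_three_hits (C : FocusChart X a ω m₀ N) (hω : 0 < ω)
    (hω2 : ω ^ 2 = 8 - a ^ 2) (hm : 0 < m₀) {γ : ℝ → ℝ × ℝ}
    (hγ : ∀ t, HasDerivAt γ (X (γ t)) t) (hne : ∀ t, γ t ≠ 0) (h0 : γ 0 ∈ C.dom)
    (hρ : turnConst a ω ^ 3 * ‖focusCoord a ω (C.fst (γ 0)) (C.snd (γ 0))‖ ≤ C.radius) :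
    ∃ T₁ T₂ T₃, T₁ < T₂ ∧ T₂ < T₃ ∧ (∀ t ∈ Set.Icc T₁ T₃, γ t ∈ C.dom) ∧ (γ T₁).1 = 0 ∧
      (γ T₂).1 = 0 ∧ (γ T₁).2 * (γ T₂).2 < 0 ∧ (γ T₂).2 * (γ T₃).2 < 0 := by
  obtain ⟨k, hk⟩ : ∃ k, k = turnConst a ω := ⟨_, rfl⟩
  have hk1 : 1 ≤ k := hk ▸ one_le_turnConst hω a
  obtain ⟨ν, hν⟩ : ∃ ν : ℝ → ℝ, ν = fun t => ‖focusCoord a ω (C.fst (γ t)) (C.snd (γ t))‖ := ⟨_, rfl⟩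
  have hν0 : 0 ≤ ν 0 := by rw [hν]; exact norm_nonneg _
  have turn : ∀ s, γ s ∈ C.dom → k * ν s ≤ C.radius → ∃ T > s, (∀ t ∈ Set.Icc s T, γ t ∈ C.dom ∧
      ν t ≤ k * ν s) ∧ (γ T).1 = 0 ∧ ((γ s).1 = 0 → (γ s).2 * (γ T).2 < 0) := by
    intro s h1 h2
    rw [hν, hk] at h2 ⊢
    exact C.exists_half_turn hω hω2 hm hγ hne h1 h2
  have hρ' : k ^ 3 * ν 0 ≤ C.radius := by rw [hν, hk]; exact hρ
  have p2 : k * (k * ν 0) ≤ k ^ 3 * ν 0 := by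
    nlinarith [mul_nonneg (sq_nonneg k) hν0]
  have p1 : k * ν 0 ≤ k * (k * ν 0) := by nlinarith [mul_nonneg (by linarith : 0 ≤ k) hν0]
  obtain ⟨T₁, hT₁, a1, a2, -⟩ := turn 0 h0 (by linarith)
  have a3 := a1 T₁ ⟨hT₁.le, le_rfl⟩
  have q1 : k * ν T₁ ≤ k * (k * ν 0) := by gcongr; exact a3.2
  obtain ⟨T₂, hT₂, b1, b2, b4⟩ := turn T₁ a3.1 (by linarith)
  have b3 := b1 T₂ ⟨hT₂.le, le_rfl⟩
  have q2 : k * ν T₂ ≤ k * (k * (k * ν 0)) := by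
    gcongr
    exact b3.2.trans q1
  obtain ⟨T₃, hT₃, c1, c2, c4⟩ := turn T₂ b3.1 (by linarith [show k * (k * (k * ν 0)) = k ^ 3 * ν 0 by ring])
  refine ⟨T₁, T₂, T₃, hT₂, hT₃, fun t ht => ?_, a2, b2, b4 a2, c4 b2⟩
  rcases le_total t T₂ with h | h
  · exact (b1 t ⟨ht.1, h⟩).1
  · exact (c1 t ⟨h, ht.2⟩).1

end

theorem exists_eq_zero_of_mul_neg {f : ℝ → ℝ} (hf : Continuous f) {s t : ℝ} (hst : s < t)
    (h : f s * f t < 0) : ∃ u ∈ Set.Ioo s t, f u = 0 := by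
  rcases mul_neg_iff.1 h with ⟨h1, h2⟩ | ⟨h1, h2⟩
  · exact intermediate_value_Ioo' hst.le hf.continuousOn ⟨h2, h1⟩
  · exact intermediate_value_Ioo hst.le hf.continuousOn ⟨h1, h2⟩

theorem abs_le_one_of_mem_ball {q : ℝ × ℝ} (h : q ∈ Metric.ball (0 : ℝ × ℝ) 1) :
    |q.1| ≤ 1 ∧ |q.2| ≤ 1 := by
  rw [mem_ball_zero_iff, Prod.norm_def, max_lt_iff] at h
  exact ⟨h.1.le, h.2.le⟩

/-- The system is time-reversible by `(x, y) ↦ (-x, y)` or by `(x, y) ↦ (x, -y)`, hence a center. -/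
theorem isCenter_cubicField_of_reversible {a c d : ℝ} (ha : a ^ 2 < 8) (hac : a * c = 0) :
    IsCenter (cubicField a c 1 0 d 0) (0, 0) := by
  obtain ⟨ω, hω, hω2⟩ : ∃ ω : ℝ, 0 < ω ∧ ω ^ 2 = 8 - a ^ 2 :=
    ⟨Real.sqrt (8 - a ^ 2), Real.sqrt_pos.2 (by linarith), Real.sq_sqrt (by linarith)⟩
  have D := ChartData.of_jetEval (c := c) (e := 0) (l₂ := []) (l₃ := []) (l₄ := []) rfl
  obtain ⟨G₃, G₂, G₁, G₀, hG⟩ := D.exists_isChartCoeff a 0 d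
  obtain ⟨p₀, p₁, p₂, p₃, a0, a1, a2, a3, -, -, -, -, hexp⟩ := D.exists_expansion hG
  obtain ⟨C₀⟩ := D.exists_focusChart hω a0 a1 a2 a3 hexp
  obtain ⟨X, hX⟩ : ∃ X, X = cubicField a c 1 0 d 0 := ⟨_, rfl⟩
  rw [← hX] at C₀ ⊢
  have hXc : ContDiff ℝ 1 X := hX ▸ cubicField_contDiff a c 1 0 d 0
  obtain ⟨⟨K, hK⟩, -⟩ := lipschitz_comp_clampSquare hXc zero_le_one
  have hclamp : ∀ q ∈ Metric.ball (0 : ℝ × ℝ) 1, (X ∘ clampSquare 1) q = X q := fun q hq => by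
    rw [Function.comp_apply, clampSquare_eq_self (abs_le_one_of_mem_ball hq).1
      (abs_le_one_of_mem_ball hq).2]
  have C := C₀.congr (Y := X ∘ clampSquare 1) fun q hq => hclamp q (C₀.dom_subset hq)
  have hm : ∀ x : ℝ, max (-1) (min 1 (-x)) = -max (-1) (min 1 x) := fun x => by
    simp only [max_def, min_def]
    split_ifs <;> linarith
  -- the reversor
  obtain ⟨S, hSrev, hSball, hSfix⟩ : ∃ S : (ℝ × ℝ) →L[ℝ] (ℝ × ℝ),
      (∀ q, (X ∘ clampSquare 1) (S q) = -S ((X ∘ clampSquare 1) q)) ∧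
      (∀ q ∈ Metric.ball (0 : ℝ × ℝ) 1, S q ∈ Metric.ball (0 : ℝ × ℝ) 1) ∧
      ((∀ q : ℝ × ℝ, q.1 = 0 → S q = q) ∨ ∀ q : ℝ × ℝ, q.2 = 0 → S q = q) := by
    rcases mul_eq_zero.1 hac with h | h
    · refine ⟨(scaleEquiv 1 (-1) one_ne_zero (by norm_num) : (ℝ × ℝ) →L[ℝ] (ℝ × ℝ)), fun q => ?_,
        fun q hq => ?_, Or.inr fun q hq => ?_⟩
      · simp only [ContinuousLinearEquiv.coe_coe, scaleEquiv_apply, Function.comp_apply, clampSquare,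
          hX, cubicField, h, one_mul, neg_one_mul, hm]
        ext <;> simp
      · simpa [scaleEquiv_apply, Prod.norm_def] using hq
      · ext <;> simp [scaleEquiv_apply, hq]
    · refine ⟨(scaleEquiv (-1) 1 (by norm_num) one_ne_zero : (ℝ × ℝ) →L[ℝ] (ℝ × ℝ)), fun q => ?_,
        fun q hq => ?_, Or.inl fun q hq => ?_⟩
      · simp only [ContinuousLinearEquiv.coe_coe, scaleEquiv_apply, Function.comp_apply, clampSquare,
          hX, cubicField, h, one_mul, neg_one_mul, hm]
        ext
        · simp
        · simp; ring
      · simpa [scaleEquiv_apply, Prod.norm_def] using hq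
      · ext <;> simp [scaleEquiv_apply, hq]
  have hper : ∀ γ : ℝ → ℝ × ℝ, (∀ t, HasDerivAt γ ((X ∘ clampSquare 1) (γ t)) t) → (∀ t, γ t ≠ 0) →
      γ 0 ∈ C.dom →
      turnConst a ω ^ 3 * ‖focusCoord a ω (C.fst (γ 0)) (C.snd (γ 0))‖ ≤ C.radius →
      ∃ T > 0, Function.Periodic γ T ∧ ∀ t, γ t ∈ Metric.ball (0 : ℝ × ℝ) 1 := by
    intro γ hγ hne h0 hρ
    have hc : Continuous γ := continuous_iff_continuousAt.2 fun t => (hγ t).continuousAt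
    obtain ⟨T₁, T₂, T₃, h12, h23, hdom, h1, h2, h3, h4⟩ :=
      C.exists_three_hits hω hω2 (by norm_num) hγ hne h0 hρ
    obtain ⟨s₁, s₂, hs, hs1, hs2, f1, f2⟩ : ∃ s₁ s₂, s₁ < s₂ ∧ T₁ ≤ s₁ ∧ s₂ ≤ T₃ ∧
        S (γ s₁) = γ s₁ ∧ S (γ s₂) = γ s₂ := by
      rcases hSfix with hf | hf
      · exact ⟨T₁, T₂, h12, le_rfl, h23.le, hf _ h1, hf _ h2⟩
      · obtain ⟨u, hu, hu0⟩ := exists_eq_zero_of_mul_neg (continuous_snd.comp hc) h12 h3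
        obtain ⟨v, hv, hv0⟩ := exists_eq_zero_of_mul_neg (continuous_snd.comp hc) h23 h4
        exact ⟨u, v, hu.2.trans hv.1, hu.1.le, hv.2.le, hf _ hu0, hf _ hv0⟩
    obtain ⟨p1, p2⟩ := periodic_of_reversible hK S hSrev hγ hs f1 f2 hSball
      fun t ht => C.dom_subset (hdom t ⟨hs1.trans ht.1, ht.2.trans hs2⟩)
    exact ⟨_, by linarith, p1, p2⟩
  refine ⟨hX ▸ cubicField_zero a c 1 0 d 0, {q | q = 0 ∨ ∃ γ : ℝ → ℝ × ℝ, γ 0 = q ∧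
    (∀ t, HasDerivAt γ (X (γ t)) t) ∧ (∀ t, γ t ≠ 0) ∧ ∃ T > 0, Function.Periodic γ T}, ?_, ?_⟩
  · have hk := pow_pos (turnConst_pos a ω) 3
    have ht := C.tendsto_norm.eventually (gt_mem_nhds (div_pos C.radius_pos hk))
    filter_upwards [C.isOpen_dom.mem_nhds C.zero_mem, ht] with q hq hqr
    rcases eq_or_ne q 0 with h | h
    · exact Or.inl h
    · refine Or.inr ?_
      obtain ⟨γ, hγ0, hγ⟩ := exists_integralCurve_clampSquare hXc zero_le_one q
      have hne : ∀ t, γ t ≠ 0 := ne_zero_of_clamped_integralCurve (σ := 1)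
        (fun t => by rw [one_smul, ← hX]; exact hγ t) (t₀ := 0) (by rwa [hγ0])
      obtain ⟨T, hT, h1, h2⟩ := hper γ hγ hne (by rwa [hγ0]) (by
        rw [hγ0]
        rw [lt_div_iff₀ hk] at hqr
        linarith)
      refine ⟨γ, hγ0, fun t => ?_, hne, T, hT, h1⟩
      rw [← hclamp _ (h2 t)]
      exact hγ t
  · rintro q (hq | ⟨γ, hγ0, hγ, hne, T, hT, hp⟩) hq0
    · exact absurd hq hq0
    · refine ⟨fun h => hq0 ?_, γ, hγ0, hγ, fun t => ⟨Or.inr ⟨fun u => γ (u + t), ?_, fun u => ?_,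
        fun u => hne _, T, hT, fun u => ?_⟩, hne t⟩, T, hT, hp⟩
      · rw [hX] at h
        have hy : q.2 = 0 := neg_eq_zero.1 (congrArg Prod.fst h)
        have hx := congrArg Prod.snd h
        simp only [cubicField, hy] at hx
        exact Prod.ext (by simpa using hx) hy
      · simp
      · exact (hγ (u + t)).comp_add_const u t
      · simp only
        rw [show u + T + t = u + t + T by ring, hp]

theorem isCenter_cubicField {a c A d : ℝ} (hA : 0 < A) (ha : a ^ 2 < 8 * A) (hac : a * c = 0) :
    IsCenter (cubicField a c A 0 d 0) (0, 0) := by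
  have hs : 0 < Real.sqrt A := Real.sqrt_pos.2 hA
  have hs2 : Real.sqrt A ^ 2 = A := Real.sq_sqrt hA.le
  have h := (isCenter_cubicField_of_reversible (a := a / Real.sqrt A) (c := c) (d := d)
    (by rw [div_pow, hs2, div_lt_iff₀ hA]; exact ha)
    (by rw [div_mul_eq_mul_div, hac, zero_div])).cubicField_scale (inv_ne_zero hs.ne')
  rwa [div_inv_eq_mul, div_mul_cancel₀ _ hs.ne', inv_pow, hs2, one_div, inv_inv, zero_div,
    zero_mul] at h

/-! ### The nilpotent form -/

theorem hasNilpotentForm_cubicField (a c A b d e : ℝ) :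
    HasNilpotentForm (cubicField a c A b d e) (0, 0) := by
  have hp : ∀ F : ℝ × ℝ → ℝ, F = (fun q => a * q.1 * q.2 - c * q.2 ^ 2 - A * q.1 ^ 3
      + b * q.1 ^ 2 * q.2 - d * q.1 * q.2 ^ 2 + e * q.2 ^ 3) →
      AnalyticAt ℝ F 0 ∧ F 0 = 0 ∧ fderiv ℝ F 0 = 0 := by
    rintro _ rfl
    refine ⟨ContDiffAt.analyticAt (ContDiff.contDiffAt (by fun_prop)), by simp, ?_⟩
    have h1 : HasFDerivAt (fun q : ℝ × ℝ => q.1) (ContinuousLinearMap.fst ℝ ℝ ℝ) 0 := hasFDerivAt_fst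
    have h2 : HasFDerivAt (fun q : ℝ × ℝ => q.2) (ContinuousLinearMap.snd ℝ ℝ ℝ) 0 := hasFDerivAt_snd
    have := ((((((h1.const_mul a).mul h2).sub ((h2.pow 2).const_mul c)).sub
      ((h1.pow 3).const_mul A)).add (((h1.pow 2).const_mul b).mul h2)).sub
      ((h1.const_mul d).mul (h2.pow 2))).add ((h2.pow 3).const_mul e)
    refine (this.congr_fderiv ?_).fderiv
    ext <;> simp
  obtain ⟨h1, h2, h3⟩ := hp _ rfl
  refine ⟨(scaleEquiv 1 (-1) one_ne_zero (by norm_num)).toLinearEquiv, 1, 0, _, one_pos,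
    analyticAt_const, rfl, by simp, h1, h2, h3, Eventually.of_forall fun q => ?_⟩
  have hq : (scaleEquiv 1 (-1) one_ne_zero (by norm_num)).toLinearEquiv.symm q = (q.1, -q.2) := by
    rw [LinearEquiv.symm_apply_eq]
    ext <;> simp [scaleEquiv_apply]
  rw [hq]
  ext
  · simp [scaleEquiv_apply, cubicField]
  · simp [scaleEquiv_apply, cubicField]
    ring

theorem mainTheorem9 (a₁₁ a₀₂ a₃₀ a₂₁ a₁₂ a₀₃ : ℝ) :
    IsNilpotentCenter (cubicField a₁₁ a₀₂ a₃₀ a₂₁ a₁₂ a₀₃) (0, 0) ↔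
      IsMonodromic (cubicField a₁₁ a₀₂ a₃₀ a₂₁ a₁₂ a₀₃) (0, 0) ∧
        a₂₁ - a₀₂ * a₁₁ = 0 ∧ a₀₃ = 0 ∧ a₀₂ * a₁₁ * a₃₀ = 0 ∧
          a₀₂ * a₁₁ * (3 * a₀₂ ^ 2 + 2 * a₁₂) = 0 := by
  constructor
  · rintro ⟨h, -⟩
    obtain ⟨hac, hb, he⟩ := h.eq_zero
    rw [mul_comm] at hac
    exact ⟨h.isMonodromic (cubicField_contDiff _ _ _ _ _ _), by rw [hb, hac, sub_zero], he,
      by rw [hac, zero_mul], by rw [hac, zero_mul]⟩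
  · rintro ⟨h, hb, rfl, hac, -⟩
    obtain ⟨hA, ha⟩ := h.pos_and_discrim_neg
    have hac : a₀₂ * a₁₁ = 0 := (mul_eq_zero.1 hac).resolve_right hA.ne'
    rw [hac, sub_zero] at hb
    subst hb
    exact ⟨isCenter_cubicField hA ha (by rw [mul_comm, hac]), hasNilpotentForm_cubicField _ _ _ _ _ _⟩
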